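/- Let $K$ be a field of characteristic $0$ and let $N,p\ge 1$ be integers. **The Poisson algebra $\mathcal W_p(N)=\mathcal W[gl(Np),N.sl(p)]$.** In $gl(p)$ let $e_-=\sum_{k=1}^{p-1}E_{k+1,k}$, $M_{j,j}=\sum_{k=1}^{p-j}\frac{(k+j-1)!\,(p-k)!}{(k-1)!\,(p-k-j)!}E_{k,k+j}$ and $M_{j,m-1}=[e_-,M_{j,m}]$ for $0\le j\le p-1$, $-j<m\le j$. The matrices $M^{jm}_{ab}=E_{ab}\otimes M_{j,m}$ ($1\le a,b\le N$, $-j\le m\le j$) form a basis of $gl(Np)=gl(N)\otimes gl(p)$. Put $\mathbb J=\sum J^{ab}_{jm}M^{jm}_{ab}$; the coordinates $J^{ab}_{jm}$ carry the Lie–Poisson bracket with $\{\mathrm{tr}(\lambda\mathbb J),\mathbb J\}=[\lambda,\mathbb J]$ for all $\lambda\in gl(Np)$. Impose the constraints that fix all coordinates $J^{ab}_{jm}$ with $m<j$ in such a way that $\mathbb J=1_N\otimes e_-+\sum_{a,b=1}^N\sum_{j=0}^{p-1}W_j^{ab}M^{jj}_{ab}$. Then $\mathcal W_p(N)$ is the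 polynomial algebra over $K$ in the $W_j^{ab}$ ($0\le j\le p-1$), with Poisson bracket the Dirac bracket of the coordinates $W_j^{ab}=J^{ab}_{jj}$ with respect to these (second class) constraints. Put $W_j^{ab}=0$ for $j\ge p$. For a family $(B_j^{ab})$ of elements, $(B_{s_1}\cdots B_{s_n})^{ab}$ denotes the $(a,b)$ entry of the product of the $N\times N$ matrices $B_{s_i}=(B_{s_i}^{ab})_{a,b}$; vectors $\vec s=(s_1,\dots,s_n)$ consist of integers $s_i\ge0$, and $|\vec s|=\sum_i s_i$. **The families.** A family ${}^{\pm}\bar W_j^{ab}\in\mathcal W_p(N)$ ($j\ge0$, $1\le a,b\le N$) is called *admissible of sign $\pm$* if ${}^{\pm}\bar W_0^{ab}=\bar W_0^{ab}=p\,W_0^{ab}$, $${}^{\pm}\bar W_1^{ab}=\pm\tfrac{p(p^2-1)}{6}W_1^{ab}+\tfrac{p(p\pm1)}{2}(W_0W_0)^{ab},$$ for every $j\ge2$ there are numbers $\alpha^{n,j}_{\vec s}\in K$ (independent of $a,b$) with $${}^{\pm}\bar W_j^{ab}=\sum_{n=1}^{j+1}\ \sum_{|\vec s|=j+1-n}\alpha^{n,j}_{\vec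 s}\,(W_{s_1}\cdots W_{s_n})^{ab},$$ and for all $a,b,c,d$ $$\{\bar W_0^{ab},{}^{\pm}\bar W_j^{cd}\}=\delta^{cb}\,{}^{\pm}\bar W_j^{ad}-\delta^{ad}\,{}^{\pm}\bar W_j^{cb}\qquad(j\ge0),$$ $$\{{}^{\pm}\bar W_1^{ab},{}^{\pm}\bar W_j^{cd}\}=\delta^{cb}\,{}^{\pm}\bar W_{j+1}^{ad}-\delta^{ad}\,{}^{\pm}\bar W_{j+1}^{cb}+\bar W_0^{cb}\,{}^{\pm}\bar W_j^{ad}-{}^{\pm}\bar W_j^{cb}\,\bar W_0^{ad}\qquad(j\ge1).$$ **Statement.** There are admissible families $({}^{+}\bar W_j^{ab})$ of sign $+$ and $({}^{-}\bar W_j^{ab})$ of sign $-$ such that each of the sets $\{{}^{\pm}\bar W_j^{ab}\}_{0\le j\le p-1}$ generates the algebra $\mathcal W_p(N)$, and such that the change of generators between them is, for all $j\ge0$, all $a,b$ and both choices of sign, $${}^{\pm}\bar W_j^{ab}=\sum_{n=1}^{j+1}(-1)^{j+n+1}\sum_{|\vec s|=j+1-n}\bigl({}^{\mp}\bar W_{s_1}\cdots{}^{\mp}\bar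 W_{s_n}\bigr)^{ab}.$$ If $N\ge2$, then this formula holds for every admissible family $({}^{+}\bar W_j^{ab})$ of sign $+$ and every admissible family $({}^{-}\bar W_j^{ab})$ of sign $-$. -/

import Mathlib

open scoped Nat Kronecker

noncomputable section

namespace FiniteW

variable (K : Type*) [Field K]

/-! ### The basis of `gl(Np) = gl(N) ⊗ gl(p)` adapted to the principal `sl(2)` of `N.sl(p)` -/

/-- The lowering operator `e₋ = ∑ₖ E_{k+1,k}` of the principal `sl(2)` in `gl(p)`. -/
def eMinus (p : ℕ) : Matrix (Fin p) (Fin p) K :=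
  Matrix.of fun i k => if (i : ℕ) = (k : ℕ) + 1 then 1 else 0

/-- The highest weight matrix `M_{j,j} = ∑ₖ a_{jj}^k E_{k,k+j}`, where
`a_{jj}^k = (k+j-1)! (p-k)! / ((k-1)! (p-k-j)!)`; rows and columns are numbered from `0` here,
so `k = i + 1`. No natural subtraction is truncated when the column `i + j` exists. -/
def highestM (p j : ℕ) : Matrix (Fin p) (Fin p) K :=
  Matrix.of fun i l =>
    if (l : ℕ) = (i : ℕ) + j then
      (((i : ℕ) + j)! * (p - 1 - (i : ℕ))! : K) / (((i : ℕ))! * (p - 1 - (i : ℕ) - j)!)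
    else 0

/-- The matrix `M_{j,m}` with `m = j - k`, obtained from `M_{j,j}` by applying `k` times
`[e₋, M_{j,m}] = M_{j,m-1}`. -/
def multM (p j k : ℕ) : Matrix (Fin p) (Fin p) K :=
  (fun A => eMinus K p * A - A * eMinus K p)^[k] (highestM K p j)

/-- The normalization `η_j = (2j)! (j!)² binom(p+j, 2j+1)`, for which
`tr(M_{j,m} M_{l,n}) = (-1)^m η_j δ_{jl} δ_{m+n,0}`. -/
def eta (p j : ℕ) : K := ((2 * j)! * (j !) ^ 2 * (p + j).choose (2 * j + 1) : ℕ)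

/-- Labels `(j, k, a, b)` of the basis elements `M_{ab}^{j,m} = E_{ab} ⊗ M_{j,m}` of `gl(Np)`:
here `0 ≤ j < p`, `m = j - k` with `0 ≤ k ≤ 2j`, and `a, b` are `gl(N)` indices. -/
abbrev Idx (N p : ℕ) : Type := (Σ j : Fin p, Fin (2 * (j : ℕ) + 1)) × Fin N × Fin N

/-- The basis element `M_{ab}^{j,m} = E_{ab} ⊗ M_{j,m}` of `gl(Np)`. -/
def basisM (N p : ℕ) (x : Idx N p) : Matrix (Fin N × Fin p) (Fin N × Fin p) K :=
  Matrix.single x.2.1 x.2.2 (1 : K) ⊗ₖ multM K p x.1.1 x.1.2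

/-- The dual basis of `basisM` for the trace form: the dual of `E_{ab} ⊗ M_{j,m}` is
`((-1)^m / η_j) E_{ba} ⊗ M_{j,-m}`. With `m = j - k` one has `-m = j - (2j - k)`, and
`(-1)^m = (-1)^(j+k)`. -/
def dualM (N p : ℕ) (x : Idx N p) : Matrix (Fin N × Fin p) (Fin N × Fin p) K :=
  ((-1) ^ ((x.1.1 : ℕ) + (x.1.2 : ℕ)) / eta K p x.1.1) •
    (Matrix.single x.2.2 x.2.1 (1 : K) ⊗ₖ multM K p x.1.1 (2 * (x.1.1 : ℕ) - (x.1.2 : ℕ)))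

/-- `ε₋ = 1_N ⊗ e₋`. -/
def epsMinus (N p : ℕ) : Matrix (Fin N × Fin p) (Fin N × Fin p) K :=
  (1 : Matrix (Fin N) (Fin N) K) ⊗ₖ eMinus K p

/-! ### The Poisson algebra of polynomial functions on `gl(Np)` -/

/-- Polynomials in the coordinates `J_{jm}^{ab}`. -/
abbrev FullAlg (N p : ℕ) : Type _ := MvPolynomial (Idx N p) K

/-- The matrix `𝕁 = ∑ J_{jm}^{ab} M_{ab}^{jm}` gathering the coordinates. -/
def genJ (N p : ℕ) : Matrix (Fin N × Fin p) (Fin N × Fin p) (FullAlg K N p) :=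
  ∑ x : Idx N p, (MvPolynomial.X x : FullAlg K N p) • (basisM K N p x).map MvPolynomial.C

/-- The bracket `{J_x, J_y}` of two coordinates, that is, the coefficient along `M_y` of the
matrix `{J_x, 𝕁}`, for the convention `{tr(λ𝕁), 𝕁} = [λ, 𝕁]`; note `J_x = tr(dualM x · 𝕁)`. -/
def coordBracket (N p : ℕ) (x y : Idx N p) : FullAlg K N p :=
  Matrix.trace ((dualM K N p y).map MvPolynomial.C *
    ((dualM K N p x).map MvPolynomial.C * genJ K N p -
      genJ K N p * (dualM K N p x).map MvPolynomial.C))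

/-- The Lie-Poisson bracket on polynomials in the `J_{jm}^{ab}`. -/
def poisson (N p : ℕ) (F G : FullAlg K N p) : FullAlg K N p :=
  ∑ x : Idx N p, ∑ y : Idx N p,
    MvPolynomial.pderiv x F * MvPolynomial.pderiv y G * coordBracket K N p x y

/-! ### Hamiltonian reduction: constraints, highest weight gauge, Dirac bracket -/

/-- Polynomials in the generators `W_j^{ab}`, `0 ≤ j < p`: the algebra underlying `𝒲_p(N)`. -/
abbrev WAlg (N p : ℕ) : Type _ := MvPolynomial (Fin p × Fin N × Fin N) K

/-- Labels of all constraints, first class ones (`m < 0`) together with the gauge fixing ones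
(`0 ≤ m < j`): the coordinates `J_{jm}^{ab}` with `m < j`. -/
abbrev ConIdx (N p : ℕ) : Type := {x : Idx N p // (x.1.2 : ℕ) ≠ 0}

/-- The value taken by `J_{jm}^{ab}`, `m < j`, on the constraint surface
`𝕁 = ε₋ + ∑ W_j^{ab} M_{ab}^{jj}`: the coordinate of `ε₋` along `M_{ab}^{jm}`. -/
def conValue (N p : ℕ) (x : Idx N p) : K := Matrix.trace (dualM K N p x * epsMinus K N p)

/-- The constraint `φ_α = J_α - (value of J_α)`. -/
def phi (N p : ℕ) (α : ConIdx N p) : FullAlg K N p :=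
  MvPolynomial.X α.1 - MvPolynomial.C (conValue K N p α.1)

/-- Applying the constraints: `J_{jj}^{ab} ↦ W_j^{ab}` and all other coordinates go to their
prescribed values. -/
def applyCon (N p : ℕ) : FullAlg K N p →ₐ[K] WAlg K N p :=
  MvPolynomial.aeval fun x =>
    if (x.1.2 : ℕ) = 0 then MvPolynomial.X (x.1.1, x.2) else MvPolynomial.C (conValue K N p x)

/-- The unconstrained lift `W_j^{ab} ↦ J_{jj}^{ab}`. -/
def unconstrained (N p : ℕ) : WAlg K N p →ₐ[K] FullAlg K N p :=
  MvPolynomial.rename fun y => (⟨y.1, 0⟩, y.2)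

/-- The matrix `Δ_{αβ} = {φ_α, φ_β}` on the constraint surface. The constraints are second
class, that is, `Δ` is invertible; its determinant is a nonzero constant. -/
def Delta (N p : ℕ) : Matrix (ConIdx N p) (ConIdx N p) (WAlg K N p) :=
  Matrix.of fun α β => applyCon K N p (poisson K N p (phi K N p α) (phi K N p β))

/-- The Poisson bracket of `𝒲_p(N)`, which is the Dirac bracket
`{F, G} - ∑ {F, φ_α} (Δ⁻¹)_{αβ} {φ_β, G}` of the unconstrained lifts, the constraints being
applied once the brackets have been computed. -/
def wBracket (N p : ℕ) (F G : WAlg K N p) : WAlg K N p :=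
  applyCon K N p (poisson K N p (unconstrained K N p F) (unconstrained K N p G)) -
    ∑ α : ConIdx N p, ∑ β : ConIdx N p,
      applyCon K N p (poisson K N p (unconstrained K N p F) (phi K N p α)) *
        (Delta K N p)⁻¹ α β *
        applyCon K N p (poisson K N p (phi K N p β) (unconstrained K N p G))

/-! ### The two families of generators -/

variable {K}

/-- The matrix `(W_j^{ab})_{a,b}` of original generators, with `W_j = 0` for `j ≥ p`. -/
def genW (K : Type*) [Field K] (N p : ℕ) (j : ℕ) : Matrix (Fin N) (Fin N) (WAlg K N p) :=
  Matrix.of fun a b => if h : j < p then MvPolynomial.X (⟨j, h⟩, a, b) else 0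

/-- The matrix product `B_{s₁} ⋯ B_{sₙ}`. -/
def word {R : Type*} [CommRing R] {N n : ℕ} (B : ℕ → Matrix (Fin N) (Fin N) R)
    (s : Fin n → ℕ) : Matrix (Fin N) (Fin N) R :=
  (List.ofFn fun i => B (s i)).prod

/-- The Kronecker symbol. -/
def kd (R : Type*) [CommRing R] {N : ℕ} (a b : Fin N) : R := if a = b then 1 else 0

/-- `B` is a family `{^ε W̄_j^{ab}}_{j ≥ 0}` of elements of `𝒲_p(N)` of sign `ε = ±1`. -/
structure IsBarFamily {N p : ℕ} (ε : ℤˣ) (B : ℕ → Matrix (Fin N) (Fin N) (WAlg K N p)) :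
    Prop where
  /-- `W̄_0 = p W_0` -/
  zero : B 0 = (p : K) • genW K N p 0
  /-- `^±W̄_1 = ± (p(p²-1)/6) W_1 + (p(p±1)/2) W_0 W_0` -/
  one : B 1 = (((ε : ℤ) : K) * (p * (p ^ 2 - 1) / 6)) • genW K N p 1 +
    ((p : K) * (p + ((ε : ℤ) : K)) / 2) • (genW K N p 0 * genW K N p 0)
  /-- `W̄_j = ∑_{n=1}^{j+1} ∑_{|s| = j+1-n} α_s^{n,j} W_{s₁} ⋯ W_{sₙ}` for some numbers `α` -/
  words : ∀ j, 2 ≤ j → ∃ α : (n : ℕ) → (Fin n → ℕ) → K,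
    B j = ∑ n ∈ Finset.Icc 1 (j + 1),
      ∑ s ∈ Finset.Nat.antidiagonalTuple n (j + 1 - n), α n s • word (genW K N p) s
  bracket_zero : ∀ (j : ℕ) (a b c d : Fin N),
    wBracket K N p (B 0 a b) (B j c d) =
      kd _ c b * B j a d - kd _ a d * B j c b
  bracket_one : ∀ j : ℕ, 1 ≤ j → ∀ a b c d : Fin N,
    wBracket K N p (B 1 a b) (B j c d) =
      kd _ c b * B (j + 1) a d - kd _ a d * B (j + 1) c b +
        B 0 c b * B j a d - B j c b * B 0 a d

/-- The first `p` members of the family generate the algebra `𝒲_p(N)`. -/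
def Generates {N p : ℕ} (B : ℕ → Matrix (Fin N) (Fin N) (WAlg K N p)) : Prop :=
  Algebra.adjoin K {w | ∃ j < p, ∃ a b : Fin N, w = B j a b} = ⊤

end FiniteW

end

namespace FiniteW

/-! ### The principal `sl(2)` in `gl(p)`: the action of `ad e₋` and the trace form. -/

section Principal

variable (K : Type*) [Field K]

/-! On the constraint surface write `𝕁 = ε₋ + W`, and let `X_j` be the bottom left `N × N` block of
`𝕁^{p+j}`. These blocks form the family of sign `+`. Grade `gl(p)` by giving `E_{i,l}` the degree `l
- i`. The commutator with `𝕁` of the gradient of an entry of `𝕁^m` telescopes to `E 𝕁^m - 𝕁^m E`,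
and for the bottom left corner the matrix unit `E` has the top degree `p - 1`, so the commutator
lives in degrees at least `0`. Highest weight gauge fixing (`exists_gauge`) shows that `Δ` is
invertible (`isUnit_Delta`) and that for functions with such gradients the Dirac bracket is the
plain Lie–Poisson bracket (`wBracket_eq_lieForm`). The brackets of the `X_j` are then explicit
(`wBracket_cornerX`). Expanding the powers of `𝕁` gives `X_j = c_j W_j` plus words of length at
least two, with `c_j ≠ 0` for `j < p`; triangularity yields generation (`generates_of_sub_mem`).

The change of generators says that `1 + ∑ Y_j (-t)^{j+1}` is the inverse of `1 + ∑ X_j t^{j+1}`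
(`barSeries_mul_twist`), a relation symmetric in the two families. Taking it as the definition of
`Y`, the bracket relations of sign `-` follow by differentiating an inverse, using `Y_1 = X_0 X_0 -
X_1` (`map_wDer_cornerY_one`).

For `N ≥ 2` an admissible family coincides with the constructed one of the same sign
(`IsBarFamily.eq_barFamily`). If two families agree up to `j ≥ 1`, the bracket with `W̄_1` forces
their next members to differ by a scalar matrix `z · 1`, where `z` Poisson commutes with all
`W̄_0^{ab}` and `W̄_1^{bb}`. Since `z · 1` is a combination of nonempty words, `z` has no purely
diagonal monomial (`isOffDiag_of_scalar_mem_wordSpan`). Give diagonal variables weight one and the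
others weight two: the leading parts of these derivations then force the lowest weight of `z` up
indefinitely, so `z = 0` (`IsTriangular.eq_zero_of_invariant`). -/

theorem sum_fin_ite_val {M : Type*} [AddCommMonoid M] {p : ℕ} (n : ℕ) (g : Fin p → M) :
    (∑ k : Fin p, if (k : ℕ) = n then g k else 0) = if h : n < p then g ⟨n, h⟩ else 0 := by
  split_ifs with h
  · rw [Finset.sum_eq_single ⟨n, h⟩]
    · simp
    · intro b _ hb
      rw [if_neg]
      rintro rfl
      exact hb rfl
    · simp
  · refine Finset.sum_eq_zero fun k _ => if_neg ?_
    have := k.2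
    omega

theorem multM_zero (p j : ℕ) : multM K p j 0 = highestM K p j := rfl

theorem multM_succ (p j k : ℕ) : multM K p j (k + 1) =
    eMinus K p * multM K p j k - multM K p j k * eMinus K p := by
  simp only [multM, Function.iterate_succ_apply']

variable {K} in
theorem eMinus_mul_apply {p : ℕ} (A : Matrix (Fin p) (Fin p) K) (i l : Fin p) :
    (eMinus K p * A) i l =
      if h : 0 < (i : ℕ) then A ⟨(i : ℕ) - 1, by omega⟩ l else 0 := by
  have h1 : ∀ k : Fin p, eMinus K p i k * A k l =
      if (k : ℕ) = (i : ℕ) - 1 then (if 0 < (i : ℕ) then A k l else 0) else 0 := by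
    intro k
    simp only [eMinus, Matrix.of_apply]
    split_ifs <;> first | omega | simp
  rw [Matrix.mul_apply, Finset.sum_congr rfl fun k _ => h1 k, sum_fin_ite_val]
  split_ifs <;> first | omega | rfl

variable {K} in
theorem mul_eMinus_apply {p : ℕ} (A : Matrix (Fin p) (Fin p) K) (i l : Fin p) :
    (A * eMinus K p) i l =
      if h : (l : ℕ) + 1 < p then A i ⟨(l : ℕ) + 1, h⟩ else 0 := by
  have h1 : ∀ k : Fin p, A i k * eMinus K p k l = if (k : ℕ) = (l : ℕ) + 1 then A i k else 0 := by
    intro k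
    simp only [eMinus, Matrix.of_apply]
    split_ifs <;> simp
  rw [Matrix.mul_apply, Finset.sum_congr rfl fun k _ => h1 k, sum_fin_ite_val]

variable [CharZero K]

theorem factorial_cast_ne_zero (n : ℕ) : ((n ! : ℕ) : K) ≠ 0 :=
  Nat.cast_ne_zero.2 (Nat.factorial_ne_zero n)

theorem highestM_zero (p : ℕ) : highestM K p 0 = 1 := by
  ext i l
  simp only [highestM, Matrix.of_apply, Matrix.one_apply, add_zero, Nat.sub_zero]
  by_cases h : i = l
  · subst h
    simp [div_self, factorial_cast_ne_zero K]
  · rw [if_neg, if_neg h]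
    exact fun h' => h (Fin.ext h'.symm)

theorem highestM_one_apply {p : ℕ} (i l : Fin p) : highestM K p 1 i l =
    if (l : ℕ) = (i : ℕ) + 1 then ((i : ℕ) + 1 : K) * ((p : K) - 1 - (i : ℕ)) else 0 := by
  simp only [highestM, Matrix.of_apply]
  split_ifs with h
  · obtain ⟨r, hr⟩ : ∃ r, p = (i : ℕ) + 2 + r := ⟨p - ((i : ℕ) + 2), by omega⟩
    have h1 : p - 1 - (i : ℕ) = r + 1 := by omega
    have h2 : r + 1 - 1 = r := by omega
    have h3 : ((p : ℕ) : K) = (i : ℕ) + 2 + r := by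
      conv_lhs => rw [hr]
      push_cast; ring
    have h4 := factorial_cast_ne_zero K (i : ℕ)
    have h5 := factorial_cast_ne_zero K r
    rw [h1, h2, h3, Nat.factorial_succ, Nat.factorial_succ]
    push_cast
    field_simp
    ring
  · rfl

/-- The factorials telescope along the superdiagonal. This makes `M_{j,j}` a power of `M_{1,1}`, so
that facts about `ad e₋` can be proved by induction on `j`. -/
theorem highestM_succ (p j : ℕ) : highestM K p (j + 1) = highestM K p 1 * highestM K p j := by
  ext i l
  have h1 : ∀ k : Fin p, highestM K p 1 i k * highestM K p j k l =
      if (k : ℕ) = (i : ℕ) + 1 then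
        ((i : ℕ) + 1 : K) * ((p : K) - 1 - (i : ℕ)) * highestM K p j k l else 0 := by
    intro k
    rw [highestM_one_apply]
    split_ifs <;> simp
  rw [Matrix.mul_apply, Finset.sum_congr rfl fun k _ => h1 k, sum_fin_ite_val]
  simp only [highestM, Matrix.of_apply]
  by_cases h : (l : ℕ) = (i : ℕ) + (j + 1)
  · have hl := l.2
    obtain ⟨r, hr⟩ : ∃ r, p = (i : ℕ) + j + 2 + r := ⟨p - ((i : ℕ) + j + 2), by omega⟩
    rw [if_pos h, dif_pos (by omega), if_pos (by omega)]
    have h1 : p - 1 - (i : ℕ) = (j + r) + 1 := by omega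
    have h2 : (j + r) + 1 - (j + 1) = r := by omega
    have h1' : p - 1 - ((i : ℕ) + 1) = j + r := by omega
    have h2' : j + r - j = r := by omega
    have h3 : ((p : ℕ) : K) = (i : ℕ) + j + 2 + r := by
      conv_lhs => rw [hr]
      push_cast; ring
    have h4 := factorial_cast_ne_zero K (i : ℕ)
    have h5 := factorial_cast_ne_zero K r
    have h6 : (i : ℕ) + 1 + j = (i : ℕ) + (j + 1) := by omega
    have h7 : ((i : ℕ) + 1 : K) ≠ 0 := Nat.cast_add_one_ne_zero _
    rw [h1, h2, h1', h2', h3, h6, Nat.factorial_succ (j + r), Nat.factorial_succ (i : ℕ)]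
    push_cast
    field_simp
    ring
  · rw [if_neg h]
    split_ifs <;> first | omega | simp

/-- `[e₋, e₊] = -h`, entrywise. -/
theorem multM_one_one (p : ℕ) : multM K p 1 1 =
    Matrix.diagonal fun i : Fin p => (2 * (i : ℕ) + 1 - p : K) := by
  ext i l
  rw [multM_succ, multM_zero, Matrix.sub_apply, eMinus_mul_apply, mul_eMinus_apply,
    Matrix.diagonal_apply]
  simp only [highestM_one_apply]
  have hi := i.2
  by_cases h : i = l
  · subst h
    simp only [if_true]
    by_cases h0 : 0 < (i : ℕ)
    · rw [dif_pos h0, if_pos (by omega), Nat.cast_sub (by omega)]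
      by_cases h1 : (i : ℕ) + 1 < p
      · rw [dif_pos h1]; push_cast; ring
      · have : (p : K) = (i : ℕ) + 1 := by
          have : p = (i : ℕ) + 1 := by omega
          conv_lhs => rw [this]
          push_cast; ring
        rw [dif_neg h1, this]; push_cast; ring
    · have h0' : (i : ℕ) = 0 := by omega
      rw [dif_neg h0]
      by_cases h1 : (i : ℕ) + 1 < p
      · rw [dif_pos h1, h0']; push_cast; ring
      · have : (p : K) = (i : ℕ) + 1 := by
          have : p = (i : ℕ) + 1 := by omega
          conv_lhs => rw [this]
          push_cast; ring
        rw [dif_neg h1, this, h0']; push_cast; ring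
  · have h' : (i : ℕ) ≠ l := fun h' => h (Fin.ext h')
    rw [if_neg h]
    split_ifs <;> first | omega | simp

theorem multM_one_two (p : ℕ) : multM K p 1 2 = (-2 : K) • eMinus K p := by
  ext i l
  rw [multM_succ, multM_one_one, Matrix.sub_apply, Matrix.mul_diagonal, Matrix.diagonal_mul,
    Matrix.smul_apply]
  simp only [eMinus, Matrix.of_apply]
  split_ifs with h
  · rw [h]; push_cast; simp; ring
  · simp

/-- Leibniz rule for the derivation `ad e₋`, which kills `M_{1,1}` after three steps; the last
coefficient is `binom(n,2)` times the `-2` of `multM_one_two`. The truncated indices `n - 1`, `n -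
2` only occur with coefficient zero. -/
theorem iterate_ad_mul {p : ℕ} (Y : ℕ → Matrix (Fin p) (Fin p) K)
    (hY : ∀ n, Y (n + 1) = eMinus K p * Y n - Y n * eMinus K p) (n : ℕ) :
    (fun A => eMinus K p * A - A * eMinus K p)^[n] (highestM K p 1 * Y 0) =
      highestM K p 1 * Y n + (n : K) • (multM K p 1 1 * Y (n - 1)) -
        ((n : K) * (n - 1)) • (eMinus K p * Y (n - 2)) := by
  have e1 : multM K p 1 1 = eMinus K p * highestM K p 1 - highestM K p 1 * eMinus K p := by
    rw [multM_succ, multM_zero]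
  have e2 : eMinus K p * multM K p 1 1 - multM K p 1 1 * eMinus K p = (-2 : K) • eMinus K p := by
    rw [← multM_succ, multM_one_two]
  have e3 : ∀ A B : Matrix (Fin p) (Fin p) K, eMinus K p * (A * B) - A * B * eMinus K p =
      (eMinus K p * A - A * eMinus K p) * B + A * (eMinus K p * B - B * eMinus K p) := by
    intro A B; noncomm_ring
  have e4 : ∀ B : Matrix (Fin p) (Fin p) K, eMinus K p * (eMinus K p * B) - eMinus K p * B * eMinus K p =
      eMinus K p * (eMinus K p * B - B * eMinus K p) := by
    intro B; noncomm_ring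
  induction n with
  | zero => simp
  | succ n ih =>
    rw [Function.iterate_succ_apply', ih]
    simp only [mul_add, mul_sub, add_mul, sub_mul, Matrix.mul_smul, Matrix.smul_mul]
    have s1 := e3 (highestM K p 1) (Y n)
    have s2 := e3 (multM K p 1 1) (Y (n - 1))
    have s3 := e4 (Y (n - 2))
    rw [← e1, ← hY] at s1
    rw [e2, ← hY] at s2
    rw [← hY] at s3
    obtain rfl | rfl | ⟨m, rfl⟩ : n = 0 ∨ n = 1 ∨ ∃ m, n = m + 2 := by
      rcases n with _ | _ | m
      · simp
      · simp
      · exact Or.inr (Or.inr ⟨m, rfl⟩)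
    · simp only [Nat.cast_zero, zero_smul, zero_mul, zero_add, sub_zero, add_zero, Nat.cast_one,
        one_smul, sub_self, mul_zero]
      rw [s1, add_comm]
    · norm_num at s1 s2 s3 ⊢
      rw [sub_eq_iff_eq_add] at s1 s2 s3
      rw [s1, s2]
      module
    · have t1 : m + 2 - 1 + 1 = m + 2 := rfl
      have t2 : m + 2 - 2 + 1 = m + 2 - 1 := rfl
      have t3 : m + 2 + 1 - 1 = m + 2 := rfl
      have t4 : m + 2 + 1 - 2 = m + 2 - 1 := rfl
      rw [t1] at s2
      rw [t2] at s3
      rw [t3, t4]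
      rw [sub_eq_iff_eq_add] at s1 s2 s3
      rw [s1, s2, s3]
      simp only [Matrix.smul_mul]
      push_cast
      module

/-- Induction on `j` through `iterate_ad_mul`: at step `2j + 2` the first two Leibniz terms vanish
by the second half of the induction hypothesis, and only the `e₋` term survives. -/
theorem multM_top (p j : ℕ) :
    multM K p j (2 * j) = ((-1) ^ j * ((2 * j)! : ℕ) : K) • eMinus K p ^ j ∧
      ∀ n, 2 * j < n → multM K p j n = 0 := by
  induction j with
  | zero =>
    have h0 : ∀ n, multM K p 0 (n + 1) = 0 := by
      intro n
      induction n with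
      | zero => rw [multM_succ, multM_zero, highestM_zero]; simp
      | succ n ih => rw [multM_succ, ih]; simp
    refine ⟨?_, ?_⟩
    · simp [multM_zero, highestM_zero]
    · rintro (_ | n) hn
      · omega
      · exact h0 n
  | succ j ih =>
    have key : ∀ n, multM K p (j + 1) n = highestM K p 1 * multM K p j n +
        (n : K) • (multM K p 1 1 * multM K p j (n - 1)) -
        ((n : K) * (n - 1)) • (eMinus K p * multM K p j (n - 2)) := by
      intro n
      rw [← iterate_ad_mul K (multM K p j) (multM_succ K p j), multM_zero, ← highestM_succ]
      rfl
    refine ⟨?_, fun n hn => ?_⟩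
    · rw [key, ih.2 _ (by omega), ih.2 _ (by omega)]
      have : 2 * (j + 1) - 2 = 2 * j := by omega
      rw [this, ih.1, show 2 * (j + 1) = 2 * j + 1 + 1 by ring, Nat.factorial_succ,
        Nat.factorial_succ, pow_succ' (eMinus K p)]
      simp only [mul_zero, smul_zero, add_zero, zero_sub, Matrix.mul_smul, smul_smul,
        ← neg_smul]
      congr 1
      push_cast
      ring
    · rw [key, ih.2 _ (by omega), ih.2 _ (by omega), ih.2 _ (by omega)]
      simp

omit [CharZero K] in
theorem multM_apply_eq_zero {p j n : ℕ} {i l : Fin p} (h : (l : ℕ) + n ≠ i + j) :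
    multM K p j n i l = 0 := by
  induction n generalizing i l with
  | zero =>
    rw [multM_zero]
    simp only [highestM, Matrix.of_apply]
    rw [if_neg (by omega)]
  | succ n ih =>
    rw [multM_succ, Matrix.sub_apply, eMinus_mul_apply, mul_eMinus_apply]
    have h1 : ∀ h0 : 0 < (i : ℕ), multM K p j n ⟨(i : ℕ) - 1, by omega⟩ l = 0 :=
      fun h0 => ih (by simp only; omega)
    have h2 : ∀ h0 : (l : ℕ) + 1 < p, multM K p j n i ⟨(l : ℕ) + 1, h0⟩ = 0 :=
      fun h0 => ih (by simp only; omega)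
    split_ifs <;> simp [*]

omit [CharZero K] in
-- Invariance of the trace form: each `ad e₋` moves to the other factor at the cost of a sign.
theorem trace_multM_mul (p j l k n : ℕ) : Matrix.trace (multM K p j k * multM K p l n) =
    (-1) ^ k * Matrix.trace (highestM K p j * multM K p l (n + k)) := by
  induction k generalizing n with
  | zero => simp [multM_zero]
  | succ k ih =>
    have h1 : n + (k + 1) = (n + 1) + k := by ring
    rw [h1, pow_succ, mul_assoc, mul_left_comm, ← ih, multM_succ, multM_succ, sub_mul, mul_sub,
      Matrix.trace_sub, Matrix.trace_sub, Matrix.mul_assoc, Matrix.trace_mul_comm (eMinus K p),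
      Matrix.mul_assoc, Matrix.mul_assoc]
    ring

omit [CharZero K] in
theorem trace_highestM_mul_eq_zero {p j l n : ℕ} (h : n ≠ j + l) :
    Matrix.trace (highestM K p j * multM K p l n) = 0 := by
  simp only [Matrix.trace, Matrix.diag_apply, Matrix.mul_apply]
  refine Finset.sum_eq_zero fun i _ => Finset.sum_eq_zero fun k _ => ?_
  by_cases h1 : (k : ℕ) = i + j
  · rw [multM_apply_eq_zero K (i := k) (l := i), mul_zero]
    omega
  · simp only [highestM, Matrix.of_apply]
    rw [if_neg h1, zero_mul]

end Principal

/-- Compare coefficients of `X^n` in `(1-X)^{-(a+1)} (1-X)^{-(b+1)} = (1-X)^{-(a+b+2)}`. -/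
theorem sum_antidiagonal_choose_mul_choose (a b n : ℕ) :
    ∑ x ∈ Finset.HasAntidiagonal.antidiagonal n, (a + x.1).choose a * (b + x.2).choose b =
      (a + b + 1 + n).choose (a + b + 1) := by
  have h := congrArg (PowerSeries.coeff n) (pow_add (PowerSeries.mk (1 : ℕ → ℤ)) (a + 1) (b + 1))
  rw [show a + 1 + (b + 1) = (a + b + 1) + 1 by ring, PowerSeries.mk_one_pow_eq_mk_choose_add,
    PowerSeries.mk_one_pow_eq_mk_choose_add, PowerSeries.mk_one_pow_eq_mk_choose_add,
    PowerSeries.coeff_mul] at h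
  simp only [PowerSeries.coeff_mk] at h
  exact_mod_cast h.symm

section Principal

variable (K : Type*) [Field K]

theorem eMinus_pow_apply (p j : ℕ) (i l : Fin p) :
    (eMinus K p ^ j) i l = if (i : ℕ) = l + j then 1 else 0 := by
  induction j generalizing i l with
  | zero =>
    rw [pow_zero, Matrix.one_apply]
    simp [Fin.ext_iff]
  | succ j ih =>
    have hi := i.2
    rw [pow_succ', eMinus_mul_apply]
    simp only [ih]
    split_ifs <;> first | omega | rfl

variable [CharZero K]

/-- The trace is the sum of the entries of `M_{j,j}`. In row `i` the entry is `(j!)² binom(j+i, j)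
binom(p-1-i, j)`, and the sum is a Vandermonde convolution. -/
theorem trace_highestM_mul_pow (p j : ℕ) (hj : j < p) :
    Matrix.trace (highestM K p j * eMinus K p ^ j) =
      (((j !) ^ 2 * (p + j).choose (2 * j + 1) : ℕ) : K) := by
  obtain ⟨n, rfl⟩ : ∃ n, p = n + 1 + j := ⟨p - 1 - j, by omega⟩
  have h1 : ∀ i k : Fin (n + 1 + j), highestM K (n + 1 + j) j i k * (eMinus K (n + 1 + j) ^ j) k i =
      if (k : ℕ) = i + j then highestM K (n + 1 + j) j i k else 0 := by
    intro i k
    rw [eMinus_pow_apply]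
    split_ifs <;> simp
  simp only [Matrix.trace, Matrix.diag_apply, Matrix.mul_apply, h1, sum_fin_ite_val]
  have h2 : ∀ i : Fin (n + 1 + j),
      (if h : (i : ℕ) + j < n + 1 + j then highestM K (n + 1 + j) j i ⟨(i : ℕ) + j, h⟩ else 0) =
      if (i : ℕ) ∈ Finset.range (n + 1) then
        (((j !) ^ 2 * ((j + i).choose j * (j + (n - i)).choose j) : ℕ) : K) else 0 := by
    intro i
    by_cases h : (i : ℕ) + j < n + 1 + j
    · rw [dif_pos h, if_pos (Finset.mem_range.2 (by omega))]
      simp only [highestM, Matrix.of_apply, if_true]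
      have e1 : n + 1 + j - 1 - (i : ℕ) = j + (n - i) := by omega
      have e2 : j + (n - (i : ℕ)) - j = n - i := by omega
      rw [e1, e2]
      have f1 := Nat.add_choose_mul_factorial_mul_factorial j (i : ℕ)
      have f2 := Nat.add_choose_mul_factorial_mul_factorial j (n - (i : ℕ))
      rw [← Nat.choose_symm_add] at f1 f2
      rw [div_eq_iff (mul_ne_zero (factorial_cast_ne_zero K _) (factorial_cast_ne_zero K _)),
        add_comm (i : ℕ) j, ← f1, ← f2]
      push_cast
      ring
    · rw [dif_neg h, if_neg (by rw [Finset.mem_range]; omega)]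
  rw [Finset.sum_congr rfl fun i _ => h2 i,
    Fin.sum_univ_eq_sum_range (fun i => if i ∈ Finset.range (n + 1) then
        (((j !) ^ 2 * ((j + i).choose j * (j + (n - i)).choose j) : ℕ) : K) else 0),
    ← Finset.sum_filter, ← Nat.cast_sum, ← Finset.mul_sum]
  congr 2
  have h3 : Finset.filter (fun i => i ∈ Finset.range (n + 1)) (Finset.range (n + 1 + j)) =
      Finset.range (n + 1) := by
    ext x; simp only [Finset.mem_filter, Finset.mem_range]; omega
  rw [h3, ← Finset.Nat.sum_antidiagonal_eq_sum_range_succ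
    (fun a b => (j + a).choose j * (j + b).choose j), sum_antidiagonal_choose_mul_choose]
  congr 1 <;> ring

theorem trace_highestM_mul_multM_top (p j : ℕ) (hj : j < p) :
    Matrix.trace (highestM K p j * multM K p j (2 * j)) = (-1) ^ j * eta K p j := by
  rw [(multM_top K p j).1, Matrix.mul_smul, Matrix.trace_smul, trace_highestM_mul_pow K p j hj,
    eta, smul_eq_mul]
  push_cast
  ring

theorem eta_ne_zero {p j : ℕ} (hj : j < p) : eta K p j ≠ 0 := by
  rw [eta, Nat.cast_ne_zero]
  have := Nat.choose_pos (n := p + j) (k := 2 * j + 1) (by omega)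
  positivity

/-- Unless the degrees cancel, the trace is zero. If they do and `j ≠ l`, moving every `ad e₋` onto
the factor of smaller spin applies it more often than that factor survives. -/
theorem trace_multM_dual (p : ℕ) {j l k n : ℕ} (hj : j < p) (hk : k ≤ 2 * j) (hn : n ≤ 2 * l) :
    Matrix.trace (multM K p j (2 * j - k) * multM K p l n) =
      if j = l ∧ k = n then (-1) ^ (j + k) * eta K p j else 0 := by
  rw [trace_multM_mul]
  by_cases h : n + (2 * j - k) = j + l
  · by_cases h1 : 2 * l < n + (2 * j - k)
    · rw [(multM_top K p l).2 _ h1, if_neg (by omega)]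
      simp
    · by_cases h2 : n + (2 * j - k) ≤ 2 * j
      · have h3 : j = l := by omega
        subst h3
        have h4 : k = n := by omega
        subst h4
        have h5 : k + (2 * j - k) = 2 * j := by omega
        rw [h5, trace_highestM_mul_multM_top K p j hj, if_pos ⟨rfl, rfl⟩, ← mul_assoc, ← pow_add]
        congr 1
        have h6 : 2 * j - k + j + 2 * k = j + k + 2 * j := by omega
        have h7 := congrArg (fun x => (-1 : K) ^ x) h6
        simpa [pow_add, pow_mul] using h7
      · have h3 : Matrix.trace (highestM K p j * multM K p l (n + (2 * j - k))) = 0 := by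
          have h4 := trace_multM_mul K p l j (n + (2 * j - k)) 0
          rw [Matrix.trace_mul_comm, multM_zero, (multM_top K p j).2 _ (by omega)] at h4
          simpa using h4
        rw [h3, mul_zero, if_neg (by omega)]
  · rw [trace_highestM_mul_eq_zero K h, mul_zero, if_neg (by omega)]

end Principal

end FiniteW

noncomputable section

namespace FiniteW

/-! ### The matrices `M_{ab}^{jm}` are a basis, with dual basis `dualM`. -/

section DualBasis

variable (K : Type*) [Field K] [CharZero K]

theorem trace_dualM_mul_basisM (N p : ℕ) (x y : Idx N p) :
    Matrix.trace (dualM K N p x * basisM K N p y) = if x = y then 1 else 0 := by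
  obtain ⟨⟨j, k⟩, a, b⟩ := x
  obtain ⟨⟨l, n⟩, c, d⟩ := y
  have hk : (k : ℕ) ≤ 2 * j := by have := k.2; omega
  have hn : (n : ℕ) ≤ 2 * l := by have := n.2; omega
  simp only [dualM, basisM, Matrix.smul_mul, Matrix.trace_smul, ← Matrix.mul_kronecker_mul,
    Matrix.trace_kronecker, trace_multM_dual K p j.2 hk hn]
  by_cases h : (j : ℕ) = l ∧ (k : ℕ) = n
  · obtain ⟨h1, h2⟩ := h
    obtain rfl := Fin.ext h1
    obtain rfl := Fin.ext h2
    have h3 : Matrix.trace (Matrix.single b a (1 : K) * Matrix.single c d 1) =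
        if a = c ∧ b = d then 1 else 0 := by
      by_cases hac : a = c
      · subst hac
        rw [Matrix.single_mul_single_same]
        by_cases hbd : b = d
        · subst hbd; simp
        · simp [hbd, Matrix.trace_single_eq_of_ne]
      · rw [Matrix.single_mul_single_of_ne _ _ _ _ hac]
        simp [hac]
    rw [h3]
    simp only [and_self, if_true, Prod.mk.injEq, true_and, smul_eq_mul]
    split_ifs with h4
    · have := eta_ne_zero K j.2
      rw [one_mul, div_mul_eq_mul_div, ← mul_assoc, ← pow_add, ← two_mul, pow_mul]
      simp [this]
    · simp
  · rw [if_neg h, if_neg]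
    · simp
    · intro h'
      simp only [Prod.mk.injEq, Sigma.mk.injEq] at h'
      obtain ⟨⟨rfl, h2⟩, -⟩ := h'
      exact h ⟨rfl, by rw [eq_of_heq h2]⟩

omit [CharZero K] [Field K] in
theorem card_idx (N p : ℕ) :
    Fintype.card (Idx N p) = Fintype.card ((Fin N × Fin p) × (Fin N × Fin p)) := by
  have h : ∀ n : ℕ, ∑ i ∈ Finset.range n, (2 * i + 1) = n * n := by
    intro n
    induction n with
    | zero => simp
    | succ n ih => rw [Finset.sum_range_succ, ih]; ring
  simp only [Fintype.card_prod, Fintype.card_sigma, Fintype.card_fin]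
  rw [Fin.sum_univ_eq_sum_range (fun i => 2 * i + 1), h]
  ring

/-- By the count `∑ (2j+1) = p²` the biorthogonality relation is an identity `D * B = 1` of square
matrices; the completeness relation is `B * D = 1`, so no separate spanning argument is needed. -/
theorem sum_basisM_mul_dualM (N p : ℕ) (u v u' v' : Fin N × Fin p) :
    ∑ x, basisM K N p x v u * dualM K N p x u' v' = if u = u' ∧ v = v' then 1 else 0 := by
  let D : Matrix (Idx N p) ((Fin N × Fin p) × (Fin N × Fin p)) K :=
    Matrix.of fun x w => dualM K N p x w.1 w.2
  let B : Matrix ((Fin N × Fin p) × (Fin N × Fin p)) (Idx N p) K :=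
    Matrix.of fun w x => basisM K N p x w.2 w.1
  have h : D * B = 1 := by
    ext x y
    rw [Matrix.one_apply, ← trace_dualM_mul_basisM, Matrix.mul_apply, Fintype.sum_prod_type]
    simp only [Matrix.trace, Matrix.diag_apply, Matrix.mul_apply, D, B, Matrix.of_apply]
  rw [Matrix.mul_eq_one_comm_of_card_eq _ _ K (card_idx N p)] at h
  have := congrFun (congrFun h (u, v)) (u', v')
  rw [Matrix.mul_apply, Matrix.one_apply] at this
  simpa only [D, B, Matrix.of_apply, Prod.mk.injEq] using this

end DualBasis

/-! ### The constraint surface and expansions in the dual bases. -/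

section Slice

variable (K : Type*) [Field K] (N p : ℕ)

/-- Matrices over `gl(Np)` with entries in the algebra underlying `𝒲_p(N)`. -/
abbrev MatW : Type _ := Matrix (Fin N × Fin p) (Fin N × Fin p) (WAlg K N p)

/-- The dual basis, with entries seen in `𝒲_p(N)`. -/
def dualW (x : Idx N p) : MatW K N p := (dualM K N p x).map MvPolynomial.C

/-- The basis, with entries seen in `𝒲_p(N)`. -/
def basisW (x : Idx N p) : MatW K N p := (basisM K N p x).map MvPolynomial.C

variable {N p} in
/-- The label of the highest weight coordinate `J_{jj}^{ab}`. -/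
def hwIdx (y : Fin p × Fin N × Fin N) : Idx N p := (⟨y.1, 0⟩, y.2)

/-- The matrix `𝕁` on the constraint surface. -/
def sliceJ : MatW K N p := (genJ K N p).map (applyCon K N p)

theorem hwIdx_injective : Function.Injective (hwIdx (N := N) (p := p)) := by
  rintro ⟨j, a⟩ ⟨l, b⟩ h
  simp only [hwIdx, Prod.mk.injEq, Sigma.mk.injEq] at h
  rw [h.1.1, h.2]

theorem sum_idx {M : Type*} [AddCommMonoid M] (f : Idx N p → M) :
    ∑ x, f x = ∑ y, f (hwIdx y) + ∑ α : ConIdx N p, f α.1 := by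
  classical
  rw [← Finset.sum_filter_add_sum_filter_not Finset.univ (fun x : Idx N p => (x.1.2 : ℕ) = 0)]
  congr 1
  · symm
    refine Finset.sum_nbij hwIdx ?_ ((hwIdx_injective N p).injOn) ?_ fun _ _ => rfl
    · intro y _
      simp [hwIdx]
    · rintro ⟨⟨j, k⟩, a⟩ h
      simp only [Finset.coe_filter, Finset.mem_univ, true_and, Set.mem_ofPred_eq] at h
      refine ⟨(j, a), by simp, ?_⟩
      have : k = 0 := Fin.ext h
      simp [hwIdx, this]
  · rw [Finset.sum_subtype]
    simp

variable [CharZero K]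

theorem sum_trace_dualW_smul (M : MatW K N p) :
    ∑ x, Matrix.trace (dualW K N p x * M) • basisW K N p x = M := by
  ext v u : 2
  have h : ∀ x, Matrix.trace (dualW K N p x * M) * basisW K N p x v u =
      ∑ u', ∑ v', MvPolynomial.C (basisM K N p x v u * dualM K N p x u' v') * M v' u' := by
    intro x
    simp only [Matrix.trace, Matrix.diag_apply, Matrix.mul_apply, dualW, basisW, Matrix.map_apply,
      Finset.sum_mul, map_mul]
    refine Finset.sum_congr rfl fun _ _ => Finset.sum_congr rfl fun _ _ => ?_
    ring
  simp only [Matrix.sum_apply, Matrix.smul_apply, smul_eq_mul, h]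
  rw [Finset.sum_comm]
  simp_rw [Finset.sum_comm (s := Finset.univ (α := Idx N p)), ← Finset.sum_mul, ← map_sum,
    sum_basisM_mul_dualM]
  rw [Finset.sum_eq_single u, Finset.sum_eq_single v]
  · simp
  · intro b _ hb
    simp [hb.symm]
  · simp
  · intro b _ hb
    simp [hb.symm]
  · simp

theorem sum_trace_basisW_smul (M : MatW K N p) :
    ∑ x, Matrix.trace (M * basisW K N p x) • dualW K N p x = M := by
  ext v u : 2
  have h : ∀ x, Matrix.trace (M * basisW K N p x) * dualW K N p x v u =
      ∑ u', ∑ v', MvPolynomial.C (basisM K N p x v' u' * dualM K N p x v u) * M u' v' := by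
    intro x
    simp only [Matrix.trace, Matrix.diag_apply, Matrix.mul_apply, dualW, basisW, Matrix.map_apply,
      Finset.sum_mul, map_mul]
    refine Finset.sum_congr rfl fun _ _ => Finset.sum_congr rfl fun _ _ => ?_
    ring
  simp only [Matrix.sum_apply, Matrix.smul_apply, smul_eq_mul, h]
  rw [Finset.sum_comm]
  simp_rw [Finset.sum_comm (s := Finset.univ (α := Idx N p)), ← Finset.sum_mul, ← map_sum,
    sum_basisM_mul_dualM]
  rw [Finset.sum_eq_single v, Finset.sum_eq_single u]
  · simp
  · intro b _ hb
    simp [hb]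
  · simp
  · intro b _ hb
    simp [hb]
  · simp

theorem trace_dualW_mul_basisW (x y : Idx N p) :
    Matrix.trace (dualW K N p x * basisW K N p y) = if x = y then 1 else 0 := by
  have h := congrArg (MvPolynomial.C (σ := Fin p × Fin N × Fin N)) (trace_dualM_mul_basisM K N p x y)
  rw [AddMonoidHom.map_trace, Matrix.map_mul] at h
  rw [dualW, basisW, h]
  split_ifs <;> simp

end Slice
end FiniteW

end

noncomputable section

namespace FiniteW

/-! ### Commutators and the filtration by the principal grading. -/

section Filtration

/-- The commutator of two matrices. -/
def comm {R n : Type*} [CommRing R] [Fintype n] (A B : Matrix n n R) : Matrix n n R := A * B - B * A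

section Commutator

variable {R n ι : Type*} [CommRing R] [Fintype n]

theorem comm_add_left (A B C : Matrix n n R) : comm (A + B) C = comm A C + comm B C := by
  simp only [comm, add_mul, mul_add]; abel

theorem comm_add_right (A B C : Matrix n n R) : comm A (B + C) = comm A B + comm A C := by
  simp only [comm, add_mul, mul_add]; abel

theorem comm_smul_left (c : R) (A B : Matrix n n R) : comm (c • A) B = c • comm A B := by
  simp only [comm, Matrix.smul_mul, Matrix.mul_smul, smul_sub]

theorem comm_sum_left (s : Finset ι) (A : ι → Matrix n n R) (B : Matrix n n R) :
    comm (∑ i ∈ s, A i) B = ∑ i ∈ s, comm (A i) B := by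
  simp only [comm, Finset.sum_mul, Finset.mul_sum, Finset.sum_sub_distrib]

theorem comm_zero_left (B : Matrix n n R) : comm 0 B = 0 := by simp [comm]

end Commutator

variable {R : Type*} [CommRing R] {N p : ℕ}

/-- The matrix has only components of degree at least `r` for the grading of `gl(p)` in which
`E_{i,l}` has degree `l - i`. -/
def DegGE (r : ℤ) (M : Matrix (Fin N × Fin p) (Fin N × Fin p) R) : Prop :=
  ∀ a b (i l : Fin p), (l : ℤ) - i < r → M (a, i) (b, l) = 0

theorem DegGE.mono {r s : ℤ} {M : Matrix (Fin N × Fin p) (Fin N × Fin p) R} (h : DegGE s M)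
    (hrs : r ≤ s) : DegGE r M := fun a b i l hil => h a b i l (by omega)

theorem DegGE.add {r : ℤ} {M M' : Matrix (Fin N × Fin p) (Fin N × Fin p) R} (h : DegGE r M)
    (h' : DegGE r M') : DegGE r (M + M') := fun a b i l hil => by
  rw [Matrix.add_apply, h a b i l hil, h' a b i l hil, add_zero]

theorem DegGE.sub {r : ℤ} {M M' : Matrix (Fin N × Fin p) (Fin N × Fin p) R} (h : DegGE r M)
    (h' : DegGE r M') : DegGE r (M - M') := fun a b i l hil => by
  rw [Matrix.sub_apply, h a b i l hil, h' a b i l hil, sub_zero]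

theorem DegGE.smul {r : ℤ} {M : Matrix (Fin N × Fin p) (Fin N × Fin p) R} (h : DegGE r M)
    (c : R) : DegGE r (c • M) := fun a b i l hil => by
  rw [Matrix.smul_apply, h a b i l hil, smul_zero]

theorem DegGE.sum {ι : Type*} {r : ℤ} (s : Finset ι)
    {M : ι → Matrix (Fin N × Fin p) (Fin N × Fin p) R} (h : ∀ x ∈ s, DegGE r (M x)) :
    DegGE r (∑ x ∈ s, M x) := fun a b i l hil => by
  rw [Matrix.sum_apply, Finset.sum_eq_zero fun x hx => h x hx a b i l hil]

theorem DegGE.mul {r s : ℤ} {M M' : Matrix (Fin N × Fin p) (Fin N × Fin p) R} (h : DegGE r M)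
    (h' : DegGE s M') : DegGE (r + s) (M * M') := fun a b i l hil => by
  rw [Matrix.mul_apply]
  refine Finset.sum_eq_zero fun x _ => ?_
  obtain ⟨c, k⟩ := x
  by_cases hk : (k : ℤ) - i < r
  · rw [h a c i k hk, zero_mul]
  · rw [h' c b k l (by omega), mul_zero]

theorem DegGE.comm {r s : ℤ} {M M' : Matrix (Fin N × Fin p) (Fin N × Fin p) R} (h : DegGE r M)
    (h' : DegGE s M') : DegGE (r + s) (comm M M') := by
  exact (h.mul h').sub ((h'.mul h).mono (by omega))

theorem DegGE.trace_eq_zero {r : ℤ} {M : Matrix (Fin N × Fin p) (Fin N × Fin p) R}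
    (h : DegGE r M) (hr : 0 < r) : Matrix.trace M = 0 :=
  Finset.sum_eq_zero fun x _ => h x.1 x.1 x.2 x.2 (by omega)

theorem DegGE.eq_zero {r : ℤ} {M : Matrix (Fin N × Fin p) (Fin N × Fin p) R}
    (h : DegGE r M) (hr : (p : ℤ) ≤ r) : M = 0 := by
  ext ⟨a, i⟩ ⟨b, l⟩
  have := l.2
  exact h a b i l (by omega)

theorem degGE_of_le {r : ℤ} (M : Matrix (Fin N × Fin p) (Fin N × Fin p) R) (hr : r ≤ 1 - p) :
    DegGE r M := fun a b i l hil => by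
  have := i.2
  omega

end Filtration

/-! ### Degrees on the constraint surface and highest weight gauge fixing. -/

section Slice

variable (K : Type*) [Field K] (N p : ℕ)

theorem degGE_basisW (x : Idx N p) : DegGE ((x.1.1 : ℤ) - (x.1.2 : ℕ)) (basisW K N p x) := by
  intro a b i l h
  rw [basisW, Matrix.map_apply, basisM, Matrix.kroneckerMap_apply,
    multM_apply_eq_zero K (by simp only; omega), mul_zero, map_zero]

theorem degGE_dualW (x : Idx N p) : DegGE ((x.1.2 : ℕ) - (x.1.1 : ℤ)) (dualW K N p x) := by
  intro a b i l h
  have := x.1.2.2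
  rw [dualW, Matrix.map_apply, dualM, Matrix.smul_apply, Matrix.kroneckerMap_apply,
    multM_apply_eq_zero K (by simp only; omega), mul_zero, smul_zero, map_zero]

/-- The part `∑ W_j^{ab} M_{ab}^{jj}` of the matrix `𝕁` on the constraint surface. -/
def sliceW : MatW K N p :=
  ∑ y, (MvPolynomial.X y : WAlg K N p) • basisW K N p (hwIdx y)

theorem degGE_sliceW : DegGE 0 (sliceW K N p) :=
  DegGE.sum _ fun y _ => ((degGE_basisW K N p (hwIdx y)).smul _).mono (by simp [hwIdx])

theorem map_C_genJ (x : Idx N p) : ((basisM K N p x).map (MvPolynomial.C (σ := Idx N p))).map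
    (applyCon K N p) = basisW K N p x := by
  ext u v : 2
  simp only [Matrix.map_apply, basisW, applyCon, MvPolynomial.aeval_C, MvPolynomial.algebraMap_eq]

theorem map_C_dualM (x : Idx N p) : ((dualM K N p x).map (MvPolynomial.C (σ := Idx N p))).map
    (applyCon K N p) = dualW K N p x := by
  ext u v : 2
  simp only [Matrix.map_apply, dualW, applyCon, MvPolynomial.aeval_C, MvPolynomial.algebraMap_eq]

theorem sliceJ_eq_sum : sliceJ K N p =
    ∑ x, (applyCon K N p (MvPolynomial.X x)) • basisW K N p x := by
  ext u v : 2
  simp only [sliceJ, genJ, Matrix.map_apply, Matrix.sum_apply, Matrix.smul_apply, smul_eq_mul,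
    map_sum, map_mul, ← map_C_genJ]

theorem applyCon_X_con (α : ConIdx N p) :
    applyCon K N p (MvPolynomial.X α.1) = MvPolynomial.C (conValue K N p α.1) := by
  rw [applyCon, MvPolynomial.aeval_X, if_neg α.2]

theorem applyCon_X_hw (y : Fin p × Fin N × Fin N) :
    applyCon K N p (MvPolynomial.X (hwIdx y)) = MvPolynomial.X y := by
  rw [applyCon, MvPolynomial.aeval_X, if_pos (by simp [hwIdx])]
  rfl

/-- `ε₋` with entries seen in `𝒲_p(N)`. -/
def epsW : MatW K N p := (epsMinus K N p).map MvPolynomial.C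

theorem epsW_apply (a b : Fin N) (i l : Fin p) : epsW K N p (a, i) (b, l) =
    if a = b ∧ (i : ℕ) = l + 1 then 1 else 0 := by
  simp only [epsW, epsMinus, Matrix.map_apply, Matrix.kroneckerMap_apply, eMinus, Matrix.of_apply,
    Matrix.one_apply]
  by_cases h1 : a = b <;> by_cases h2 : (i : ℕ) = l + 1 <;> simp [h1, h2]

theorem degGE_epsW : DegGE (-1) (epsW K N p) := by
  intro a b i l h
  rw [epsW_apply, if_neg]
  rintro ⟨-, h'⟩
  omega

/-- The dual of a highest weight vector `M_{j,j}` has degree `-j` and `ε₋` has degree `-1`, so their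
product is strictly of negative degree. -/
theorem trace_dualW_mul_epsW_hw (y : Fin p × Fin N × Fin N) :
    Matrix.trace (dualW K N p (hwIdx y) * epsW K N p) = 0 := by
  simp only [Matrix.trace, Matrix.diag_apply, Matrix.mul_apply]
  refine Finset.sum_eq_zero fun u _ => Finset.sum_eq_zero fun v _ => ?_
  obtain ⟨a, i⟩ := u
  obtain ⟨b, l⟩ := v
  rw [epsW_apply]
  split_ifs with h
  · rw [dualW, Matrix.map_apply, dualM, Matrix.smul_apply, Matrix.kroneckerMap_apply,
      multM_apply_eq_zero K (by simp only [hwIdx, Fin.val_zero]; omega)]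
    simp
  · simp

theorem trace_dualW_mul_epsW (x : Idx N p) :
    Matrix.trace (dualW K N p x * epsW K N p) = MvPolynomial.C (conValue K N p x) := by
  rw [conValue, AddMonoidHom.map_trace, Matrix.map_mul]
  rfl

theorem comm_basisW_epsW (x z : Idx N p) (hj : (x.1.1 : ℕ) = z.1.1) (hk : (x.1.2 : ℕ) = z.1.2 + 1)
    (ha : x.2 = z.2) : comm (basisW K N p z) (epsW K N p) = - basisW K N p x := by
  rw [comm, basisW, epsW, basisW, ← Matrix.map_mul, ← Matrix.map_mul,
    ← Matrix.map_sub _ (map_sub _), basisM, basisM, epsMinus, ← Matrix.mul_kronecker_mul,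
    ← Matrix.mul_kronecker_mul, congrArg₂ (multM K p) hj hk, ha, multM_succ, Matrix.mul_one,
    Matrix.one_mul]
  ext u v : 2
  simp only [Matrix.map_apply, Matrix.sub_apply, Matrix.neg_apply, Matrix.kroneckerMap_apply,
    ← map_neg]
  rw [← mul_sub, ← mul_neg, neg_sub]

variable [CharZero K]

theorem sliceJ_eq : sliceJ K N p = epsW K N p + sliceW K N p := by
  conv_rhs => rw [← sum_trace_dualW_smul K N p (epsW K N p), sum_idx]
  rw [sliceJ_eq_sum, sum_idx, sliceW, add_comm]
  simp only [trace_dualW_mul_epsW_hw, zero_smul, Finset.sum_const_zero, zero_add]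
  simp only [applyCon_X_hw, applyCon_X_con, trace_dualW_mul_epsW]

omit [CharZero K] in
theorem trace_mul_dualW_eq_zero {r : ℤ} {M : MatW K N p} (h : DegGE r M) (x : Idx N p)
    (hx : (x.1.1 : ℤ) - (x.1.2 : ℕ) < r) : Matrix.trace (dualW K N p x * M) = 0 :=
  ((degGE_dualW K N p x).mul h).trace_eq_zero (by omega)

/-- The label `(j, k - 1, a, b)` of a constraint `(j, k, a, b)`. -/
def predIdx {N p : ℕ} (α : ConIdx N p) : Idx N p :=
  (⟨α.1.1.1, ⟨(α.1.1.2 : ℕ) - 1, by omega⟩⟩, α.1.2)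

/-- A highest weight vector pairs only with a lowest weight vector, and a predecessor has `k ≤ 2j -
1`, so it is never lowest. -/
theorem trace_basisW_pred_mul_hw (α : ConIdx N p) (y : Fin p × Fin N × Fin N) :
    Matrix.trace (basisW K N p (predIdx α) * basisW K N p (hwIdx y)) = 0 := by
  have h := α.1.1.2.2
  have h0 := α.2
  simp only [basisW, ← Matrix.map_mul, basisM, ← Matrix.mul_kronecker_mul]
  rw [← AddMonoidHom.map_trace, Matrix.trace_kronecker]
  simp only [predIdx, hwIdx, Fin.val_zero, multM_zero]
  rw [Matrix.trace_mul_comm (multM _ _ _ _)]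
  by_cases h1 : (α.1.1.2 : ℕ) - 1 = (y.1 : ℕ) + α.1.1.1
  · have h2 := trace_multM_mul K p α.1.1.1 y.1 ((α.1.1.2 : ℕ) - 1) 0
    rw [multM_zero, (multM_top K p y.1).2 _ (by omega), Matrix.trace_mul_comm] at h2
    rw [h2]
    simp
  · rw [trace_highestM_mul_eq_zero K h1]
    simp

/-- Every matrix can be brought to highest weight form by adding a commutator `[ν, 𝕁]`. -/
theorem exists_gauge (n : ℕ) : ∀ (r : ℤ), (p : ℤ) ≤ r + n → ∀ R : MatW K N p, DegGE r R →
    ∃ ν : MatW K N p, DegGE (r + 1) ν ∧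
      (∀ y, Matrix.trace (ν * basisW K N p (hwIdx y)) = 0) ∧
      ∀ α : ConIdx N p, Matrix.trace (dualW K N p α.1 * (R + comm ν (sliceJ K N p))) = 0 := by
  induction n with
  | zero =>
    intro r hr R hR
    refine ⟨0, fun _ _ _ _ _ => rfl, by simp, ?_⟩
    simp [hR.eq_zero (by simpa using hr), comm_zero_left]
  | succ n ih =>
    intro r hr R hR
    -- Since `[e₋, M_{j,m+1}] = M_{j,m}`, this `ν₀` solves `[ν₀, ε₋] = -` (the part of `R` outside
    -- highest weight). The error `[ν₀, W]` has degree at least `r + 1`, and nothing is left from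
    -- degree `p` on, so the recursion stops.
    set ν₀ : MatW K N p := ∑ α : ConIdx N p,
      Matrix.trace (dualW K N p α.1 * R) • basisW K N p (predIdx α) with hν
    have hdeg : DegGE (r + 1) ν₀ := by
      refine DegGE.sum _ fun α _ => ?_
      have hα := α.2
      by_cases h : (α.1.1.1 : ℤ) - (α.1.1.2 : ℕ) < r
      · rw [trace_mul_dualW_eq_zero K N p hR α.1 h, zero_smul]
        exact fun _ _ _ _ _ => rfl
      · refine ((degGE_basisW K N p (predIdx α)).smul _).mono ?_
        simp only [predIdx]
        omega
    have hhw : ∀ y, Matrix.trace (ν₀ * basisW K N p (hwIdx y)) = 0 := by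
      intro y
      simp only [hν, Finset.sum_mul, Matrix.trace_sum, Matrix.smul_mul, Matrix.trace_smul,
        trace_basisW_pred_mul_hw, smul_zero, Finset.sum_const_zero]
    have hlie : comm ν₀ (epsW K N p) =
        - ∑ α : ConIdx N p, Matrix.trace (dualW K N p α.1 * R) • basisW K N p α.1 := by
      rw [hν, comm_sum_left, ← Finset.sum_neg_distrib]
      refine Finset.sum_congr rfl fun α _ => ?_
      have hα := α.2
      rw [comm_smul_left, comm_basisW_epsW K N p α.1 (predIdx α) rfl
        (by simp only [predIdx]; omega) rfl, smul_neg]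
    obtain ⟨ν₁, h1, h2, h3⟩ := ih (r + 1) (by push_cast at hr; omega) (comm ν₀ (sliceW K N p))
      ((hdeg.comm (degGE_sliceW K N p)).mono (by omega))
    refine ⟨ν₀ + ν₁, hdeg.add (h1.mono (by omega)), fun y => ?_, fun α => ?_⟩
    · rw [add_mul, Matrix.trace_add, hhw, h2, add_zero]
    · have h4 : R + comm (ν₀ + ν₁) (sliceJ K N p) =
          (∑ y, Matrix.trace (dualW K N p (hwIdx y) * R) • basisW K N p (hwIdx y)) +
          (comm ν₀ (sliceW K N p) + comm ν₁ (sliceJ K N p)) := by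
        conv_lhs => rw [← sum_trace_dualW_smul K N p R, sum_idx, comm_add_left]
        conv_lhs =>
          enter [2, 1]
          rw [sliceJ_eq, comm_add_right, hlie]
        abel
      rw [h4, mul_add, Matrix.trace_add, h3, add_zero, Finset.mul_sum, Matrix.trace_sum]
      refine Finset.sum_eq_zero fun y _ => ?_
      rw [Matrix.mul_smul, Matrix.trace_smul, trace_dualW_mul_basisW, if_neg, smul_zero]
      rintro h
      apply α.2
      rw [h]
      simp [hwIdx]

end Slice

end FiniteW

end

noncomputable section

namespace FiniteW

/-! ### The Dirac bracket through corrected gradients. -/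

section Dirac

variable (K : Type*) [Field K] (N p : ℕ)

/-- The Lie-Poisson bracket at the constraint surface of two functions with gradients `A`, `B`. -/
def lieForm (A B : MatW K N p) : WAlg K N p := Matrix.trace (B * comm A (sliceJ K N p))

theorem lieForm_add_left (A A' B : MatW K N p) :
    lieForm K N p (A + A') B = lieForm K N p A B + lieForm K N p A' B := by
  rw [lieForm, comm_add_left, mul_add, Matrix.trace_add]; rfl

theorem lieForm_smul_left (c : WAlg K N p) (A B : MatW K N p) :
    lieForm K N p (c • A) B = c * lieForm K N p A B := by
  rw [lieForm, comm_smul_left, Matrix.mul_smul, Matrix.trace_smul, smul_eq_mul]; rfl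

theorem lieForm_sum_left {ι : Type*} (s : Finset ι) (A : ι → MatW K N p) (B : MatW K N p) :
    lieForm K N p (∑ i ∈ s, A i) B = ∑ i ∈ s, lieForm K N p (A i) B := by
  simp only [lieForm, comm_sum_left, Finset.mul_sum, Matrix.trace_sum]

theorem lieForm_smul_right (c : WAlg K N p) (A B : MatW K N p) :
    lieForm K N p A (c • B) = c * lieForm K N p A B := by
  rw [lieForm, Matrix.smul_mul, Matrix.trace_smul, smul_eq_mul]; rfl

theorem lieForm_sum_right {ι : Type*} (s : Finset ι) (A : MatW K N p) (B : ι → MatW K N p) :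
    lieForm K N p A (∑ i ∈ s, B i) = ∑ i ∈ s, lieForm K N p A (B i) := by
  simp only [lieForm, Finset.sum_mul, Matrix.trace_sum]

theorem lieForm_antisymm (A B : MatW K N p) : lieForm K N p A B = - lieForm K N p B A := by
  simp only [lieForm, comm, mul_sub, Matrix.trace_sub, ← Matrix.mul_assoc]
  rw [Matrix.trace_mul_cycle B (sliceJ K N p) A, Matrix.trace_mul_cycle A (sliceJ K N p) B]
  ring

theorem applyCon_coordBracket (x y : Idx N p) : applyCon K N p (coordBracket K N p x y) =
    lieForm K N p (dualW K N p x) (dualW K N p y) := by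
  have h := AddMonoidHom.map_trace (applyCon K N p) ((dualM K N p y).map MvPolynomial.C *
    ((dualM K N p x).map MvPolynomial.C * genJ K N p -
      genJ K N p * (dualM K N p x).map MvPolynomial.C))
  rw [coordBracket, h, Matrix.map_mul, Matrix.map_sub _ (map_sub _), Matrix.map_mul,
    Matrix.map_mul, map_C_dualM, map_C_dualM]
  rfl

/-- The gradient of the unconstrained lift of `f`, at the constraint surface. -/
def liftGrad (f : WAlg K N p) : MatW K N p :=
  ∑ y, MvPolynomial.pderiv y f • dualW K N p (hwIdx y)

theorem pderiv_unconstrained_hw (y : Fin p × Fin N × Fin N) (f : WAlg K N p) :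
    MvPolynomial.pderiv (hwIdx y) (unconstrained K N p f) =
      unconstrained K N p (MvPolynomial.pderiv y f) :=
  MvPolynomial.pderiv_rename (hwIdx_injective N p) y f

theorem pderiv_unconstrained_con (α : ConIdx N p) (f : WAlg K N p) :
    MvPolynomial.pderiv α.1 (unconstrained K N p f) = 0 := by
  classical
  refine MvPolynomial.pderiv_eq_zero_of_notMem_vars fun h => ?_
  have h1 := MvPolynomial.vars_rename hwIdx f h
  obtain ⟨y, -, hy⟩ := Finset.mem_image.1 h1
  exact α.2 (by rw [← hy]; simp [hwIdx])

theorem applyCon_unconstrained (f : WAlg K N p) :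
    applyCon K N p (unconstrained K N p f) = f := by
  have h : (applyCon K N p).comp (unconstrained K N p) = AlgHom.id K _ := by
    refine MvPolynomial.algHom_ext fun y => ?_
    have : unconstrained K N p (MvPolynomial.X y) = MvPolynomial.X (hwIdx y) :=
      MvPolynomial.rename_X _ _
    rw [AlgHom.comp_apply, this, applyCon_X_hw]
    rfl
  exact DFunLike.congr_fun h f

/-- The gradient of a polynomial in the coordinates, at the constraint surface. -/
def fullGrad (F : FullAlg K N p) : MatW K N p :=
  ∑ x, applyCon K N p (MvPolynomial.pderiv x F) • dualW K N p x

theorem applyCon_poisson (F G : FullAlg K N p) : applyCon K N p (poisson K N p F G) =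
    lieForm K N p (fullGrad K N p F) (fullGrad K N p G) := by
  simp only [poisson, fullGrad, map_sum, map_mul, applyCon_coordBracket, lieForm_sum_left,
    lieForm_smul_left]
  simp only [lieForm_sum_right, lieForm_smul_right, Finset.mul_sum]
  exact Finset.sum_congr rfl fun _ _ => Finset.sum_congr rfl fun _ _ => by ring

theorem fullGrad_unconstrained (f : WAlg K N p) :
    fullGrad K N p (unconstrained K N p f) = liftGrad K N p f := by
  rw [fullGrad, sum_idx, liftGrad]
  simp only [pderiv_unconstrained_con, pderiv_unconstrained_hw, applyCon_unconstrained, map_zero,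
    zero_smul, Finset.sum_const_zero, add_zero]

theorem fullGrad_phi (α : ConIdx N p) : fullGrad K N p (phi K N p α) = dualW K N p α.1 := by
  classical
  rw [fullGrad, Finset.sum_eq_single α.1]
  · simp [phi]
  · intro x _ hx
    rw [phi, map_sub, MvPolynomial.pderiv_X_of_ne hx.symm, MvPolynomial.pderiv_C]
    simp
  · simp

theorem Delta_apply (α β : ConIdx N p) :
    Delta K N p α β = lieForm K N p (dualW K N p α.1) (dualW K N p β.1) := by
  rw [Delta, Matrix.of_apply, applyCon_poisson, fullGrad_phi, fullGrad_phi]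

/-- The gradient of a function corrected by multiples of the gradients of the constraints so that
the constraints are preserved by its Hamiltonian flow. -/
def diracGrad (A : MatW K N p) : MatW K N p :=
  A - ∑ β : ConIdx N p, (∑ α : ConIdx N p,
    lieForm K N p A (dualW K N p α.1) * (Delta K N p)⁻¹ α β) • dualW K N p β.1

theorem diracGrad_add (A B : MatW K N p) :
    diracGrad K N p (A + B) = diracGrad K N p A + diracGrad K N p B := by
  simp only [diracGrad, lieForm_add_left, add_mul, Finset.sum_add_distrib, add_smul]
  abel

theorem diracGrad_smul (c : WAlg K N p) (A : MatW K N p) :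
    diracGrad K N p (c • A) = c • diracGrad K N p A := by
  simp only [diracGrad, lieForm_smul_left, mul_assoc, ← Finset.mul_sum, ← smul_smul,
    ← Finset.smul_sum, smul_sub]

theorem wBracket_eq (f g : WAlg K N p) : wBracket K N p f g =
    lieForm K N p (diracGrad K N p (liftGrad K N p f)) (liftGrad K N p g) := by
  rw [diracGrad, sub_eq_add_neg, ← neg_one_smul (WAlg K N p) (∑ β : ConIdx N p, _),
    lieForm_add_left, lieForm_smul_left, lieForm_sum_left, Finset.sum_congr rfl fun β _ =>
      lieForm_smul_left K N p (∑ α : ConIdx N p, _) _ _]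
  simp only [wBracket, applyCon_poisson, fullGrad_unconstrained, fullGrad_phi, Finset.sum_mul]
  rw [Finset.sum_comm]
  ring

theorem liftGrad_mul (f g : WAlg K N p) : liftGrad K N p (f * g) =
    f • liftGrad K N p g + g • liftGrad K N p f := by
  simp only [liftGrad, Derivation.leibniz, add_smul, Finset.sum_add_distrib, Finset.smul_sum,
    smul_smul, smul_eq_mul]

theorem liftGrad_add (f g : WAlg K N p) : liftGrad K N p (f + g) =
    liftGrad K N p f + liftGrad K N p g := by
  simp only [liftGrad, map_add, add_smul, Finset.sum_add_distrib]

/-- The bracket of `𝒲_p(N)` as a derivation of its second argument. -/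
def wDer (f : WAlg K N p) : Derivation K (WAlg K N p) (WAlg K N p) :=
  ∑ y, lieForm K N p (diracGrad K N p (liftGrad K N p f)) (dualW K N p (hwIdx y)) •
    MvPolynomial.pderiv y

theorem wDer_apply (f g : WAlg K N p) : wDer K N p f g = wBracket K N p f g := by
  rw [wBracket_eq, wDer]
  generalize diracGrad K N p (liftGrad K N p f) = A
  have h := congrFun (map_sum (Derivation.coeFnAddMonoidHom (R := K) (A := WAlg K N p)
    (M := WAlg K N p)) (fun y => lieForm K N p A (dualW K N p (hwIdx y)) • MvPolynomial.pderiv y)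
    Finset.univ) g
  rw [Finset.sum_apply] at h
  refine h.trans ?_
  rw [liftGrad, lieForm_sum_right]
  refine Finset.sum_congr rfl fun y _ => ?_
  rw [lieForm_smul_right, mul_comm]
  rfl

theorem wDer_mul (f g : WAlg K N p) : wDer K N p (f * g) = f • wDer K N p g + g • wDer K N p f := by
  simp only [wDer, liftGrad_mul, diracGrad_add, diracGrad_smul, lieForm_add_left,
    lieForm_smul_left, add_smul, Finset.sum_add_distrib, Finset.smul_sum, smul_smul]

theorem wDer_add (f g : WAlg K N p) : wDer K N p (f + g) = wDer K N p f + wDer K N p g := by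
  simp only [wDer, liftGrad_add, diracGrad_add, lieForm_add_left, add_smul, Finset.sum_add_distrib]

variable [CharZero K]

/-- Row vectors `c` correspond to the matrices `ν = ∑ c_α dualW α`, those orthogonal to all highest
weight vectors, and `c Δ` lists the constraint components of `[ν, 𝕁]`. Gauge fixing `-∑ v_β M_β`
therefore solves `c Δ = v`. -/
theorem isUnit_Delta : IsUnit (Delta K N p) := by
  rw [← Matrix.vecMul_surjective_iff_isUnit]
  intro v
  obtain ⟨ν, -, h1, h2⟩ := exists_gauge K N p (2 * p) (1 - p) (by push_cast; omega)
    (- ∑ β : ConIdx N p, v β • basisW K N p β.1) (degGE_of_le _ le_rfl)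
  refine ⟨fun α => Matrix.trace (ν * basisW K N p α.1), ?_⟩
  have h3 : ν = ∑ α : ConIdx N p, Matrix.trace (ν * basisW K N p α.1) • dualW K N p α.1 := by
    conv_lhs => rw [← sum_trace_basisW_smul K N p ν, sum_idx]
    simp [h1]
  ext1 γ
  have h4 := h2 γ
  rw [mul_add, Matrix.trace_add, mul_neg, Matrix.trace_neg, Finset.mul_sum, Matrix.trace_sum,
    Finset.sum_eq_single γ, Matrix.mul_smul, Matrix.trace_smul, trace_dualW_mul_basisW, if_pos rfl,
    smul_eq_mul, mul_one, neg_add_eq_zero] at h4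
  · rw [h4]
    change _ = lieForm K N p ν (dualW K N p γ.1)
    conv_rhs => rw [h3, lieForm_sum_left]
    simp only [Matrix.vecMul, dotProduct, Delta_apply, lieForm_smul_left]
  · intro β _ hβ
    rw [Matrix.mul_smul, Matrix.trace_smul, trace_dualW_mul_basisW, if_neg, smul_zero]
    exact fun h => hβ (Subtype.ext h.symm)
  · simp

variable {K N p} in
/-- `A` is the gradient of a function on `gl(Np)` extending `f` whose Hamiltonian flow preserves
the first class constraints. -/
structure IsGrad (f : WAlg K N p) (A : MatW K N p) : Prop where
  trace_mul : ∀ y, Matrix.trace (A * basisW K N p (hwIdx y)) = MvPolynomial.pderiv y f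
  degGE : DegGE 0 (comm A (sliceJ K N p))

variable {K N p} in
-- Gradients whose flow stays in degrees `≥ 0` can be used without Dirac correction: gauge fixing
-- changes `A` by some `ν` of positive degree, which turns it into the corrected gradient of `f` and
-- is invisible to `B`.
theorem wBracket_eq_lieForm {f g : WAlg K N p} {A B : MatW K N p} (hA : IsGrad f A)
    (hB : IsGrad g B) : wBracket K N p f g = lieForm K N p A B := by
  obtain ⟨ν, hν, -, h2⟩ := exists_gauge K N p p 0 (by simp) _ hA.degGE
  -- Here the vanishing comes from `ν` having degree at least one, so that `A + ν` still pairs with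
  -- `M_{j,j}` as the partial derivatives of `f`.
  have hν0 : ∀ y, Matrix.trace (ν * basisW K N p (hwIdx y)) = 0 := fun y =>
    (hν.mul (degGE_basisW K N p (hwIdx y))).trace_eq_zero (by simp [hwIdx]; omega)
  set c : ConIdx N p → WAlg K N p := fun α => Matrix.trace ((A + ν) * basisW K N p α.1) with hc
  have h3 : A + ν = liftGrad K N p f + ∑ α, c α • dualW K N p α.1 := by
    conv_lhs => rw [← sum_trace_basisW_smul K N p (A + ν), sum_idx]
    simp only [add_mul, Matrix.trace_add, hA.trace_mul, hν0, add_zero, liftGrad, hc]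
  set v : ConIdx N p → WAlg K N p := fun γ => lieForm K N p (liftGrad K N p f) (dualW K N p γ.1)
    with hv
  -- The flow of `A + ν` is tangent to the constraint surface. This linear system determines `c`,
  -- and its solution is the correction built into `diracGrad`.
  have h4 : Matrix.vecMul c (Delta K N p) = -v := by
    ext1 γ
    have h5 := h2 γ
    rw [← comm_add_left] at h5
    change lieForm K N p (A + ν) (dualW K N p γ.1) = 0 at h5
    rw [h3, lieForm_add_left, lieForm_sum_left] at h5
    simp only [Matrix.vecMul, dotProduct, Delta_apply, Pi.neg_apply, hv]
    simp only [lieForm_smul_left] at h5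
    exact eq_neg_of_add_eq_zero_right h5
  have h5 : Matrix.vecMul v (Delta K N p)⁻¹ = -c := by
    rw [← neg_eq_iff_eq_neg.2 h4, Matrix.neg_vecMul, Matrix.vecMul_vecMul,
      Matrix.mul_nonsing_inv _ ((Matrix.isUnit_iff_isUnit_det _).1 (isUnit_Delta K N p)),
      Matrix.vecMul_one]
  have h6 : wBracket K N p f g = lieForm K N p (A + ν) (liftGrad K N p g) := by
    rw [wBracket_eq, h3, diracGrad, sub_eq_add_neg, ← Finset.sum_neg_distrib]
    congr 2
    refine Finset.sum_congr rfl fun β _ => ?_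
    have h7 := congrFun h5 β
    simp only [Matrix.vecMul, dotProduct, Pi.neg_apply, hv] at h7
    rw [h7, neg_smul, neg_neg]
  -- `[A + ν, 𝕁]` has only highest weight components, so its second partner matters only through its
  -- pairings with the `M_{j,j}`; these are the derivatives of `g` for both partners.
  have h8 : lieForm K N p (A + ν) (liftGrad K N p g) = lieForm K N p (A + ν) B := by
    have h9 : comm (A + ν) (sliceJ K N p) = ∑ y, Matrix.trace (dualW K N p (hwIdx y) *
        comm (A + ν) (sliceJ K N p)) • basisW K N p (hwIdx y) := by
      conv_lhs => rw [← sum_trace_dualW_smul K N p (comm (A + ν) (sliceJ K N p)), sum_idx]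
      simp only [comm_add_left] at h2 ⊢
      simp only [h2, zero_smul, Finset.sum_const_zero, add_zero]
    rw [liftGrad, lieForm_sum_right]
    conv_rhs => rw [lieForm, h9, Finset.mul_sum, Matrix.trace_sum]
    refine Finset.sum_congr rfl fun y _ => ?_
    rw [Matrix.mul_smul, Matrix.trace_smul, hB.trace_mul, lieForm_smul_right, smul_eq_mul, mul_comm]
    rfl
  have h10 : lieForm K N p ν B = 0 := by
    rw [lieForm_antisymm, lieForm, (hν.mul hB.degGE).trace_eq_zero (by omega), neg_zero]
  rw [h6, h8, lieForm_add_left, h10, add_zero]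

end Dirac

end FiniteW

end

noncomputable section

namespace FiniteW

/-! ### Spans of matrix words, filtered by length. -/

section Words

variable {K : Type*} [Field K] {R : Type*} [CommRing R] [Algebra K R] {N : ℕ}

variable (K) in
/-- The span of the words `B_{s₁} ⋯ B_{sₙ}` of length `n ≥ c` with `n + |s| = w`. -/
def wordSpan (B : ℕ → Matrix (Fin N) (Fin N) R) (c w : ℕ) :
    Submodule K (Matrix (Fin N) (Fin N) R) :=
  Submodule.span K {M | ∃ (n : ℕ) (s : Fin n → ℕ), c ≤ n ∧ n + ∑ i, s i = w ∧ M = word B s}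

theorem word_append (B : ℕ → Matrix (Fin N) (Fin N) R) {m n : ℕ} (s : Fin m → ℕ) (t : Fin n → ℕ) :
    word B (Fin.append s t) = word B s * word B t := by
  rw [word, word, word, ← List.prod_append, ← List.ofFn_fin_append]
  congr 2
  ext i
  refine Fin.addCases (fun i => ?_) (fun i => ?_) i <;> simp

theorem mul_mem_wordSpan {B : ℕ → Matrix (Fin N) (Fin N) R} {c c' w w' : ℕ}
    {M M' : Matrix (Fin N) (Fin N) R} (h : M ∈ wordSpan K B c w) (h' : M' ∈ wordSpan K B c' w') :
    M * M' ∈ wordSpan K B (c + c') (w + w') := by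
  refine Submodule.span_induction₂ (p := fun x y _ _ => x * y ∈ wordSpan K B (c + c') (w + w'))
    ?_ ?_ ?_ ?_ ?_ ?_ ?_ h h'
  · rintro x y ⟨m, s, h1, h2, rfl⟩ ⟨n, t, h3, h4, rfl⟩
    refine Submodule.subset_span ⟨m + n, Fin.append s t, by omega, ?_, (word_append B s t).symm⟩
    rw [Fin.sum_univ_add]
    simp only [Fin.append_left, Fin.append_right]
    omega
  · intro y _; rw [zero_mul]; exact zero_mem _
  · intro x _; rw [mul_zero]; exact zero_mem _
  · intro x y z _ _ _ hx hy; rw [add_mul]; exact add_mem hx hy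
  · intro x y z _ _ _ hx hy; rw [mul_add]; exact add_mem hx hy
  · intro r x y _ _ hx; rw [Matrix.smul_mul]; exact Submodule.smul_mem _ _ hx
  · intro r x y _ _ hx; rw [Matrix.mul_smul]; exact Submodule.smul_mem _ _ hx

theorem wordSpan_mono (B : ℕ → Matrix (Fin N) (Fin N) R) {c c' : ℕ} (h : c ≤ c') (w : ℕ) :
    wordSpan K B c' w ≤ wordSpan K B c w :=
  Submodule.span_mono fun _ ⟨n, s, h1, h2, h3⟩ => ⟨n, s, h.trans h1, h2, h3⟩

theorem mem_wordSpan_one (B : ℕ → Matrix (Fin N) (Fin N) R) (s : ℕ) :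
    B s ∈ wordSpan K B 1 (s + 1) :=
  Submodule.subset_span ⟨1, fun _ => s, le_rfl, by simp [add_comm], by simp [word]⟩

theorem exists_coeff_of_mem_wordSpan {B : ℕ → Matrix (Fin N) (Fin N) R} {w : ℕ}
    {M : Matrix (Fin N) (Fin N) R} (h : M ∈ wordSpan K B 1 w) :
    ∃ α : (n : ℕ) → (Fin n → ℕ) → K, M = ∑ n ∈ Finset.Icc 1 w,
      ∑ s ∈ Finset.Nat.antidiagonalTuple n (w - n), α n s • word B s := by
  classical
  induction h using Submodule.span_induction with
  | mem x hx =>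
    obtain ⟨n, s, h1, h2, rfl⟩ := hx
    refine ⟨fun m t => if (⟨m, t⟩ : Σ n, Fin n → ℕ) = ⟨n, s⟩ then 1 else 0, ?_⟩
    rw [Finset.sum_eq_single n, Finset.sum_eq_single s]
    · simp
    · intro t _ ht
      dsimp only
      rw [if_neg, zero_smul]
      simpa using ht
    · intro hs
      exact absurd (Finset.Nat.mem_antidiagonalTuple.2 (by omega)) hs
    · intro m _ hm
      refine Finset.sum_eq_zero fun t _ => ?_
      dsimp only
      rw [if_neg, zero_smul]
      intro h
      exact hm (congrArg Sigma.fst h)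
    · intro hn
      exact absurd (Finset.mem_Icc.2 ⟨h1, by omega⟩) hn
  | zero => exact ⟨fun _ _ => 0, by simp⟩
  | add x y _ _ hx hy =>
    obtain ⟨α, rfl⟩ := hx
    obtain ⟨β, rfl⟩ := hy
    exact ⟨fun n s => α n s + β n s, by simp only [add_smul, Finset.sum_add_distrib]⟩
  | smul r x _ hx =>
    obtain ⟨α, rfl⟩ := hx
    exact ⟨fun n s => r * α n s, by simp only [Finset.smul_sum, smul_smul]⟩

end Words

/-! ### Blocks of powers of `𝕁`: the bottom left corner as a family of sign `+`. -/

section Blocks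

variable {R : Type*} [CommRing R] {N p : ℕ}

/-- The `N × N` blocks of a matrix in `gl(Np) = gl(N) ⊗ gl(p)`. -/
def blk (M : Matrix (Fin N × Fin p) (Fin N × Fin p) R) (i l : Fin p) : Matrix (Fin N) (Fin N) R :=
  Matrix.of fun a b => M (a, i) (b, l)

theorem blk_mul (M M' : Matrix (Fin N × Fin p) (Fin N × Fin p) R) (i l : Fin p) :
    blk (M * M') i l = ∑ k, blk M i k * blk M' k l := by
  ext a b
  simp only [blk, Matrix.of_apply, Matrix.mul_apply, Matrix.sum_apply, Fintype.sum_prod_type]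
  exact Finset.sum_comm

theorem blk_add (M M' : Matrix (Fin N × Fin p) (Fin N × Fin p) R) (i l : Fin p) :
    blk (M + M') i l = blk M i l + blk M' i l := rfl

end Blocks

section Corner

variable (K : Type*) [Field K] (N p : ℕ)

theorem blk_epsW_mul (M : MatW K N p) (i l : Fin p) : blk (epsW K N p * M) i l =
    if h : 0 < (i : ℕ) then blk M ⟨(i : ℕ) - 1, by omega⟩ l else 0 := by
  have h1 : ∀ k : Fin p, blk (epsW K N p) i k * blk M k l =
      if (k : ℕ) = (i : ℕ) - 1 then (if 0 < (i : ℕ) then blk M k l else 0) else 0 := by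
    intro k
    have h2 : blk (epsW K N p) i k = if (i : ℕ) = k + 1 then 1 else 0 := by
      ext a b
      simp only [blk, Matrix.of_apply, epsW_apply]
      split_ifs with h h' h' <;> simp_all [Matrix.one_apply]
    rw [h2]
    split_ifs <;> first | omega | simp
  rw [blk_mul, Finset.sum_congr rfl fun k _ => h1 k, sum_fin_ite_val]
  split_ifs <;> first | omega | rfl

theorem blk_sliceW (i l : Fin p) : blk (sliceW K N p) i l = if (i : ℕ) ≤ l then
    highestM K p ((l : ℕ) - i) i l • genW K N p ((l : ℕ) - i) else 0 := by
  refine Matrix.ext fun a b => ?_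
  simp only [blk, Matrix.of_apply, sliceW, Matrix.sum_apply, Matrix.smul_apply, basisW,
    Matrix.map_apply, basisM, Matrix.kroneckerMap_apply, hwIdx, Fin.val_zero, multM_zero]
  rw [Fintype.sum_prod_type]
  have hl := l.2
  by_cases h : (i : ℕ) ≤ l
  · rw [if_pos h, Finset.sum_eq_single ⟨(l : ℕ) - i, by omega⟩,
      Finset.sum_eq_single (a, b)]
    · simp only [Matrix.smul_apply, genW, Matrix.of_apply]
      rw [dif_pos (by omega), MvPolynomial.smul_eq_C_mul, Matrix.single_apply_same, one_mul,
        smul_eq_mul, mul_comm]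
    · rintro ⟨c, d⟩ _ hcd
      rw [Matrix.single_apply_of_ne]
      · simp
      · simpa [Prod.ext_iff] using hcd
    · simp
    · intro j _ hj
      dsimp only
      refine Finset.sum_eq_zero fun x _ => ?_
      have : highestM K p j i l = 0 := by
        rw [highestM, Matrix.of_apply, if_neg]
        intro h'
        exact hj (Fin.ext (by simp only; omega))
      simp [this]
    · simp
  · rw [if_neg h]
    refine Finset.sum_eq_zero fun j _ => ?_
    refine Finset.sum_eq_zero fun x _ => ?_
    have : highestM K p j i l = 0 := by
      rw [highestM, Matrix.of_apply, if_neg]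
      omega
    simp [this]

variable [CharZero K]

theorem degGE_sliceJ_pow (m : ℕ) : DegGE (-(m : ℤ)) (sliceJ K N p ^ m) := by
  induction m with
  | zero =>
    intro a b i l h
    rw [pow_zero, Matrix.one_apply_ne]
    intro h'
    have := congrArg Prod.snd h'
    simp only at this
    subst this
    simp at h
  | succ m ih =>
    rw [pow_succ]
    refine (ih.mul (s := -1) ?_).mono (by push_cast; omega)
    rw [sliceJ_eq]
    exact (degGE_epsW K N p).add ((degGE_sliceW K N p).mono (by omega))

theorem blk_pow_eq_zero {m : ℕ} {i l : Fin p} (h : (l : ℕ) + m < i) :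
    blk (sliceJ K N p ^ m) i l = 0 := by
  refine Matrix.ext fun a b => ?_
  exact degGE_sliceJ_pow K N p m a b i l (by omega)

theorem blk_pow_succ (m : ℕ) (i l : Fin p) : blk (sliceJ K N p ^ (m + 1)) i l =
    (if h : 0 < (i : ℕ) then blk (sliceJ K N p ^ m) ⟨(i : ℕ) - 1, by omega⟩ l else 0) +
      ∑ k, blk (sliceW K N p) i k * blk (sliceJ K N p ^ m) k l := by
  rw [pow_succ', sliceJ_eq, add_mul, blk_add, blk_epsW_mul, blk_mul, ← sliceJ_eq]

/-- To pass from row `n` to row `0` in `n` factors, every factor must contribute its `ε₋` part. -/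
theorem blk_pow_self (i₀ : Fin p) (h0 : (i₀ : ℕ) = 0) (n : ℕ) :
    ∀ i : Fin p, (i : ℕ) = n → blk (sliceJ K N p ^ n) i i₀ = 1 := by
  induction n with
  | zero =>
    intro i hi
    obtain rfl : i = i₀ := Fin.ext (by omega)
    ext a b
    simp [blk, Matrix.one_apply]
  | succ n ih =>
    intro i hi
    rw [blk_pow_succ, dif_pos (by omega), ih _ (by simp only; omega), Finset.sum_eq_zero, add_zero]
    intro k _
    by_cases h : (k : ℕ) ≤ n
    · rw [blk_sliceW, if_neg (by omega), zero_mul]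
    · rw [blk_pow_eq_zero K N p (by omega), mul_zero]

/-- Peel off leading factors. A factor `ε₋` lowers row and exponent together; `i'` is the row where
the first factor `W` occurs. -/
theorem blk_pow_eq_sum (i₀ : Fin p) (w n : ℕ) : ∀ i : Fin p, (i : ℕ) = n →
    blk (sliceJ K N p ^ (n + w + 1)) i i₀ = ∑ i' : Fin p, if i' ≤ i then
      ∑ l, blk (sliceW K N p) i' l * blk (sliceJ K N p ^ ((i' : ℕ) + w)) l i₀ else 0 := by
  set T : Fin p → Matrix (Fin N) (Fin N) (WAlg K N p) := fun i' =>
    ∑ l, blk (sliceW K N p) i' l * blk (sliceJ K N p ^ ((i' : ℕ) + w)) l i₀ with hT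
  induction n with
  | zero =>
    intro i hi
    have h : ∀ i' : Fin p, i' ≤ i ↔ i' = i := fun i' => by
      rw [Fin.le_def, Fin.ext_iff]; omega
    simp only [h, Finset.sum_ite_eq', Finset.mem_univ, if_true]
    rw [blk_pow_succ, dif_neg (by omega), zero_add]
    simp only [hi]
  | succ n ih =>
    intro i hi
    have h : ∀ i' : Fin p, (if i' ≤ i then T i' else 0) =
        (if i' ≤ (⟨(i : ℕ) - 1, by omega⟩ : Fin p) then T i' else 0) +
          if i' = i then T i' else 0 := fun i' => by
      simp only [Fin.le_def, Fin.ext_iff]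
      split_ifs <;> first | omega | simp
    change _ = ∑ i', if i' ≤ i then T i' else 0
    have ih' : _ = ∑ i', if i' ≤ (⟨(i : ℕ) - 1, by omega⟩ : Fin p) then T i' else 0 :=
      ih _ (by simp only; omega)
    simp only [h, Finset.sum_add_distrib, Finset.sum_ite_eq', Finset.mem_univ, if_true]
    rw [← ih', blk_pow_succ, dif_pos (by omega)]
    simp only [hT, hi, show n + 1 + w = n + w + 1 by ring]

/-- After the first factor `W_{l-i'}` of `blk_pow_eq_sum` the remaining block falls into three
cases: for `l < i' + w` it consists of nonempty words, by induction; for `l = i' + w` it is the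
identity and gives the linear term; for `l > i' + w` it vanishes. -/
theorem blk_pow_mem (i₀ : Fin p) (h0 : (i₀ : ℕ) = 0) (w : ℕ) : ∀ i : Fin p,
    blk (sliceJ K N p ^ ((i : ℕ) + w + 1)) i i₀ -
      (∑ i' : Fin p, if i' ≤ i then ∑ l, highestM K p w i' l else 0) • genW K N p w ∈
      wordSpan K (genW K N p) 2 (w + 1) := by
  induction w using Nat.strong_induction_on with
  | _ w ih =>
  intro i
  rw [blk_pow_eq_sum K N p i₀ w i i rfl, Finset.sum_smul, ← Finset.sum_sub_distrib]
  refine Submodule.sum_mem _ fun i' _ => ?_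
  by_cases hi : i' ≤ i
  swap
  · simp [hi]
  rw [if_pos hi, if_pos hi, Finset.sum_smul, ← Finset.sum_sub_distrib]
  refine Submodule.sum_mem _ fun l _ => ?_
  rw [blk_sliceW]
  rcases lt_trichotomy (l : ℕ) ((i' : ℕ) + w) with h | h | h
  · have h1 : highestM K p w i' l = 0 := by
      rw [highestM, Matrix.of_apply, if_neg (by omega)]
    rw [h1, zero_smul, sub_zero]
    by_cases h2 : (i' : ℕ) ≤ l
    swap
    · simp [h2]
    rw [if_pos h2, Matrix.smul_mul]
    refine Submodule.smul_mem _ _ ?_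
    obtain ⟨v, hv⟩ : ∃ v, (i' : ℕ) + w = l + v + 1 := ⟨(i' : ℕ) + w - l - 1, by omega⟩
    have h3 := ih v (by omega) l
    have h4 : blk (sliceJ K N p ^ ((l : ℕ) + v + 1)) l i₀ ∈ wordSpan K (genW K N p) 1 (v + 1) := by
      have h5 := add_mem (wordSpan_mono _ (by omega : 1 ≤ 2) _ h3)
        (Submodule.smul_mem _ (∑ i' : Fin p, if i' ≤ l then ∑ l, highestM K p v i' l else 0)
          (mem_wordSpan_one (K := K) (genW K N p) v))
      rwa [sub_add_cancel] at h5
    have h6 := mul_mem_wordSpan (mem_wordSpan_one (K := K) (genW K N p) ((l : ℕ) - i')) h4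
    rw [hv]
    rwa [show (l : ℕ) - i' + 1 + (v + 1) = w + 1 by omega] at h6
  · rw [if_pos (by omega), ← h, blk_pow_self K N p i₀ h0 _ l rfl, mul_one,
      show (l : ℕ) - i' = w by omega, sub_self]
    exact zero_mem _
  · have h1 : highestM K p w i' l = 0 := by
      rw [highestM, Matrix.of_apply, if_neg (by omega)]
    rw [h1, zero_smul, sub_zero, blk_pow_eq_zero K N p (by omega), mul_zero]
    exact zero_mem _

/-- The coefficient of `W_j` in the `j`-th element of the family. -/
def leadCoeff (j : ℕ) : K := ∑ i : Fin p, ∑ l, highestM K p j i l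

/-- Summing the entries of `M_{j,j}` is the same as pairing it with `e₋^j`. -/
theorem leadCoeff_eq {j : ℕ} (hj : j < p) :
    leadCoeff K p j = (((j !) ^ 2 * (p + j).choose (2 * j + 1) : ℕ) : K) := by
  rw [← trace_highestM_mul_pow K p j hj, leadCoeff, Matrix.trace]
  refine Finset.sum_congr rfl fun i _ => ?_
  rw [Matrix.diag_apply, Matrix.mul_apply]
  refine Finset.sum_congr rfl fun l _ => ?_
  rw [eMinus_pow_apply, highestM, Matrix.of_apply]
  split_ifs <;> simp

theorem leadCoeff_ne_zero {j : ℕ} (hj : j < p) : leadCoeff K p j ≠ 0 := by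
  rw [leadCoeff_eq K p hj, Nat.cast_ne_zero]
  have := Nat.choose_pos (n := p + j) (k := 2 * j + 1) (by omega)
  positivity

variable {p} in
/-- The matrices `(𝕁^{p+j})_{p,1}`, which form the family of sign `+`. -/
def cornerX (hp : 0 < p) (j : ℕ) : Matrix (Fin N) (Fin N) (WAlg K N p) :=
  blk (sliceJ K N p ^ (p + j)) ⟨p - 1, by omega⟩ ⟨0, hp⟩

variable {p} in
theorem cornerX_sub_mem (hp : 0 < p) (j : ℕ) : cornerX K N hp j - leadCoeff K p j • genW K N p j ∈
    wordSpan K (genW K N p) 2 (j + 1) := by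
  have h := blk_pow_mem K N p ⟨0, hp⟩ rfl j ⟨p - 1, by omega⟩
  have h1 : ∀ i : Fin p, i ≤ ⟨p - 1, by omega⟩ := fun i => by
    rw [Fin.le_def]; have := i.2; simp only; omega
  simp only [h1, if_true] at h
  rwa [show p - 1 + j + 1 = p + j by omega] at h

theorem blk_pow_add_one (i₀ : Fin p) (h0 : (i₀ : ℕ) = 0) (i : Fin p) :
    blk (sliceJ K N p ^ ((i : ℕ) + 1)) i i₀ = ((i : ℕ) + 1 : K) • genW K N p 0 := by
  have h := blk_pow_eq_sum K N p i₀ 0 i i rfl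
  simp only [add_zero] at h
  have h1 : ∀ i' : Fin p, ∑ l, blk (sliceW K N p) i' l * blk (sliceJ K N p ^ (i' : ℕ)) l i₀ =
      genW K N p 0 := by
    intro i'
    rw [Finset.sum_eq_single i', blk_pow_self K N p i₀ h0 _ i' rfl, blk_sliceW]
    · simp [highestM_zero]
    · intro l _ hl
      have hl' : (l : ℕ) ≠ i' := fun h => hl (Fin.ext h)
      by_cases h2 : (l : ℕ) < i'
      · rw [blk_sliceW, if_neg (by omega), zero_mul]
      · rw [blk_pow_eq_zero K N p (by omega), mul_zero]
    · simp
  simp only [h1] at h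
  rw [h, ← Finset.sum_filter, Finset.sum_const]
  have h2 : (Finset.univ.filter fun i' : Fin p => i' ≤ i) = Finset.Iic i := by
    ext; simp
  rw [h2, Fin.card_Iic, ← Nat.cast_smul_eq_nsmul K]
  push_cast
  rfl

variable {p} in
theorem cornerX_zero (hp : 0 < p) : cornerX K N hp 0 = (p : K) • genW K N p 0 := by
  have h := blk_pow_add_one K N p ⟨0, hp⟩ rfl ⟨p - 1, by omega⟩
  simp only at h
  rw [show p - 1 + 1 = p by omega] at h
  rw [cornerX, add_zero, h]
  congr 1
  exact_mod_cast congrArg (Nat.cast (R := K)) (show p - 1 + 1 = p by omega)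

variable {p} in
theorem cornerX_one (hp : 0 < p) : cornerX K N hp 1 =
    ((p : K) * (p ^ 2 - 1) / 6) • genW K N p 1 +
      ((p : K) * (p + 1) / 2) • (genW K N p 0 * genW K N p 0) := by
  have h := blk_pow_eq_sum K N p ⟨0, hp⟩ 1 (p - 1) ⟨p - 1, by omega⟩ rfl
  have h1 : ∀ i : Fin p, i ≤ ⟨p - 1, by omega⟩ := fun i => by
    rw [Fin.le_def]; have := i.2; simp only; omega
  have h2 : ∀ i' : Fin p, ∑ l, blk (sliceW K N p) i' l * blk (sliceJ K N p ^ ((i' : ℕ) + 1)) l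
      ⟨0, hp⟩ = ((i' : ℕ) + 1 : K) • (genW K N p 0 * genW K N p 0) +
        (∑ l, highestM K p 1 i' l) • genW K N p 1 := by
    intro i'
    rw [Finset.sum_smul, ← sub_eq_iff_eq_add, ← Finset.sum_sub_distrib, Finset.sum_eq_single i']
    · rw [blk_pow_add_one K N p ⟨0, hp⟩ rfl, blk_sliceW, if_pos le_rfl, highestM_one_apply,
        if_neg (by omega)]
      simp [highestM_zero]
    · intro l _ hl
      have hl' : (l : ℕ) ≠ i' := fun h => hl (Fin.ext h)
      rw [blk_sliceW]
      by_cases h3 : (l : ℕ) = i' + 1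
      · rw [if_pos (by omega), show (l : ℕ) - i' = 1 by omega, ← h3,
          blk_pow_self K N p ⟨0, hp⟩ rfl _ l rfl, mul_one, sub_self]
      · rw [highestM_one_apply, if_neg h3, zero_smul, sub_zero]
        by_cases h2 : (l : ℕ) < i'
        · rw [if_neg (by omega), zero_mul]
        · rw [blk_pow_eq_zero K N p (by simp only; omega), mul_zero]
    · simp
  simp only [h1, if_true, h2] at h
  rw [show p - 1 + 1 + 1 = p + 1 by omega, Finset.sum_add_distrib, ← Finset.sum_smul,
    ← Finset.sum_smul] at h
  rw [cornerX, h, add_comm]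
  have hs : ∀ n : ℕ, ∑ i ∈ Finset.range n, ((i : K) + 1) = n * (n + 1) / 2 := by
    intro n
    induction n with
    | zero => simp
    | succ n ih => rw [Finset.sum_range_succ, ih]; push_cast; ring
  have hc : ∀ n : ℕ, (((n + 1).choose 3 : ℕ) : K) = n * (n ^ 2 - 1) / 6 := by
    intro n
    induction n with
    | zero => simp [Nat.choose]
    | succ n ih =>
      rw [Nat.choose_succ_succ, Nat.cast_add, ih, Nat.cast_choose_two]; push_cast; ring
  congr 2
  -- For `p > 1` the coefficient is `binom(p+1, 3)`. For `p = 1` the closed form of `leadCoeff` is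
  -- not available, but both sides vanish.
  · by_cases hp1 : 1 < p
    · have := leadCoeff_eq K p hp1
      rw [leadCoeff] at this
      rw [this, ← hc]
      simp
    · obtain rfl : p = 1 := by omega
      simp [highestM_one_apply]
  · rw [← hs, Fin.sum_univ_eq_sum_range (fun i => ((i : K) + 1))]

end Corner

end FiniteW

end

noncomputable section

namespace FiniteW

/-! ### The change of generators as inversion of a power series. -/

section Inversion

variable {R : Type*} [CommRing R] {N : ℕ}

theorem sum_antidiagonalTuple_succ {M : Type*} [AddCommMonoid M] (n m : ℕ)
    (f : (Fin (n + 1) → ℕ) → M) : ∑ s ∈ Finset.Nat.antidiagonalTuple (n + 1) m, f s =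
      ∑ x ∈ Finset.HasAntidiagonal.antidiagonal m,
        ∑ t ∈ Finset.Nat.antidiagonalTuple n x.2, f (Fin.cons x.1 t) := by
  rw [Finset.sum_sigma']
  refine Finset.sum_bij' (fun s _ => ⟨(s 0, ∑ i, Fin.tail s i), Fin.tail s⟩)
    (fun x _ => Fin.cons x.1.1 x.2) ?_ ?_ ?_ ?_ ?_
  · intro s hs
    rw [Finset.Nat.mem_antidiagonalTuple, Fin.sum_univ_succ] at hs
    simp only [Finset.mem_sigma, Finset.HasAntidiagonal.mem_antidiagonal,
      Finset.Nat.mem_antidiagonalTuple, and_true]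
    exact hs
  · rintro ⟨⟨i, k⟩, t⟩ h
    simp only [Finset.mem_sigma, Finset.HasAntidiagonal.mem_antidiagonal,
      Finset.Nat.mem_antidiagonalTuple] at h
    rw [Finset.Nat.mem_antidiagonalTuple, Fin.sum_cons, h.2]
    exact h.1
  · intro s _
    exact Fin.cons_self_tail s
  · rintro ⟨⟨i, k⟩, t⟩ h
    simp only [Finset.mem_sigma, Finset.HasAntidiagonal.mem_antidiagonal,
      Finset.Nat.mem_antidiagonalTuple] at h
    obtain ⟨-, rfl⟩ := h
    simp
  · intro s _
    simp only [Fin.cons_self_tail]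

theorem coeff_mk_pow (B : ℕ → Matrix (Fin N) (Fin N) R) (n m : ℕ) :
    PowerSeries.coeff m (PowerSeries.mk B ^ n) =
      ∑ s ∈ Finset.Nat.antidiagonalTuple n m, word B s := by
  induction n generalizing m with
  | zero =>
    rw [pow_zero, PowerSeries.coeff_one]
    rcases m with _ | m
    · simp [word]
    · simp
  | succ n ih =>
    rw [pow_succ', PowerSeries.coeff_mul, sum_antidiagonalTuple_succ]
    refine Finset.sum_congr rfl fun x _ => ?_
    rw [PowerSeries.coeff_mk, ih, Finset.mul_sum]
    refine Finset.sum_congr rfl fun t _ => ?_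
    simp [word, List.ofFn_succ]

/-- The generating series `1 + ∑ B_j t^{j+1}`. -/
def barSeries (B : ℕ → Matrix (Fin N) (Fin N) R) : PowerSeries (Matrix (Fin N) (Fin N) R) :=
  1 + PowerSeries.X * PowerSeries.mk B

/-- The substitution `t ↦ -t`. -/
def twist (f : PowerSeries (Matrix (Fin N) (Fin N) R)) : PowerSeries (Matrix (Fin N) (Fin N) R) :=
  PowerSeries.mk fun k => (-1 : R) ^ k • PowerSeries.coeff k f

/-- The family with generating series `1 + ∑ B'_j (-t)^{j+1} = (1 + ∑ B_j t^{j+1})⁻¹`. -/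
def invFamily (B : ℕ → Matrix (Fin N) (Fin N) R) (j : ℕ) : Matrix (Fin N) (Fin N) R :=
  ∑ n ∈ Finset.Icc 1 (j + 1), (-1 : R) ^ (j + n + 1) •
    ∑ s ∈ Finset.Nat.antidiagonalTuple n (j + 1 - n), word B s

theorem coeff_zero_barSeries (B : ℕ → Matrix (Fin N) (Fin N) R) :
    PowerSeries.coeff 0 (barSeries B) = 1 := by
  rw [barSeries, map_add, PowerSeries.coeff_zero_X_mul, PowerSeries.coeff_one, if_pos rfl, add_zero]

theorem coeff_succ_barSeries (B : ℕ → Matrix (Fin N) (Fin N) R) (j : ℕ) :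
    PowerSeries.coeff (j + 1) (barSeries B) = B j := by
  rw [barSeries, map_add, PowerSeries.coeff_succ_X_mul, PowerSeries.coeff_one,
    if_neg (Nat.succ_ne_zero j), zero_add, PowerSeries.coeff_mk]

theorem coeff_twist (f : PowerSeries (Matrix (Fin N) (Fin N) R)) (k : ℕ) :
    PowerSeries.coeff k (twist f) = (-1 : R) ^ k • PowerSeries.coeff k f := PowerSeries.coeff_mk _ _

theorem twist_mul (f g : PowerSeries (Matrix (Fin N) (Fin N) R)) :
    twist (f * g) = twist f * twist g := by
  refine PowerSeries.ext fun k => ?_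
  rw [coeff_twist, PowerSeries.coeff_mul, PowerSeries.coeff_mul, Finset.smul_sum]
  refine Finset.sum_congr rfl fun x hx => ?_
  rw [coeff_twist, coeff_twist, Matrix.smul_mul, Matrix.mul_smul, smul_smul, ← pow_add,
    Finset.HasAntidiagonal.mem_antidiagonal.1 hx]

theorem twist_twist (f : PowerSeries (Matrix (Fin N) (Fin N) R)) : twist (twist f) = f := by
  refine PowerSeries.ext fun k => ?_
  rw [coeff_twist, coeff_twist, smul_smul, ← mul_pow]
  simp

theorem twist_one : twist (1 : PowerSeries (Matrix (Fin N) (Fin N) R)) = 1 := by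
  refine PowerSeries.ext fun k => ?_
  rw [coeff_twist, PowerSeries.coeff_one]
  split_ifs with h
  · simp [h]
  · simp

/-- The twist contributes `(-1)^{j+1}`, which turns the sign `(-1)^{j+n+1}` into `(-1)^n`: the
series is the geometric series of `-X · ∑ B_j X^j`. Terms with `n ≥ m` have order above `k`, so the
truncation is harmless. -/
theorem coeff_twist_invFamily (B : ℕ → Matrix (Fin N) (Fin N) R) (k m : ℕ) (hk : k < m) :
    PowerSeries.coeff k (twist (barSeries (invFamily B))) = PowerSeries.coeff k
      (∑ n ∈ Finset.range m, (-(PowerSeries.X * PowerSeries.mk B)) ^ n) := by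
  have h1 : ∀ n, PowerSeries.coeff k ((-(PowerSeries.X * PowerSeries.mk B)) ^ n) =
      if n ≤ k then (-1 : R) ^ n • ∑ s ∈ Finset.Nat.antidiagonalTuple n (k - n), word B s else 0 := by
    intro n
    have h2 : ((-(PowerSeries.X * PowerSeries.mk B)) ^ n : PowerSeries (Matrix (Fin N) (Fin N) R)) =
        PowerSeries.X ^ n * ((-1) ^ n * PowerSeries.mk B ^ n) := by
      rw [neg_pow, (PowerSeries.commute_X (PowerSeries.mk B)).symm.mul_pow, ← mul_assoc, ← mul_assoc,
        (PowerSeries.commute_X_pow ((-1) ^ n) n).eq]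
    have h3 : ((-1) ^ n : PowerSeries (Matrix (Fin N) (Fin N) R)) = PowerSeries.C ((-1) ^ n) := by
      simp
    rw [h2, PowerSeries.coeff_X_pow_mul']
    split_ifs with h
    · rw [h3, PowerSeries.coeff_C_mul, coeff_mk_pow]
      rcases Nat.even_or_odd n with hn | hn <;> simp [hn.neg_one_pow]
    · rfl
  rw [map_sum, Finset.sum_congr rfl fun n _ => h1 n, coeff_twist]
  rcases k with _ | j
  · rw [coeff_zero_barSeries, Finset.sum_eq_single 0]
    · simp [word]
    · intro n _ hn
      rw [if_neg (by omega)]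
    · intro h
      exact absurd (Finset.mem_range.2 hk) h
  · rw [coeff_succ_barSeries, invFamily, Finset.smul_sum, ← Finset.sum_filter]
    have h4 : (Finset.range m).filter (fun n => n ≤ j + 1) = insert 0 (Finset.Icc 1 (j + 1)) := by
      ext n
      simp only [Finset.mem_filter, Finset.mem_range, Finset.mem_insert, Finset.mem_Icc]
      omega
    rw [h4, Finset.sum_insert (by simp)]
    simp only [Finset.Nat.antidiagonalTuple_zero_succ, Nat.sub_zero, Finset.sum_empty, smul_zero,
      zero_add, smul_smul]
    refine Finset.sum_congr rfl fun n _ => ?_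
    rw [← pow_add, show j + 1 + (j + n + 1) = 2 * (j + 1) + n by ring, pow_add, pow_mul]
    simp

theorem barSeries_mul_twist (B : ℕ → Matrix (Fin N) (Fin N) R) :
    barSeries B * twist (barSeries (invFamily B)) = 1 ∧
      twist (barSeries (invFamily B)) * barSeries B = 1 := by
  have h0 : barSeries B = 1 - -(PowerSeries.X * PowerSeries.mk B) := by
    rw [barSeries, sub_neg_eq_add]
  have h1 : ∀ k, PowerSeries.coeff k ((-(PowerSeries.X * PowerSeries.mk B)) ^ (k + 1) :
      PowerSeries (Matrix (Fin N) (Fin N) R)) = 0 := by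
    intro k
    rw [neg_pow, (PowerSeries.commute_X (PowerSeries.mk B)).symm.mul_pow, ← mul_assoc,
      (PowerSeries.commute_X_pow ((-1) ^ (k + 1)) (k + 1)).eq, mul_assoc, PowerSeries.coeff_X_pow_mul',
      if_neg (by omega)]
  constructor
  · refine PowerSeries.ext fun k => ?_
    have h2 := congrArg (PowerSeries.coeff k)
      (mul_neg_geom_sum (-(PowerSeries.X * PowerSeries.mk B)) (k + 1))
    rw [map_sub, h1, sub_zero, ← h0, PowerSeries.coeff_mul] at h2
    rw [← h2, PowerSeries.coeff_mul]
    refine Finset.sum_congr rfl fun x hx => ?_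
    rw [coeff_twist_invFamily B x.2 (k + 1)]
    have := Finset.HasAntidiagonal.mem_antidiagonal.1 hx
    omega
  · refine PowerSeries.ext fun k => ?_
    have h2 := congrArg (PowerSeries.coeff k)
      (geom_sum_mul_neg (-(PowerSeries.X * PowerSeries.mk B)) (k + 1))
    rw [map_sub, h1, sub_zero, ← h0, PowerSeries.coeff_mul] at h2
    rw [← h2, PowerSeries.coeff_mul]
    refine Finset.sum_congr rfl fun x hx => ?_
    rw [coeff_twist_invFamily B x.1 (k + 1)]
    have := Finset.HasAntidiagonal.mem_antidiagonal.1 hx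
    omega

/-- The twist is an involutive ring homomorphism, so both sides give, after twisting, an inverse of
the same series; inverses are unique. -/
theorem invFamily_invFamily (B : ℕ → Matrix (Fin N) (Fin N) R) : invFamily (invFamily B) = B := by
  have h1 := congrArg twist (barSeries_mul_twist B).2
  rw [twist_mul, twist_twist, twist_one] at h1
  have h2 : twist (barSeries (invFamily (invFamily B))) = twist (barSeries B) :=
    left_inv_eq_right_inv (barSeries_mul_twist (invFamily B)).2 h1
  have h3 := congrArg twist h2
  rw [twist_twist, twist_twist] at h3
  ext1 j
  have h4 := congrArg (PowerSeries.coeff (j + 1)) h3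
  rwa [coeff_succ_barSeries, coeff_succ_barSeries] at h4

end Inversion

/-! ### How derivations act on the inverse family. -/

section Derivations

variable {K : Type*} [CommRing K] {R : Type*} [CommRing R] [Algebra K R] {N : ℕ}

theorem map_derivation_mul {l m n : Type*} [Fintype m] (D : Derivation K R R) (A : Matrix l m R)
    (B : Matrix m n R) : (A * B).map D = A.map D * B + A * B.map D := by
  refine Matrix.ext fun i j => ?_
  simp only [Matrix.map_apply, Matrix.mul_apply, Matrix.add_apply, map_sum, Derivation.leibniz,
    smul_eq_mul, Finset.sum_add_distrib]
  rw [add_comm]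
  congr 1
  exact Finset.sum_congr rfl fun _ _ => mul_comm _ _

theorem map_derivation_one {n : Type*} [DecidableEq n] (D : Derivation K R R) :
    (1 : Matrix n n R).map D = 0 := by
  refine Matrix.ext fun i j => ?_
  rw [Matrix.map_apply, Matrix.one_apply]
  split_ifs <;> simp

theorem map_derivation_sum {m n ι : Type*} (D : Derivation K R R) (s : Finset ι)
    (A : ι → Matrix m n R) : (∑ i ∈ s, A i).map D = ∑ i ∈ s, (A i).map D := by
  refine Matrix.ext fun i j => ?_
  simp only [Matrix.map_apply, Matrix.sum_apply, map_sum]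

theorem map_derivation_pow {n : Type*} [Fintype n] [DecidableEq n] (D : Derivation K R R)
    (A : Matrix n n R) (m : ℕ) :
    (A ^ m).map D = ∑ k ∈ Finset.range m, A ^ k * A.map D * A ^ (m - 1 - k) := by
  induction m with
  | zero => simp [map_derivation_one]
  | succ m ih =>
    rw [pow_succ, map_derivation_mul, ih, Finset.sum_range_succ, Finset.sum_mul]
    congr 1
    · refine Finset.sum_congr rfl fun k hk => ?_
      have := Finset.mem_range.1 hk
      rw [mul_assoc _ _ A, ← pow_succ, show m - 1 - k + 1 = m + 1 - 1 - k by omega]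
    · simp

/-- A derivation applied to the coefficients of a series of matrices. -/
def seriesMap (D : Derivation K R R) (f : PowerSeries (Matrix (Fin N) (Fin N) R)) :
    PowerSeries (Matrix (Fin N) (Fin N) R) :=
  PowerSeries.mk fun k => (PowerSeries.coeff k f).map D

theorem seriesMap_mul (D : Derivation K R R) (f g : PowerSeries (Matrix (Fin N) (Fin N) R)) :
    seriesMap D (f * g) = seriesMap D f * g + f * seriesMap D g := by
  refine PowerSeries.ext fun k => ?_
  simp only [seriesMap, PowerSeries.coeff_mk, map_add, PowerSeries.coeff_mul, map_derivation_sum,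
    map_derivation_mul, Finset.sum_add_distrib]

theorem seriesMap_one (D : Derivation K R R) :
    seriesMap D (1 : PowerSeries (Matrix (Fin N) (Fin N) R)) = 0 := by
  refine PowerSeries.ext fun k => ?_
  rw [seriesMap, PowerSeries.coeff_mk, PowerSeries.coeff_one, map_zero]
  split_ifs
  · exact map_derivation_one D
  · refine Matrix.ext fun i j => ?_
    simp

/-- From `S G = 1` one gets `D G = -G (D S) G`, so `D S = [E, S]` implies `D G = [E, G]`; the sign
of the twist cancels coefficientwise. -/
theorem map_derivation_invFamily_of_comm (D : Derivation K R R) {B : ℕ → Matrix (Fin N) (Fin N) R}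
    {E : Matrix (Fin N) (Fin N) R} (h : ∀ j, (B j).map D = comm E (B j)) (j : ℕ) :
    (invFamily B j).map D = comm E (invFamily B j) := by
  obtain ⟨h1, h2⟩ := barSeries_mul_twist B
  set S := barSeries B
  set G := twist (barSeries (invFamily B)) with hG
  have hS : seriesMap D S = PowerSeries.C E * S - S * PowerSeries.C E := by
    refine PowerSeries.ext fun k => ?_
    rw [seriesMap, PowerSeries.coeff_mk, map_sub, PowerSeries.coeff_C_mul, PowerSeries.coeff_mul_C]
    rcases k with _ | j
    · rw [coeff_zero_barSeries, map_derivation_one, mul_one, one_mul, sub_self]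
    · rw [coeff_succ_barSeries, h, comm]
  have h3 := congrArg (seriesMap D) h1
  rw [seriesMap_mul, seriesMap_one] at h3
  have h4 : seriesMap D G = PowerSeries.C E * G - G * PowerSeries.C E := by
    calc seriesMap D G = (G * S) * seriesMap D G := by rw [h2, one_mul]
      _ = G * -(seriesMap D S * G) := by rw [mul_assoc, eq_neg_of_add_eq_zero_right h3]
      _ = (G * S) * PowerSeries.C E * G - G * PowerSeries.C E * (S * G) := by rw [hS]; noncomm_ring
      _ = _ := by rw [h1, h2, one_mul, mul_one]
  have h5 := congrArg (PowerSeries.coeff (j + 1)) h4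
  rw [seriesMap, PowerSeries.coeff_mk, map_sub, PowerSeries.coeff_C_mul, PowerSeries.coeff_mul_C,
    hG, coeff_twist, coeff_succ_barSeries] at h5
  rcases neg_one_pow_eq_or R (j + 1) with h6 | h6
  · simpa [h6, comm] using h5
  · rw [h6] at h5
    simp only [neg_smul, one_smul, mul_neg, neg_mul] at h5
    have h7 : (-(invFamily B j)).map D = -((invFamily B j).map D) := by
      refine Matrix.ext fun a b => ?_
      simp
    rw [h7, ← neg_sub', neg_inj] at h5
    exact h5

/-- Again `D G = -G (D S) G`. The commutator keeps its form for `G`, but it involves one more power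
of `t` than the other terms, so undoing the twist changes its sign. -/
theorem map_derivation_invFamily_of_shift (D : Derivation K R R) {B : ℕ → Matrix (Fin N) (Fin N) R}
    {E : Matrix (Fin N) (Fin N) R}
    (h : ∀ j, (B j).map D = comm E (B (j + 1)) + B 0 * E * B j - B j * E * B 0) (j : ℕ) :
    (invFamily B j).map D = - comm E (invFamily B (j + 1)) + E * B 0 * invFamily B j -
      invFamily B j * B 0 * E := by
  obtain ⟨h1, h2⟩ := barSeries_mul_twist B
  set S := barSeries B
  set G := twist (barSeries (invFamily B)) with hG
  set e : PowerSeries (Matrix (Fin N) (Fin N) R) := PowerSeries.C E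
  set x : PowerSeries (Matrix (Fin N) (Fin N) R) := PowerSeries.C (B 0)
  set t : PowerSeries (Matrix (Fin N) (Fin N) R) := PowerSeries.X
  have ht : ∀ f : PowerSeries (Matrix (Fin N) (Fin N) R), t * f = f * t := fun f => PowerSeries.X_mul
  -- The hypotheses for all `j` in one identity. The coefficient of `t` is not among them: there
  -- `[E, B_0]` cancels against `B_0 E - E B_0`, which comes from the constant term `1` of `S`.
  have hS : t * seriesMap D S = e * S - S * e + t * (x * (e * S) - S * (e * x)) := by
    refine PowerSeries.ext fun k => ?_
    rcases k with _ | k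
    · simp only [map_add, map_sub, t, PowerSeries.coeff_zero_X_mul, e, PowerSeries.coeff_C_mul,
        PowerSeries.coeff_mul_C]
      rw [coeff_zero_barSeries, mul_one, one_mul, sub_self, add_zero]
    · simp only [map_add, map_sub, t, PowerSeries.coeff_succ_X_mul, e, x, ← mul_assoc,
        PowerSeries.coeff_mul_C]
      simp only [mul_assoc, PowerSeries.coeff_C_mul, seriesMap, PowerSeries.coeff_mk]
      rw [coeff_succ_barSeries]
      rcases k with _ | j
      · rw [coeff_zero_barSeries, map_derivation_one]
        noncomm_ring
      · rw [coeff_succ_barSeries, h, comm]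
        noncomm_ring
  have h3 := congrArg (seriesMap D) h1
  rw [seriesMap_mul, seriesMap_one] at h3
  have h4 : t * seriesMap D G = e * G - G * e + t * (e * (x * G) - G * (x * e)) := by
    calc t * seriesMap D G = t * ((G * S) * seriesMap D G) := by rw [h2, one_mul]
      _ = (t * G) * -(seriesMap D S * G) := by
        rw [mul_assoc G, eq_neg_of_add_eq_zero_right h3, mul_assoc]
      _ = - (G * (t * seriesMap D S) * G) := by rw [ht]; noncomm_ring
      _ = (G * S) * (e * G) - (G * e) * (S * G) + ((G * t) * S * (e * x * G) -
          (G * t) * (x * e) * (S * G)) := by rw [hS]; noncomm_ring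
      _ = _ := by
        rw [← ht, mul_assoc t G S, h1, h2]
        noncomm_ring
  have h5 := congrArg (PowerSeries.coeff (j + 2)) h4
  simp only [map_add, map_sub, t, PowerSeries.coeff_succ_X_mul, e, x, ← mul_assoc,
        PowerSeries.coeff_mul_C] at h5
  simp only [mul_assoc, PowerSeries.coeff_C_mul, seriesMap, PowerSeries.coeff_mk] at h5
  rw [hG, coeff_twist, coeff_twist, coeff_succ_barSeries, coeff_succ_barSeries,
    pow_succ _ (j + 1)] at h5
  rcases neg_one_pow_eq_or R (j + 1) with h6 | h6
  · rw [h6] at h5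
    simp only [one_smul, one_mul, neg_smul] at h5
    rw [h5, comm]
    noncomm_ring
  · rw [h6] at h5
    have h7 : (-(invFamily B j)).map D = -((invFamily B j).map D) := by
      refine Matrix.ext fun a b => ?_
      simp
    simp only [neg_smul, one_smul, neg_mul, one_mul, neg_neg, h7, mul_neg] at h5
    rw [← neg_inj, h5, comm]
    noncomm_ring

end Derivations

end FiniteW

end

noncomputable section

namespace FiniteW

/-! ### Brackets of the corner blocks. -/

section CornerBracket

variable (K : Type*) [Field K] [CharZero K] {N p : ℕ}

theorem map_pderiv_sliceJ (y : Fin p × Fin N × Fin N) :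
    (sliceJ K N p).map (MvPolynomial.pderiv y) = basisW K N p (hwIdx y) := by
  classical
  refine Matrix.ext fun u v => ?_
  rw [sliceJ_eq, Matrix.map_apply, Matrix.add_apply, map_add, epsW, Matrix.map_apply,
    MvPolynomial.pderiv_C, zero_add, sliceW, Matrix.sum_apply, map_sum, Finset.sum_eq_single y]
  · simp [basisW]
  · intro z _ hz
    simp [basisW, MvPolynomial.pderiv_X_of_ne hz]
  · simp

/-- The gradient of the entry `(a, b)` of a block of `𝕁^m`. -/
def powGrad (i₀ i₁ : Fin p) (m : ℕ) (a b : Fin N) : MatW K N p :=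
  ∑ k ∈ Finset.range m, sliceJ K N p ^ (m - 1 - k) * Matrix.single (b, i₀) (a, i₁) 1 *
    sliceJ K N p ^ k

omit [CharZero K] in
theorem trace_powGrad_mul (i₀ i₁ : Fin p) (m : ℕ) (a b : Fin N) (M : MatW K N p) :
    Matrix.trace (powGrad K i₀ i₁ m a b * M) = ∑ k ∈ Finset.range m,
      (sliceJ K N p ^ k * M * sliceJ K N p ^ (m - 1 - k)) (a, i₁) (b, i₀) := by
  rw [powGrad, Finset.sum_mul, Matrix.trace_sum]
  refine Finset.sum_congr rfl fun k _ => ?_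
  rw [mul_assoc, mul_assoc, Matrix.trace_mul_comm, mul_assoc, Matrix.trace_single_mul, one_smul]

omit [CharZero K] in
theorem comm_powGrad (i₀ i₁ : Fin p) (m : ℕ) (a b : Fin N) :
    comm (powGrad K i₀ i₁ m a b) (sliceJ K N p) =
      Matrix.single (b, i₀) (a, i₁) 1 * sliceJ K N p ^ m -
        sliceJ K N p ^ m * Matrix.single (b, i₀) (a, i₁) 1 := by
  set f : ℕ → MatW K N p := fun k => sliceJ K N p ^ (m - k) * Matrix.single (b, i₀) (a, i₁) 1 *
    sliceJ K N p ^ k with hf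
  have h := Finset.sum_range_sub f m
  have h1 : comm (powGrad K i₀ i₁ m a b) (sliceJ K N p) =
      ∑ k ∈ Finset.range m, (f (k + 1) - f k) := by
    rw [powGrad, comm_sum_left]
    refine Finset.sum_congr rfl fun k hk => ?_
    have hk' := Finset.mem_range.1 hk
    rw [comm, hf]
    simp only
    rw [mul_assoc, ← pow_succ, ← mul_assoc, ← mul_assoc, ← pow_succ',
      show m - 1 - k + 1 = m - k by omega, show m - (k + 1) = m - 1 - k by omega]
  rw [h1, h, hf]
  simp

/-- The hypothesis `h` forces `i₁ = p - 1` and `i₀ = 0`. The matrix unit then has degree `p - 1`,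
which compensates the lowest possible degree `1 - p` of `𝕁^m`; this is why the bottom left corner is
used. -/
theorem isGrad_powGrad (i₀ i₁ : Fin p) (h : (i₁ : ℕ) + 1 = p + i₀) (m : ℕ) (a b : Fin N) :
    IsGrad ((sliceJ K N p ^ m) (a, i₁) (b, i₀)) (powGrad K i₀ i₁ m a b) where
  trace_mul y := by
    have h1 := map_derivation_pow (MvPolynomial.pderiv y) (sliceJ K N p) m
    have h2 := congrFun (congrFun h1 (a, i₁)) (b, i₀)
    rw [Matrix.map_apply] at h2
    rw [h2, trace_powGrad_mul, map_pderiv_sliceJ, Matrix.sum_apply]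
  degGE := by
    have h1 : DegGE ((p : ℤ) - 1) (Matrix.single (b, i₀) (a, i₁) (1 : WAlg K N p)) := by
      intro c d i l hil
      rw [Matrix.single_apply_of_ne]
      rintro ⟨h1, h2⟩
      simp only [Prod.mk.injEq] at h1 h2
      rw [← h1.2, ← h2.2] at hil
      omega
    have h2 : DegGE (1 - (p : ℤ)) (sliceJ K N p ^ m) := degGE_of_le _ le_rfl
    rw [comm_powGrad]
    exact ((h1.mul h2).mono (by omega)).sub ((h2.mul h1).mono (by omega))

theorem mul_single_mul_apply {n R : Type*} [Fintype n] [DecidableEq n] [CommRing R]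
    (A B : Matrix n n R) (i j k l : n) :
    (A * Matrix.single i j 1 * B : Matrix n n R) k l = A k i * B j l := by
  rw [Matrix.mul_apply, Finset.sum_eq_single j]
  · rw [Matrix.mul_single_apply_same, mul_one]
  · intro x _ hx
    rw [Matrix.mul_single_apply_of_ne _ _ _ _ _ hx, zero_mul]
  · simp

theorem wBracket_pow (i₀ i₁ : Fin p) (h : (i₁ : ℕ) + 1 = p + i₀) (m n : ℕ) (a b c d : Fin N) :
    wBracket K N p ((sliceJ K N p ^ m) (a, i₁) (b, i₀)) ((sliceJ K N p ^ n) (c, i₁) (d, i₀)) =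
      ∑ k ∈ Finset.range n,
        ((sliceJ K N p ^ k) (c, i₁) (b, i₀) * (sliceJ K N p ^ (m + n - 1 - k)) (a, i₁) (d, i₀) -
          (sliceJ K N p ^ (k + m)) (c, i₁) (b, i₀) *
            (sliceJ K N p ^ (n - 1 - k)) (a, i₁) (d, i₀)) := by
  rw [wBracket_eq_lieForm (isGrad_powGrad K i₀ i₁ h m a b) (isGrad_powGrad K i₀ i₁ h n c d),
    lieForm, comm_powGrad, trace_powGrad_mul]
  refine Finset.sum_congr rfl fun k hk => ?_
  have hk' := Finset.mem_range.1 hk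
  rw [mul_sub, sub_mul, Matrix.sub_apply, ← mul_assoc, mul_assoc _ (sliceJ K N p ^ m),
    ← pow_add, mul_single_mul_apply, ← mul_assoc, ← pow_add, mul_single_mul_apply,
    show m + (n - 1 - k) = m + n - 1 - k by omega]

variable (hp : 0 < p)

/-- In the corner `𝕁^k` vanishes for `k < p - 1` and is the identity for `k = p - 1`. These low
powers yield the Kronecker terms of `wBracket_pow`, the others the quadratic ones. -/
theorem wBracket_cornerX (i j : ℕ) (a b c d : Fin N) :
    wBracket K N p (cornerX K N hp i a b) (cornerX K N hp j c d) =
      kd _ c b * cornerX K N hp (i + j) a d - kd _ a d * cornerX K N hp (i + j) c b +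
        (∑ r ∈ Finset.range j, cornerX K N hp r c b * cornerX K N hp (i + j - 1 - r) a d -
          ∑ r ∈ Finset.range j, cornerX K N hp (r + i) c b * cornerX K N hp (j - 1 - r) a d) := by
  set i₀ : Fin p := ⟨0, hp⟩
  set i₁ : Fin p := ⟨p - 1, by omega⟩
  have hX : ∀ k (x y : Fin N), (sliceJ K N p ^ (p + k)) (x, i₁) (y, i₀) = cornerX K N hp k x y :=
    fun k x y => rfl
  have h0 : ∀ k (x y : Fin N), k + 1 < p → (sliceJ K N p ^ k) (x, i₁) (y, i₀) = 0 := by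
    intro k x y hk
    exact congrFun (congrFun (blk_pow_eq_zero K N p (m := k) (i := i₁) (l := i₀)
      (by simp only [i₀, i₁]; omega)) x) y
  have h1 : ∀ x y : Fin N, (sliceJ K N p ^ (p - 1)) (x, i₁) (y, i₀) = kd _ x y := by
    intro x y
    exact congrFun (congrFun (blk_pow_self K N p i₀ rfl (p - 1) i₁ rfl) x) y
  have hb := wBracket_pow K i₀ i₁ (by simp only [i₀, i₁]; omega) (p + i) (p + j) a b c d
  rw [hX, hX] at hb
  rw [hb, Finset.sum_sub_distrib, Finset.sum_range_add]
  have e1 : ∑ k ∈ Finset.range p, (sliceJ K N p ^ k) (c, i₁) (b, i₀) *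
      (sliceJ K N p ^ (p + i + (p + j) - 1 - k)) (a, i₁) (d, i₀) =
      kd _ c b * cornerX K N hp (i + j) a d := by
    rw [Finset.sum_eq_single (p - 1), h1, ← hX]
    · rw [show p + i + (p + j) - 1 - (p - 1) = p + (i + j) by omega]
    · intro k hk hk'
      have := Finset.mem_range.1 hk
      rw [h0 k _ _ (by omega), zero_mul]
    · intro h
      exact absurd (Finset.mem_range.2 (by omega)) h
  have e2 : ∀ k ∈ Finset.range j, (sliceJ K N p ^ (p + k)) (c, i₁) (b, i₀) *
      (sliceJ K N p ^ (p + i + (p + j) - 1 - (p + k))) (a, i₁) (d, i₀) =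
      cornerX K N hp k c b * cornerX K N hp (i + j - 1 - k) a d := by
    intro k hk
    have := Finset.mem_range.1 hk
    rw [← hX, ← hX, show p + i + (p + j) - 1 - (p + k) = p + (i + j - 1 - k) by omega]
  rw [e1, Finset.sum_congr rfl e2, add_comm p j, Finset.sum_range_add]
  have e3 : ∀ k ∈ Finset.range j, (sliceJ K N p ^ (k + (p + i))) (c, i₁) (b, i₀) *
      (sliceJ K N p ^ (j + p - 1 - k)) (a, i₁) (d, i₀) =
      cornerX K N hp (k + i) c b * cornerX K N hp (j - 1 - k) a d := by
    intro k hk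
    have := Finset.mem_range.1 hk
    rw [← hX, ← hX, show k + (p + i) = p + (k + i) by ring,
      show j + p - 1 - k = p + (j - 1 - k) by omega]
  have e4 : ∑ k ∈ Finset.range p, (sliceJ K N p ^ (j + k + (p + i))) (c, i₁) (b, i₀) *
      (sliceJ K N p ^ (j + p - 1 - (j + k))) (a, i₁) (d, i₀) =
      kd _ a d * cornerX K N hp (i + j) c b := by
    rw [Finset.sum_eq_single 0, ← hX, show j + p - 1 - (j + 0) = p - 1 by omega, h1, mul_comm,
      show j + 0 + (p + i) = p + (i + j) by ring]
    · intro k hk hk'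
      have := Finset.mem_range.1 hk
      rw [h0 (j + p - 1 - (j + k)) _ _ (by omega), mul_zero]
    · intro h
      exact absurd (Finset.mem_range.2 (by omega)) h
  rw [e4, Finset.sum_congr rfl e3]
  ring

theorem wBracket_cornerX_zero (j : ℕ) (a b c d : Fin N) :
    wBracket K N p (cornerX K N hp 0 a b) (cornerX K N hp j c d) =
      kd _ c b * cornerX K N hp j a d - kd _ a d * cornerX K N hp j c b := by
  rw [wBracket_cornerX]
  simp

theorem wBracket_cornerX_one (j : ℕ) (a b c d : Fin N) :
    wBracket K N p (cornerX K N hp 1 a b) (cornerX K N hp j c d) =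
      kd _ c b * cornerX K N hp (j + 1) a d - kd _ a d * cornerX K N hp (j + 1) c b +
        cornerX K N hp 0 c b * cornerX K N hp j a d -
          cornerX K N hp j c b * cornerX K N hp 0 a d := by
  rw [wBracket_cornerX, ← Finset.sum_sub_distrib, add_comm 1 j, add_sub_assoc]
  congr 1
  -- The two quadratic sums differ by a shift of `r`, so for first index `1` only the end terms
  -- remain.
  have h := Finset.sum_range_sub'
    (fun r => cornerX K N hp r c b * cornerX K N hp (j - r) a d) j
  simp only [Nat.sub_zero, Nat.sub_self] at h
  rw [← h]
  refine Finset.sum_congr rfl fun r _ => ?_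
  rw [show j + 1 - 1 - r = j - r by omega, show j - (r + 1) = j - 1 - r by omega]

theorem single_mul_apply_kd {R : Type*} [CommRing R] (a b c d : Fin N)
    (M : Matrix (Fin N) (Fin N) R) :
    (Matrix.single b a 1 * M : Matrix (Fin N) (Fin N) R) c d = kd R c b * M a d := by
  rw [kd]
  by_cases h : c = b
  · subst h; simp
  · simp [h]

theorem mul_single_apply_kd {R : Type*} [CommRing R] (a b c d : Fin N)
    (M : Matrix (Fin N) (Fin N) R) :
    (M * Matrix.single b a 1 : Matrix (Fin N) (Fin N) R) c d = M c b * kd R a d := by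
  rw [kd]
  by_cases h : a = d
  · subst h; simp
  · rw [if_neg h, Matrix.mul_single_apply_of_ne _ _ _ _ _ (Ne.symm h), mul_zero]

/-- In matrix form the bracket relation becomes an action of a derivation by `ad E_{ba}`, which is
what passes to inverse series. -/
theorem map_wDer_zero (j : ℕ) (a b : Fin N) :
    (cornerX K N hp j).map (wDer K N p (cornerX K N hp 0 a b)) =
      comm (Matrix.single b a 1) (cornerX K N hp j) := by
  refine Matrix.ext fun c d => ?_
  rw [Matrix.map_apply, wDer_apply, wBracket_cornerX_zero, comm, Matrix.sub_apply,
    single_mul_apply_kd, mul_single_apply_kd]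
  ring

theorem map_wDer_one (j : ℕ) (a b : Fin N) :
    (cornerX K N hp j).map (wDer K N p (cornerX K N hp 1 a b)) =
      comm (Matrix.single b a 1) (cornerX K N hp (j + 1)) +
        cornerX K N hp 0 * Matrix.single b a 1 * cornerX K N hp j -
        cornerX K N hp j * Matrix.single b a 1 * cornerX K N hp 0 := by
  refine Matrix.ext fun c d => ?_
  rw [Matrix.map_apply, wDer_apply, wBracket_cornerX_one, comm, Matrix.sub_apply, Matrix.add_apply,
    Matrix.sub_apply, single_mul_apply_kd, mul_single_apply_kd, mul_single_mul_apply,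
    mul_single_mul_apply]
  ring

end CornerBracket

/-! ### The family of sign `-`. -/

section InverseFamily

variable (K : Type*) [Field K] [CharZero K] {N p : ℕ} (hp : 0 < p)

/-- The family of sign `-`. -/
def cornerY (j : ℕ) : Matrix (Fin N) (Fin N) (WAlg K N p) := invFamily (cornerX K N hp) j

omit [CharZero K] in
theorem invFamily_zero {R : Type*} [CommRing R] (B : ℕ → Matrix (Fin N) (Fin N) R) :
    invFamily B 0 = B 0 := by
  simp [invFamily, word]

omit [CharZero K] in
theorem invFamily_one {R : Type*} [CommRing R] (B : ℕ → Matrix (Fin N) (Fin N) R) :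
    invFamily B 1 = B 0 * B 0 - B 1 := by
  have h : Finset.Icc 1 2 = ({1, 2} : Finset ℕ) := by decide
  rw [invFamily, h, Finset.sum_pair (by decide)]
  simp only [Finset.Nat.antidiagonalTuple_one, Finset.Nat.antidiagonalTuple_zero_right, word,
    Finset.sum_singleton, List.ofFn_succ, List.ofFn_zero, Nat.sub_self]
  norm_num
  abel

theorem map_wDer_cornerY_zero (j : ℕ) (a b : Fin N) :
    (cornerY K hp j).map (wDer K N p (cornerX K N hp 0 a b)) =
      comm (Matrix.single b a 1) (cornerY K hp j) :=
  map_derivation_invFamily_of_comm _ (fun j => map_wDer_zero K hp j a b) j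

/-- With `E = E_{ba}` and `Y_1 = X_0 X_0 - X_1`, the square acts by `ad(E X_0 + X_0 E)` and `-X_1`
by the negative of `map_derivation_invFamily_of_shift`. The terms containing `E X_0 Y_j` and `Y_j
X_0 E` cancel, leaving the relation of the same shape as for `X`. -/
theorem map_wDer_cornerY_one (j : ℕ) (a b : Fin N) :
    (cornerY K hp j).map (wDer K N p (cornerY K hp 1 a b)) =
      comm (Matrix.single b a 1) (cornerY K hp (j + 1)) +
        cornerY K hp 0 * Matrix.single b a 1 * cornerY K hp j -
        cornerY K hp j * Matrix.single b a 1 * cornerY K hp 0 := by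
  set X := cornerX K N hp with hX
  have h0 : cornerY K hp 0 = X 0 := invFamily_zero X
  have h1 : cornerY K hp 1 = X 0 * X 0 - X 1 := invFamily_one X
  have hD : wDer K N p (cornerY K hp 1 a b) = ∑ e, (X 0 a e • wDer K N p (X 0 e b) +
      X 0 e b • wDer K N p (X 0 a e)) - wDer K N p (X 1 a b) := by
    have hs : ∀ s : Finset (Fin N), ∀ f : Fin N → WAlg K N p,
        wDer K N p (∑ e ∈ s, f e) = ∑ e ∈ s, wDer K N p (f e) := by
      intro s f
      exact map_sum (AddMonoidHom.mk' (wDer K N p) (wDer_add K N p)) f s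
    have hn : ∀ f : WAlg K N p, wDer K N p (-f) = - wDer K N p f := by
      intro f
      exact map_neg (AddMonoidHom.mk' (wDer K N p) (wDer_add K N p)) f
    rw [h1, Matrix.sub_apply, Matrix.mul_apply, sub_eq_add_neg, wDer_add, hn, hs, ← sub_eq_add_neg]
    simp only [wDer_mul]
  have hM : ∀ M : Matrix (Fin N) (Fin N) (WAlg K N p), M.map (wDer K N p (cornerY K hp 1 a b)) =
      ∑ e, (X 0 a e • M.map (wDer K N p (X 0 e b)) + X 0 e b • M.map (wDer K N p (X 0 a e))) -
        M.map (wDer K N p (X 1 a b)) := by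
    intro M
    refine Matrix.ext fun c d => ?_
    rw [Matrix.map_apply, hD, Matrix.sub_apply, Matrix.sum_apply, Derivation.sub_apply]
    congr 1
    exact congrFun (map_sum (Derivation.coeFnAddMonoidHom (R := K) (A := WAlg K N p)
      (M := WAlg K N p)) _ _) (M c d) |>.trans (by rw [Finset.sum_apply]; rfl)
  have h2 : ∑ e, X 0 a e • Matrix.single b e (1 : WAlg K N p) = Matrix.single b a 1 * X 0 := by
    refine Matrix.ext fun c d => ?_
    rw [single_mul_apply_kd, Matrix.sum_apply, Finset.sum_eq_single d]
    · by_cases h : c = b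
      · subst h; simp [kd]
      · simp [kd, h, Matrix.single_apply_of_row_ne (Ne.symm h)]
    · intro e _ he
      simp [Matrix.single_apply_of_col_ne _ _ he]
    · simp
  have h3 : ∑ e, X 0 e b • Matrix.single e a (1 : WAlg K N p) = X 0 * Matrix.single b a 1 := by
    refine Matrix.ext fun c d => ?_
    rw [mul_single_apply_kd, Matrix.sum_apply, Finset.sum_eq_single c]
    · by_cases h : a = d
      · subst h; simp [kd]
      · simp [kd, h]
    · intro e _ he
      simp [Matrix.single_apply_of_row_ne he]
    · simp
  have h4 := map_derivation_invFamily_of_shift (wDer K N p (X 1 a b))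
    (fun j => map_wDer_one K hp j a b) j
  rw [hM]
  simp only [hX, map_wDer_cornerY_zero]
  simp only [← comm_smul_left, Finset.sum_add_distrib, ← comm_sum_left, ← hX, h2, h3]
  change _ - (cornerY K hp j).map _ = _
  rw [show (cornerY K hp j).map (wDer K N p (X 1 a b)) = _ from h4, h0]
  change _ - (- comm _ (cornerY K hp (j + 1)) + _ * cornerY K hp j - cornerY K hp j * _ * _) = _
  simp only [comm]
  noncomm_ring

end InverseFamily

end FiniteW

end

noncomputable section

namespace FiniteW

/-! ### Triangularity of the inverse family with respect to word length. -/

section Words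

variable {K : Type*} [Field K] {R : Type*} [CommRing R] [Algebra K R] {N : ℕ}

theorem word_cons {n : ℕ} (B : ℕ → Matrix (Fin N) (Fin N) R) (s : Fin (n + 1) → ℕ) :
    word B s = B (s 0) * word B (Fin.tail s) := by
  simp [word, List.ofFn_succ, Fin.tail]

theorem word_mem_wordSpan {B X : ℕ → Matrix (Fin N) (Fin N) R}
    (h : ∀ j, X j ∈ wordSpan K B 1 (j + 1)) {n : ℕ} (s : Fin n → ℕ) :
    word X s ∈ wordSpan K B n (n + ∑ i, s i) := by
  induction n with
  | zero => exact Submodule.subset_span ⟨0, Fin.elim0, le_rfl, by simp, by simp [word]⟩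
  | succ n ih =>
    rw [word_cons, Fin.sum_univ_succ]
    have h1 := mul_mem_wordSpan (h (s 0)) (ih (Fin.tail s))
    rwa [show 1 + n = n + 1 by ring,
      show s 0 + 1 + (n + ∑ i, Fin.tail s i) = n + 1 + (s 0 + ∑ i, Fin.tail s i) by ring] at h1

theorem invFamily_sub_mem {B X : ℕ → Matrix (Fin N) (Fin N) R}
    (h : ∀ j, X j ∈ wordSpan K B 1 (j + 1)) (j : ℕ) :
    invFamily X j - (-1 : K) ^ j • X j ∈ wordSpan K B 2 (j + 1) := by
  have h1 : Finset.Icc 1 (j + 1) = insert 1 (Finset.Icc 2 (j + 1)) := by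
    ext n; simp only [Finset.mem_insert, Finset.mem_Icc]; omega
  have hc : ∀ (k : ℕ) (M : Matrix (Fin N) (Fin N) R), (-1 : R) ^ k • M = (-1 : K) ^ k • M := by
    intro k M
    rcases Nat.even_or_odd k with hk | hk <;> simp [hk.neg_one_pow]
  have h2 : word X ![j] = X j := by simp [word]
  rw [invFamily, h1, Finset.sum_insert (by simp), Nat.add_sub_cancel,
    Finset.Nat.antidiagonalTuple_one, Finset.sum_singleton, hc, h2,
    show j + 1 + 1 = j + 2 by ring, pow_add, neg_one_sq, mul_one, add_sub_cancel_left]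
  refine Submodule.sum_mem _ fun n hn => ?_
  rw [hc]
  refine Submodule.smul_mem _ _ (Submodule.sum_mem _ fun s hs => ?_)
  have h3 := wordSpan_mono (K := K) B (Finset.mem_Icc.1 hn).1 _ (word_mem_wordSpan h s)
  have h4 := Finset.Nat.mem_antidiagonalTuple.1 hs
  have h5 := (Finset.mem_Icc.1 hn).2
  rwa [h4, show n + (j + 1 - n) = j + 1 by omega] at h3

theorem word_apply_mem (S : Subalgebra K R) (B : ℕ → Matrix (Fin N) (Fin N) R) {n : ℕ}
    (s : Fin n → ℕ) (h : ∀ i a b, B (s i) a b ∈ S) (a b : Fin N) : word B s a b ∈ S := by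
  induction n generalizing a with
  | zero =>
    simp only [word, List.ofFn_zero, List.prod_nil, Matrix.one_apply]
    split_ifs
    · exact S.one_mem
    · exact S.zero_mem
  | succ n ih =>
    rw [word_cons, Matrix.mul_apply]
    exact S.sum_mem fun c _ => S.mul_mem (h 0 a c) (ih _ (fun i => h i.succ) c)

/-- A word of length at least two with `n + |s| = j + 1` only has letters of index below `j`. -/
theorem apply_mem_of_mem_wordSpan (S : Subalgebra K R) {B : ℕ → Matrix (Fin N) (Fin N) R} {j : ℕ}
    (hB : ∀ s < j, ∀ a b, B s a b ∈ S) {M : Matrix (Fin N) (Fin N) R}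
    (hM : M ∈ wordSpan K B 2 (j + 1)) (a b : Fin N) : M a b ∈ S := by
  induction hM using Submodule.span_induction with
  | mem x hx =>
    obtain ⟨n, s, h1, h2, rfl⟩ := hx
    refine word_apply_mem S B s (fun i => hB _ ?_) a b
    have := Finset.single_le_sum (f := s) (fun _ _ => Nat.zero_le _) (Finset.mem_univ i)
    omega
  | zero => exact S.zero_mem
  | add x y _ _ hx hy => exact S.add_mem hx hy
  | smul r x _ hx => exact S.smul_mem hx r

end Words

/-! ### Both families are admissible and generate. -/

section Existence

variable (K : Type*) [Field K] [CharZero K] {N p : ℕ} (hp : 0 < p)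

theorem cornerX_mem (j : ℕ) : cornerX K N hp j ∈ wordSpan K (genW K N p) 1 (j + 1) := by
  have h := add_mem (wordSpan_mono _ (by omega : 1 ≤ 2) _ (cornerX_sub_mem K N hp j))
    (Submodule.smul_mem _ (leadCoeff K p j) (mem_wordSpan_one (K := K) (genW K N p) j))
  rwa [sub_add_cancel] at h

theorem cornerY_mem (j : ℕ) : cornerY K hp j ∈ wordSpan K (genW K N p) 1 (j + 1) := by
  have h := add_mem (wordSpan_mono _ (by omega : 1 ≤ 2) _ (invFamily_sub_mem (cornerX_mem K hp) j))
    (Submodule.smul_mem _ ((-1 : K) ^ j) (cornerX_mem K (N := N) hp j))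
  rwa [sub_add_cancel] at h

theorem cornerY_sub_mem (j : ℕ) :
    cornerY K hp j - ((-1) ^ j * leadCoeff K p j) • genW K N p j ∈
      wordSpan K (genW K N p) 2 (j + 1) := by
  have h := add_mem (invFamily_sub_mem (cornerX_mem K (N := N) hp) j)
    (Submodule.smul_mem _ ((-1 : K) ^ j) (cornerX_sub_mem K N hp j))
  rw [smul_sub, smul_smul] at h
  convert h using 1
  rw [cornerY]
  abel

omit [CharZero K] in
-- The triangular system is solved for `W_j` by strong induction on `j`.
theorem generates_of_sub_mem {B : ℕ → Matrix (Fin N) (Fin N) (WAlg K N p)} {c : ℕ → K}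
    (hc : ∀ j < p, c j ≠ 0)
    (hB : ∀ j, B j - c j • genW K N p j ∈ wordSpan K (genW K N p) 2 (j + 1)) : Generates B := by
  rw [Generates]
  set S := Algebra.adjoin K {w | ∃ j < p, ∃ a b : Fin N, w = B j a b} with hS
  have key : ∀ j, ∀ a b, genW K N p j a b ∈ S := by
    intro j
    induction j using Nat.strong_induction_on with
    | _ j ih =>
    intro a b
    by_cases hj : j < p
    · have h1 := apply_mem_of_mem_wordSpan S ih (hB j) a b
      have h2 : B j a b ∈ S := Algebra.subset_adjoin ⟨j, hj, a, b, rfl⟩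
      have h3 := S.smul_mem (S.sub_mem h2 h1) (c j)⁻¹
      rwa [Matrix.sub_apply, sub_sub_cancel, Matrix.smul_apply, inv_smul_smul₀ (hc j hj)] at h3
    · rw [genW, Matrix.of_apply, dif_neg hj]
      exact S.zero_mem
  rw [eq_top_iff, ← MvPolynomial.adjoin_range_X, Algebra.adjoin_le_iff]
  rintro _ ⟨⟨j, a, b⟩, rfl⟩
  have h := key j a b
  rwa [genW, Matrix.of_apply, dif_pos j.2] at h

theorem isBarFamily_cornerX : IsBarFamily 1 (cornerX K N hp) where
  zero := cornerX_zero K N hp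
  one := by
    rw [cornerX_one]
    simp
  words j _ := exists_coeff_of_mem_wordSpan (cornerX_mem K hp j)
  bracket_zero := wBracket_cornerX_zero K hp
  bracket_one j _ := wBracket_cornerX_one K hp j

theorem isBarFamily_cornerY : IsBarFamily (-1) (cornerY K (N := N) hp) where
  zero := by rw [cornerY, invFamily_zero, cornerX_zero]
  one := by
    rw [cornerY, invFamily_one, cornerX_one, cornerX_zero]
    simp only [Matrix.smul_mul, Matrix.mul_smul, smul_smul]
    push_cast
    module
  words j _ := exists_coeff_of_mem_wordSpan (cornerY_mem K hp j)
  bracket_zero j a b c d := by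
    have h := congrFun (congrFun (map_wDer_cornerY_zero K hp j a b) c) d
    rw [Matrix.map_apply, wDer_apply, comm, Matrix.sub_apply, single_mul_apply_kd,
      mul_single_apply_kd, mul_comm _ (kd _ a d)] at h
    rw [← h, cornerY, invFamily_zero]
  bracket_one j _ a b c d := by
    have h := congrFun (congrFun (map_wDer_cornerY_one K hp j a b) c) d
    rw [Matrix.map_apply, wDer_apply, comm, Matrix.sub_apply, Matrix.add_apply, Matrix.sub_apply,
      single_mul_apply_kd, mul_single_apply_kd, mul_comm _ (kd _ a d), mul_single_mul_apply,
      mul_single_mul_apply] at h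
    exact h

/-- The families of both signs. -/
def barFamily (ε : ℤˣ) : ℕ → Matrix (Fin N) (Fin N) (WAlg K N p) :=
  if ε = 1 then cornerX K N hp else cornerY K hp

theorem isBarFamily_barFamily (ε : ℤˣ) : IsBarFamily ε (barFamily K (N := N) hp ε) := by
  rcases Int.units_eq_one_or ε with rfl | rfl
  · rw [barFamily, if_pos rfl]
    exact isBarFamily_cornerX K hp
  · rw [barFamily, if_neg (by decide)]
    exact isBarFamily_cornerY K hp

theorem generates_barFamily (ε : ℤˣ) : Generates (barFamily K (N := N) hp ε) := by
  rcases Int.units_eq_one_or ε with rfl | rfl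
  · rw [barFamily, if_pos rfl]
    exact generates_of_sub_mem K (fun j hj => leadCoeff_ne_zero K p hj) (cornerX_sub_mem K N hp)
  · rw [barFamily, if_neg (by decide)]
    exact generates_of_sub_mem K
      (fun j hj => mul_ne_zero (pow_ne_zero _ (by simp)) (leadCoeff_ne_zero K p hj))
      (cornerY_sub_mem K hp)

omit [CharZero K] in
theorem barFamily_eq_invFamily (ε : ℤˣ) :
    barFamily K (N := N) hp ε = invFamily (barFamily K hp (-ε)) := by
  have h : ¬ (-1 : ℤˣ) = 1 := by decide
  rcases Int.units_eq_one_or ε with rfl | rfl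
  · rw [barFamily, if_pos rfl, barFamily, if_neg h]
    exact (invFamily_invFamily (cornerX K N hp)).symm
  · rw [neg_neg, barFamily, if_neg h, barFamily, if_pos rfl]
    rfl

omit [CharZero K] [Field K] in
theorem invFamily_apply {R : Type*} [CommRing R] (B : ℕ → Matrix (Fin N) (Fin N) R) (j : ℕ)
    (a b : Fin N) : invFamily B j a b = ∑ n ∈ Finset.Icc 1 (j + 1), (-1) ^ (j + n + 1) *
      ∑ s ∈ Finset.Nat.antidiagonalTuple n (j + 1 - n), word B s a b := by
  simp only [invFamily, Matrix.sum_apply, Matrix.smul_apply, smul_eq_mul]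

end Existence

end FiniteW

end

noncomputable section

namespace FiniteW

/-! ### A weight filtration separating diagonal from off-diagonal variables. -/

section Weights

variable {K : Type*} [Field K] {N p : ℕ}

/-- Diagonal entries have weight one, the others have weight two. -/
def entryWt (c d : Fin N) : ℕ := if c = d then 1 else 2

theorem entryWt_self (c : Fin N) : entryWt c c = 1 := if_pos rfl

theorem entryWt_of_ne {c d : Fin N} (h : c ≠ d) : entryWt c d = 2 := if_neg h

theorem entryWt_bounds (c d : Fin N) : 1 ≤ entryWt c d ∧ entryWt c d ≤ 2 := by
  rw [entryWt]; split_ifs <;> omega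

/-- The weight of a monomial in the generators `W_j^{ab}`. -/
def monWt (m : Fin p × Fin N × Fin N →₀ ℕ) : ℕ :=
  Finsupp.weight (fun y : Fin p × Fin N × Fin N => entryWt y.2.1 y.2.2) m

theorem monWt_add (m m' : Fin p × Fin N × Fin N →₀ ℕ) : monWt (m + m') = monWt m + monWt m' :=
  map_add _ _ _

theorem monWt_single (y : Fin p × Fin N × Fin N) :
    monWt (Finsupp.single y 1) = entryWt y.2.1 y.2.2 := by
  simp [monWt, Finsupp.weight_single]

/-- All monomials of `f` have weight at least `n`. -/
def WGE (n : ℤ) (f : WAlg K N p) : Prop := ∀ m, (monWt m : ℤ) < n → MvPolynomial.coeff m f = 0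

theorem WGE.mono {n n' : ℤ} {f : WAlg K N p} (h : WGE n f) (hn : n' ≤ n) : WGE n' f :=
  fun m hm => h m (by omega)

theorem wge_zero (n : ℤ) : WGE n (0 : WAlg K N p) := fun m _ => MvPolynomial.coeff_zero m

theorem wge_of_nonpos {n : ℤ} (hn : n ≤ 0) (f : WAlg K N p) : WGE n f := fun m hm => by omega

theorem WGE.add {n : ℤ} {f g : WAlg K N p} (hf : WGE n f) (hg : WGE n g) : WGE n (f + g) :=
  fun m hm => by rw [MvPolynomial.coeff_add, hf m hm, hg m hm, add_zero]

theorem WGE.neg {n : ℤ} {f : WAlg K N p} (hf : WGE n f) : WGE n (-f) :=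
  fun m hm => by rw [MvPolynomial.coeff_neg, hf m hm, neg_zero]

theorem WGE.sub {n : ℤ} {f g : WAlg K N p} (hf : WGE n f) (hg : WGE n g) : WGE n (f - g) := by
  rw [sub_eq_add_neg]
  exact hf.add hg.neg

theorem WGE.smul {n : ℤ} {f : WAlg K N p} (hf : WGE n f) (c : K) : WGE n (c • f) :=
  fun m hm => by rw [MvPolynomial.coeff_smul, hf m hm, smul_zero]

theorem WGE.sum {ι : Type*} {n : ℤ} (s : Finset ι) {f : ι → WAlg K N p}
    (h : ∀ i ∈ s, WGE n (f i)) : WGE n (∑ i ∈ s, f i) :=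
  fun m hm => by rw [MvPolynomial.coeff_sum, Finset.sum_eq_zero fun i hi => h i hi m hm]

theorem WGE.mul {n n' : ℤ} {f g : WAlg K N p} (hf : WGE n f) (hg : WGE n' g) :
    WGE (n + n') (f * g) := fun m hm => by
  classical
  rw [MvPolynomial.coeff_mul]
  refine Finset.sum_eq_zero fun x hx => ?_
  have h := congrArg monWt (Finset.HasAntidiagonal.mem_antidiagonal.1 hx)
  rw [monWt_add] at h
  by_cases h1 : (monWt x.1 : ℤ) < n
  · rw [hf _ h1, zero_mul]
  · rw [hg _ (by omega), mul_zero]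

theorem wge_X (y : Fin p × Fin N × Fin N) :
    WGE (entryWt y.2.1 y.2.2 : ℕ) (MvPolynomial.X y : WAlg K N p) := fun m hm => by
  classical
  rw [MvPolynomial.coeff_X, if_neg]
  rintro rfl
  rw [monWt_single] at hm
  omega

theorem WGE.pderiv {n : ℤ} {f : WAlg K N p} (hf : WGE n f) (y : Fin p × Fin N × Fin N) :
    WGE (n - (entryWt y.2.1 y.2.2 : ℕ)) (MvPolynomial.pderiv y f) := fun m hm => by
  rw [MvPolynomial.coeff_pderiv, hf, zero_mul]
  rw [monWt_add, monWt_single]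
  push_cast
  omega

theorem derivation_apply_eq_sum (D : Derivation K (WAlg K N p) (WAlg K N p)) (f : WAlg K N p) :
    D f = ∑ y, D (MvPolynomial.X y) * MvPolynomial.pderiv y f := by
  classical
  have h : D = ∑ y, D (MvPolynomial.X y) • MvPolynomial.pderiv y := by
    refine MvPolynomial.derivation_ext fun z => ?_
    have h1 := congrFun (map_sum (Derivation.coeFnAddMonoidHom (R := K) (A := WAlg K N p)
      (M := WAlg K N p)) (fun y => D (MvPolynomial.X y) • MvPolynomial.pderiv y) Finset.univ)
      (MvPolynomial.X z)
    refine Eq.trans ?_ h1.symm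
    rw [Finset.sum_apply, Finset.sum_eq_single z]
    · change _ = D (MvPolynomial.X z) • MvPolynomial.pderiv z (MvPolynomial.X z : WAlg K N p)
      rw [MvPolynomial.pderiv_X_self, smul_eq_mul, mul_one]
    · intro y _ hy
      change D (MvPolynomial.X y) • MvPolynomial.pderiv y (MvPolynomial.X z : WAlg K N p) = 0
      rw [MvPolynomial.pderiv_X_of_ne hy.symm, smul_zero]
    · simp
  have h1 := congrFun (map_sum (Derivation.coeFnAddMonoidHom (R := K) (A := WAlg K N p)
    (M := WAlg K N p)) (fun y => D (MvPolynomial.X y) • MvPolynomial.pderiv y) Finset.univ) f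
  conv_lhs => rw [h]
  refine h1.trans ?_
  rw [Finset.sum_apply]
  rfl

theorem WGE.derivation {D : Derivation K (WAlg K N p) (WAlg K N p)} {s : ℤ}
    (hD : ∀ y, WGE ((entryWt y.2.1 y.2.2 : ℕ) + s) (D (MvPolynomial.X y))) {n : ℤ}
    {f : WAlg K N p} (hf : WGE n f) : WGE (n + s) (D f) := by
  rw [derivation_apply_eq_sum]
  exact WGE.sum _ fun y _ => ((hD y).mul (hf.pderiv y)).mono (by omega)

/-- The difference of two variables of weight one can be cancelled. -/
theorem WGE.of_sub_mul {n : ℤ} {f : WAlg K N p} {x y : Fin p × Fin N × Fin N} (hxy : x ≠ y)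
    (hx : x.2.1 = x.2.2) (hy : y.2.1 = y.2.2)
    (h : WGE n ((MvPolynomial.X x - MvPolynomial.X y) * f)) : WGE (n - 1) f := by
  classical
  -- Induction on the exponent of `y`: the coefficient at `x · m` of the product equates the
  -- coefficients of `f` at `m` and at `x · m / y`, which has the same weight. Without a factor `y`
  -- the second one is absent.
  have key : ∀ k, ∀ m : Fin p × Fin N × Fin N →₀ ℕ, m y = k → (monWt m : ℤ) < n - 1 →
      MvPolynomial.coeff m f = 0 := by
    intro k
    induction k with
    | zero =>
      intro m hm hw
      have h1 := h (m + Finsupp.single x 1) (by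
        rw [monWt_add, monWt_single, hx, entryWt_self]; push_cast; omega)
      rw [sub_mul, MvPolynomial.coeff_sub, add_comm m, MvPolynomial.coeff_X_mul,
        MvPolynomial.coeff_X_mul', if_neg, sub_zero] at h1
      · exact h1
      · simp [hm, hxy]
    | succ k ih =>
      intro m hm hw
      obtain ⟨m', rfl⟩ : ∃ m', m = Finsupp.single y 1 + m' := by
        refine ⟨m - Finsupp.single y 1, ?_⟩
        ext z
        by_cases hz : z = y
        · subst hz
          simp only [Finsupp.coe_add, Finsupp.coe_tsub, Pi.add_apply, Pi.sub_apply,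
            Finsupp.single_eq_same]
          omega
        · simp [hz]
      rw [monWt_add, monWt_single, hy, entryWt_self] at hw
      have h1 := h (Finsupp.single x 1 + (Finsupp.single y 1 + m')) (by
        rw [monWt_add, monWt_single, monWt_add, monWt_single, hx, hy, entryWt_self, entryWt_self]
        push_cast at hw ⊢; omega)
      rw [sub_mul, MvPolynomial.coeff_sub, MvPolynomial.coeff_X_mul, add_left_comm,
        MvPolynomial.coeff_X_mul, sub_eq_zero] at h1
      rw [h1]
      refine ih _ ?_ ?_
      · simp only [Finsupp.coe_add, Pi.add_apply, Finsupp.single_eq_same] at hm ⊢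
        rw [Finsupp.single_apply, if_neg hxy]
        omega
      · rw [monWt_add, monWt_single, hx, entryWt_self]
        push_cast at hw ⊢
        omega
  exact fun m hm => key _ m rfl hm

/-- The entry `(c, d)` of the matrix has weight at least `entryWt c d + k`. -/
def MGE (k : ℤ) (M : Matrix (Fin N) (Fin N) (WAlg K N p)) : Prop :=
  ∀ c d, WGE ((entryWt c d : ℕ) + k) (M c d)

theorem MGE.mono {k k' : ℤ} {M : Matrix (Fin N) (Fin N) (WAlg K N p)} (h : MGE k M) (hk : k' ≤ k) :
    MGE k' M := fun c d => (h c d).mono (by omega)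

theorem MGE.add {k : ℤ} {M M' : Matrix (Fin N) (Fin N) (WAlg K N p)} (h : MGE k M)
    (h' : MGE k M') : MGE k (M + M') := fun c d => (h c d).add (h' c d)

theorem MGE.sub {k : ℤ} {M M' : Matrix (Fin N) (Fin N) (WAlg K N p)} (h : MGE k M)
    (h' : MGE k M') : MGE k (M - M') := fun c d => (h c d).sub (h' c d)

theorem MGE.smul {k : ℤ} {M : Matrix (Fin N) (Fin N) (WAlg K N p)} (h : MGE k M) (r : K) :
    MGE k (r • M) := fun c d => (h c d).smul r

/-- The weights one and two satisfy `wt(c,e) + wt(e,d) ≥ wt(c,d) + 1`. Hence every further letter of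
a word gains at least one unit. -/
theorem MGE.mul {k k' : ℤ} {M M' : Matrix (Fin N) (Fin N) (WAlg K N p)} (h : MGE k M)
    (h' : MGE k' M') : MGE (k + k' + 1) (M * M') := fun c d => by
  rw [Matrix.mul_apply]
  refine WGE.sum _ fun e _ => ((h c e).mul (h' e d)).mono ?_
  have h1 := entryWt_bounds c e
  have h2 := entryWt_bounds e d
  have h3 := entryWt_bounds c d
  by_cases h4 : c = e
  · subst h4
    rw [entryWt_self]; push_cast; omega
  · by_cases h5 : e = d
    · subst h5
      rw [entryWt_self]; push_cast; omega
    · rw [entryWt_of_ne h4, entryWt_of_ne h5]; push_cast; omega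

theorem mge_genW (j : ℕ) : MGE 0 (genW K N p j) := fun c d => by
  rw [genW, Matrix.of_apply]
  split_ifs with h
  · rw [add_zero]
    exact wge_X (⟨j, h⟩, c, d)
  · exact wge_zero _

theorem mge_single_mul {k : ℤ} {M : Matrix (Fin N) (Fin N) (WAlg K N p)} (h : MGE k M) (b : Fin N) :
    MGE k (Matrix.single b b 1 * M) := fun c d => by
  rw [single_mul_apply_kd, kd]
  split_ifs with h1
  · subst h1
    rw [one_mul]
    exact h c d
  · rw [zero_mul]
    exact wge_zero _

theorem mge_mul_single {k : ℤ} {M : Matrix (Fin N) (Fin N) (WAlg K N p)} (h : MGE k M) (b : Fin N) :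
    MGE k (M * Matrix.single b b 1) := fun c d => by
  rw [mul_single_apply_kd, kd]
  split_ifs with h1
  · subst h1
    rw [mul_one]
    exact h c _
  · rw [mul_zero]
    exact wge_zero _

theorem mge_zero (k : ℤ) : MGE k (0 : Matrix (Fin N) (Fin N) (WAlg K N p)) := fun _ _ => wge_zero _

theorem mge_one : MGE (-1) (1 : Matrix (Fin N) (Fin N) (WAlg K N p)) := fun c d => by
  rw [Matrix.one_apply]
  split_ifs with h
  · subst h
    rw [entryWt_self]
    exact wge_of_nonpos (by simp) _
  · exact wge_zero _

theorem mge_word {n : ℕ} (s : Fin n → ℕ) : MGE ((n : ℤ) - 1) (word (genW K N p) s) := by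
  induction n with
  | zero => simpa [word] using mge_one
  | succ n ih =>
    rw [word_cons]
    exact ((mge_genW (s 0)).mul (ih (Fin.tail s))).mono (by push_cast; omega)

theorem mge_of_mem_wordSpan {c w : ℕ} {M : Matrix (Fin N) (Fin N) (WAlg K N p)}
    (h : M ∈ wordSpan K (genW K N p) c w) : MGE ((c : ℤ) - 1) M := by
  induction h using Submodule.span_induction with
  | mem x hx =>
    obtain ⟨n, s, h1, -, rfl⟩ := hx
    exact (mge_word s).mono (by omega)
  | zero => exact mge_zero _
  | add x y _ _ hx hy => exact hx.add hy
  | smul r x _ hx => exact hx.smul r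

theorem map_derivation_add {m n : Type*} (D : Derivation K (WAlg K N p) (WAlg K N p))
    (A B : Matrix m n (WAlg K N p)) : (A + B).map D = A.map D + B.map D :=
  Matrix.ext fun _ _ => map_add D _ _

theorem map_derivation_sub {m n : Type*} (D : Derivation K (WAlg K N p) (WAlg K N p))
    (A B : Matrix m n (WAlg K N p)) : (A - B).map D = A.map D - B.map D :=
  Matrix.ext fun _ _ => map_sub D _ _

theorem map_derivation_smul {m n : Type*} (D : Derivation K (WAlg K N p) (WAlg K N p)) (r : K)
    (A : Matrix m n (WAlg K N p)) : (r • A).map D = r • A.map D :=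
  Matrix.ext fun _ _ => D.map_smul r _

theorem mge_map_word {D : Derivation K (WAlg K N p) (WAlg K N p)} {n : ℕ} (s : Fin n → ℕ)
    (hD : ∀ i, MGE 0 ((genW K N p (s i)).map D)) :
    MGE ((n : ℤ) - 1) ((word (genW K N p) s).map D) := by
  induction n with
  | zero =>
    rw [word, List.ofFn_zero, List.prod_nil, map_derivation_one]
    exact mge_zero _
  | succ n ih =>
    rw [word_cons, map_derivation_mul]
    refine MGE.add ?_ ?_
    · exact ((hD 0).mul (mge_word (Fin.tail s))).mono (by push_cast; omega)
    · exact ((mge_genW (s 0)).mul (ih (Fin.tail s) fun i => hD i.succ)).mono (by push_cast; omega)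

theorem mge_map_of_mem_wordSpan {D : Derivation K (WAlg K N p) (WAlg K N p)} {j : ℕ}
    (hD : ∀ s < j, MGE 0 ((genW K N p s).map D)) {M : Matrix (Fin N) (Fin N) (WAlg K N p)}
    (h : M ∈ wordSpan K (genW K N p) 2 (j + 1)) : MGE 1 (M.map D) := by
  induction h using Submodule.span_induction with
  | mem x hx =>
    obtain ⟨n, s, h1, h2, rfl⟩ := hx
    refine (mge_map_word s fun i => hD _ ?_).mono (by omega)
    have := Finset.single_le_sum (f := s) (fun _ _ => Nat.zero_le _) (Finset.mem_univ i)
    omega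
  | zero =>
    have h0 : (0 : Matrix (Fin N) (Fin N) (WAlg K N p)).map D = 0 :=
      Matrix.ext fun _ _ => map_zero D
    rw [h0]
    exact mge_zero _
  | add x y _ _ hx hy =>
    rw [map_derivation_add]
    exact hx.add hy
  | smul r x _ hx =>
    rw [map_derivation_smul]
    exact hx.smul r

theorem map_word_eq_comm {D : Derivation K (WAlg K N p) (WAlg K N p)}
    {E : Matrix (Fin N) (Fin N) (WAlg K N p)} {n : ℕ} (s : Fin n → ℕ)
    (hD : ∀ i, (genW K N p (s i)).map D = comm E (genW K N p (s i))) :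
    (word (genW K N p) s).map D = comm E (word (genW K N p) s) := by
  induction n with
  | zero => simp [word, map_derivation_one, comm]
  | succ n ih =>
    rw [word_cons, map_derivation_mul, hD, ih (Fin.tail s) fun i => hD i.succ]
    simp only [comm]
    noncomm_ring

theorem map_eq_comm_of_mem_wordSpan {D : Derivation K (WAlg K N p) (WAlg K N p)} {j : ℕ}
    {E : Matrix (Fin N) (Fin N) (WAlg K N p)}
    (hD : ∀ s < j, (genW K N p s).map D = comm E (genW K N p s))
    {M : Matrix (Fin N) (Fin N) (WAlg K N p)}
    (h : M ∈ wordSpan K (genW K N p) 2 (j + 1)) : M.map D = comm E M := by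
  induction h using Submodule.span_induction with
  | mem x hx =>
    obtain ⟨n, s, h1, h2, rfl⟩ := hx
    refine map_word_eq_comm s fun i => hD _ ?_
    have := Finset.single_le_sum (f := s) (fun _ _ => Nat.zero_le _) (Finset.mem_univ i)
    omega
  | zero =>
    have h0 : (0 : Matrix (Fin N) (Fin N) (WAlg K N p)).map D = 0 :=
      Matrix.ext fun _ _ => map_zero D
    rw [h0]
    simp [comm]
  | add x y _ _ hx hy => rw [map_derivation_add, comm_add_right, hx, hy]
  | smul r x _ hx =>
    rw [map_derivation_smul, hx, comm, comm, Matrix.mul_smul, Matrix.smul_mul, smul_sub]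

theorem genW_eq_zero {j : ℕ} (hj : p ≤ j) : genW K N p j = 0 :=
  Matrix.ext fun a b => by rw [genW, Matrix.of_apply, dif_neg (by omega)]; rfl

/-- A family of the form `c_j W_j` plus words of length at least two. -/
structure IsTriangular (C : ℕ → Matrix (Fin N) (Fin N) (WAlg K N p)) (c : ℕ → K) : Prop where
  ne_zero : ∀ j < p, c j ≠ 0
  sub_mem : ∀ j, C j - c j • genW K N p j ∈ wordSpan K (genW K N p) 2 (j + 1)

/-- `ad E` satisfies the Leibniz rule on words, so the action descends from `C_j` to `W_j` by
induction on `j`. -/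
theorem IsTriangular.map_genW_eq_comm {C : ℕ → Matrix (Fin N) (Fin N) (WAlg K N p)} {c : ℕ → K}
    (hC : IsTriangular C c) {D : Derivation K (WAlg K N p) (WAlg K N p)}
    {E : Matrix (Fin N) (Fin N) (WAlg K N p)} (hD : ∀ j, (C j).map D = comm E (C j)) (j : ℕ) :
    (genW K N p j).map D = comm E (genW K N p j) := by
  induction j using Nat.strong_induction_on with
  | _ j ih =>
  by_cases hj : j < p
  · have h1 := map_eq_comm_of_mem_wordSpan ih (hC.sub_mem j)
    have h2 : ∀ A B : Matrix (Fin N) (Fin N) (WAlg K N p), comm E (A - B) = comm E A - comm E B := by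
      intro A B; simp only [comm]; noncomm_ring
    have h3 : comm E (c j • genW K N p j) = c j • comm E (genW K N p j) := by
      rw [comm, comm, Matrix.mul_smul, Matrix.smul_mul, smul_sub]
    rw [map_derivation_sub, hD, h2, sub_right_inj, map_derivation_smul, h3] at h1
    exact smul_right_injective _ (hC.ne_zero j hj) h1
  · rw [genW_eq_zero (by omega)]
    have h0 : (0 : Matrix (Fin N) (Fin N) (WAlg K N p)).map D = 0 :=
      Matrix.ext fun _ _ => map_zero D
    rw [h0]
    simp [comm]

/-- Up to one more unit of weight, `C_j` is `c_j W_j` and the quadratic terms of the bracket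
disappear, so the derivation is the shift `W_j ↦ W_{j+1}` composed with `ad E_{bb}`. -/
theorem IsTriangular.mge_map_genW_sub {C : ℕ → Matrix (Fin N) (Fin N) (WAlg K N p)} {c : ℕ → K}
    (hC : IsTriangular C c) {D : Derivation K (WAlg K N p) (WAlg K N p)} {b : Fin N}
    (hD : ∀ j, (C j).map D = comm (Matrix.single b b 1) (C (j + 1)) +
      C 0 * Matrix.single b b 1 * C j - C j * Matrix.single b b 1 * C 0) (j : ℕ) :
    MGE 1 ((genW K N p j).map D -
      (c (j + 1) / c j) • comm (Matrix.single b b 1) (genW K N p (j + 1))) := by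
  have hC0 : ∀ j, MGE 0 (C j) := by
    intro j
    have h1 := ((mge_of_mem_wordSpan (hC.sub_mem j)).mono (k' := 0) (by norm_num)).add
      ((mge_genW j).smul (c j))
    rwa [sub_add_cancel] at h1
  have hcomm : ∀ {k : ℤ} {M : Matrix (Fin N) (Fin N) (WAlg K N p)}, MGE k M →
      MGE k (comm (Matrix.single b b 1) M) := fun h =>
    (mge_single_mul h b).sub (mge_mul_single h b)
  induction j using Nat.strong_induction_on with
  | _ j ih =>
  by_cases hj : j < p
  · have ih' : ∀ s < j, MGE 0 ((genW K N p s).map D) := by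
      intro s hs
      have h1 := ((ih s hs).mono (k' := 0) (by norm_num)).add
        ((hcomm (mge_genW (s + 1))).smul (c (s + 1) / c s))
      rwa [sub_add_cancel] at h1
    have h1 := mge_map_of_mem_wordSpan ih' (hC.sub_mem j)
    rw [map_derivation_sub, map_derivation_smul, hD] at h1
    have h2 : MGE 1 (comm (Matrix.single b b 1) (C (j + 1) - c (j + 1) • genW K N p (j + 1))) :=
      hcomm ((mge_of_mem_wordSpan (hC.sub_mem (j + 1))).mono (by norm_num))
    have h3 : MGE 1 (C 0 * Matrix.single b b 1 * C j) :=
      ((mge_mul_single (hC0 0) b).mul (hC0 j)).mono (by norm_num)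
    have h4 : MGE 1 (C j * Matrix.single b b 1 * C 0) :=
      ((mge_mul_single (hC0 j) b).mul (hC0 0)).mono (by norm_num)
    have h5 := (((h2.add h3).sub h4).sub h1).smul (c j)⁻¹
    have h6 : comm (Matrix.single b b 1) (C (j + 1) - c (j + 1) • genW K N p (j + 1)) =
        comm (Matrix.single b b 1) (C (j + 1)) -
          c (j + 1) • comm (Matrix.single b b 1) (genW K N p (j + 1)) := by
      simp only [comm, mul_sub, sub_mul, Matrix.mul_smul, Matrix.smul_mul, smul_sub]
      abel
    rw [h6] at h5
    convert h5 using 1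
    have h7 := hC.ne_zero j hj
    rw [div_eq_inv_mul, ← smul_smul, ← smul_right_injective _ h7 |>.eq_iff]
    simp only [smul_sub, smul_inv_smul₀ h7]
    abel
  · rw [genW_eq_zero (by omega), genW_eq_zero (by omega)]
    have h0 : (0 : Matrix (Fin N) (Fin N) (WAlg K N p)).map D -
        (c (j + 1) / c j) • comm (Matrix.single b b 1) 0 = 0 :=
      Matrix.ext fun _ _ => by simp [comm]
    rw [h0]
    exact mge_zero _

end Weights

end FiniteW

end

noncomputable section

namespace FiniteW

/-! ### Elements annihilated by the brackets with `W̄_0` and `W̄_1`. -/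

section Invariants

variable {K : Type*} [Field K] {N p : ℕ}

/-- The leading part of the derivation `{W̄_1^{bb}, ·}` with respect to the weight. -/
def shiftDer (N p : ℕ) (c : ℕ → K) (b : Fin N) : Derivation K (WAlg K N p) (WAlg K N p) :=
  MvPolynomial.mkDerivation K fun y =>
    (c (y.1 + 1) / c y.1 * ((if y.2.1 = b then 1 else 0) - (if y.2.2 = b then 1 else 0))) •
      genW K N p (y.1 + 1) y.2.1 y.2.2

/-- The derivation sending `W_j^{ba}` to a multiple of `W_{j+k}^{aa} - W_{j+k}^{bb}`; for `k = 0`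
it is the leading part of `{W̄_0^{ab}, ·}`. -/
def rootDer (N p : ℕ) (c : ℕ → K) (a b : Fin N) (k : ℕ) :
    Derivation K (WAlg K N p) (WAlg K N p) :=
  MvPolynomial.mkDerivation K fun y =>
    if y.2 = (b, a) then
      (c (y.1 + k) / c y.1) • (genW K N p (y.1 + k) a a - genW K N p (y.1 + k) b b)
    else 0

theorem genW_val (y : Fin p × Fin N × Fin N) :
    genW K N p y.1 y.2.1 y.2.2 = MvPolynomial.X y := by
  rw [genW, Matrix.of_apply, dif_pos y.1.2]

theorem shiftDer_genW (c : ℕ → K) (b : Fin N) (j : ℕ) (e d : Fin N) :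
    shiftDer N p c b (genW K N p j e d) =
      (c (j + 1) / c j * ((if e = b then 1 else 0) - (if d = b then 1 else 0))) •
        genW K N p (j + 1) e d := by
  by_cases hj : j < p
  · rw [genW_val (⟨j, hj⟩, e, d), shiftDer, MvPolynomial.mkDerivation_X]
  · rw [genW_eq_zero (by omega), genW_eq_zero (by omega), Matrix.zero_apply, map_zero, smul_zero]

theorem rootDer_genW (c : ℕ → K) (a b : Fin N) (k j : ℕ) (e d : Fin N) :
    rootDer N p c a b k (genW K N p j e d) = if (e, d) = (b, a) then
      (c (j + k) / c j) • (genW K N p (j + k) a a - genW K N p (j + k) b b) else 0 := by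
  by_cases hj : j < p
  · rw [genW_val (⟨j, hj⟩, e, d), rootDer, MvPolynomial.mkDerivation_X]
  · rw [genW_eq_zero (by omega), genW_eq_zero (by omega), Matrix.zero_apply, map_zero,
      Matrix.zero_apply, Matrix.zero_apply, sub_zero, smul_zero, ite_self]

theorem wge_genW (j : ℕ) (e d : Fin N) : WGE (entryWt e d : ℕ) (genW K N p j e d) :=
  (mge_genW j e d).mono (by simp)

theorem wge_shiftDer (c : ℕ → K) (b : Fin N) {n : ℤ} {f : WAlg K N p} (hf : WGE n f) :
    WGE n (shiftDer N p c b f) := by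
  have h := WGE.derivation (D := shiftDer N p c b) (s := 0) (fun y => by
    rw [← genW_val, shiftDer_genW, add_zero]
    exact (wge_genW _ _ _).smul _) hf
  rwa [add_zero] at h

theorem wge_rootDer (c : ℕ → K) {a b : Fin N} (hab : a ≠ b) (k : ℕ) {n : ℤ} {f : WAlg K N p}
    (hf : WGE n f) : WGE (n - 1) (rootDer N p c a b k f) := by
  refine WGE.derivation (D := rootDer N p c a b k) (s := -1) (fun y => ?_) hf
  rw [← genW_val, rootDer_genW]
  split_ifs with h
  · have h1 := congrArg Prod.fst h
    have h2 := congrArg Prod.snd h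
    simp only at h1 h2
    have h3 : ∀ e : Fin N, WGE 1 (genW K N p (y.1 + k) e e) := fun e =>
      (wge_genW _ e e).mono (by rw [entryWt_self]; rfl)
    rw [h1, h2, entryWt_of_ne hab.symm]
    exact ((h3 a).sub (h3 b)).smul _
  · exact wge_zero _

/-- On `W_j^{ba}` the shift multiplies by `c_{j+1}/c_j` and the ratios compose; on diagonal
variables it vanishes. So commutators with the shift produce all `rootDer` from the one with `k =
0`. -/
theorem rootDer_succ (c : ℕ → K) (hc : ∀ j < p, c j ≠ 0) {a b : Fin N} (hab : a ≠ b) (k : ℕ)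
    (f : WAlg K N p) :
    rootDer N p c a b (k + 1) f =
      rootDer N p c a b k (shiftDer N p c b f) - shiftDer N p c b (rootDer N p c a b k f) := by
  rw [← Derivation.commutator_apply]
  congr 1
  refine MvPolynomial.derivation_ext fun y => ?_
  rw [Derivation.commutator_apply, ← genW_val, shiftDer_genW, Derivation.map_smul, rootDer_genW,
    rootDer_genW, rootDer_genW]
  by_cases h : (y.2.1, y.2.2) = (b, a)
  · have h1 := congrArg Prod.fst h
    have h2 := congrArg Prod.snd h
    simp only at h1 h2
    rw [if_pos h, if_pos h, if_pos h, Derivation.map_smul, map_sub, shiftDer_genW, shiftDer_genW,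
      h1, h2]
    simp only [if_neg hab, if_true, sub_self, sub_zero, mul_zero, zero_smul, smul_zero, mul_one,
      smul_smul]
    by_cases hj : (y.1 : ℕ) + 1 < p
    · rw [show (y.1 : ℕ) + 1 + k = y.1 + (k + 1) by ring]
      congr 1
      have h3 := hc _ hj
      field_simp
    · rw [genW_eq_zero (show p ≤ (y.1 : ℕ) + 1 + k by omega),
        genW_eq_zero (show p ≤ (y.1 : ℕ) + (k + 1) by omega)]
      simp
  · rw [if_neg h, if_neg h, if_neg h, map_zero, smul_zero, sub_zero]

/-- If both derivations raise the weight of `z` by one more than they have to, so do the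
partial derivatives of `z` in the off-diagonal directions. -/
theorem WGE.pderiv_of_derivations {c : ℕ → K} (hc : ∀ j < p, c j ≠ 0) {a b : Fin N} (hab : a ≠ b)
    {n : ℤ} {z : WAlg K N p} (h0 : WGE n (rootDer N p c a b 0 z))
    (h1 : WGE (n + 1) (shiftDer N p c b z)) (j : Fin p) :
    WGE (n - 1) (MvPolynomial.pderiv (j, b, a) z) := by
  have hk : ∀ k, WGE n (rootDer N p c a b k z) := by
    intro k
    induction k with
    | zero => exact h0
    | succ k ih =>
      rw [rootDer_succ c hc hab]
      exact ((wge_rootDer c hab k h1).mono (by omega)).sub (wge_shiftDer c b ih)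
  obtain ⟨j, hj⟩ := j
  induction j using Nat.strong_induction_on with
  | _ j ih =>
  -- With this `k` the index `j` is shifted to the last one, `p - 1`. Indices above `j` are shifted
  -- out of range and those below are covered by induction, which isolates `(W_{p-1}^{aa} -
  -- W_{p-1}^{bb}) ∂z`.
  have h2 := hk (p - 1 - j)
  rw [derivation_apply_eq_sum, ← Finset.add_sum_erase _ _ (Finset.mem_univ (⟨j, hj⟩, b, a))] at h2
  have h3 : WGE n (∑ y ∈ Finset.univ.erase ((⟨j, hj⟩, b, a) : Fin p × Fin N × Fin N),
      rootDer N p c a b (p - 1 - j) (MvPolynomial.X y) * MvPolynomial.pderiv y z) := by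
    refine WGE.sum _ fun y hy => ?_
    obtain ⟨⟨i, hi⟩, e, d⟩ := y
    rw [← genW_val, rootDer_genW]
    split_ifs with h
    · obtain ⟨rfl, rfl⟩ := Prod.mk.inj h
      have hij : i ≠ j := by
        rintro rfl
        simp at hy
      rcases lt_or_gt_of_ne hij with hij | hij
      · have h4 : ∀ e : Fin N, WGE 1 (genW K N p (i + (p - 1 - j)) e e) := fun e =>
          (wge_genW _ e e).mono (by rw [entryWt_self]; rfl)
        exact ((((h4 _).sub (h4 _)).smul _).mul (ih i hij hi)).mono (by omega)
      · rw [genW_eq_zero (by simp only; omega)]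
        simpa using wge_zero n
    · rw [zero_mul]
      exact wge_zero n
  have h4 := h2.sub h3
  rw [add_sub_cancel_right, ← genW_val, rootDer_genW, if_pos rfl] at h4
  simp only [show j + (p - 1 - j) = p - 1 by omega] at h4
  have hp : p - 1 < p := by omega
  rw [genW_val (⟨p - 1, hp⟩, a, a), genW_val (⟨p - 1, hp⟩, b, b), smul_mul_assoc] at h4
  have h5 := h4.smul (c (p - 1) / c j)⁻¹
  rw [inv_smul_smul₀ (div_ne_zero (hc _ hp) (hc _ hj))] at h5
  exact h5.of_sub_mul (by simp [hab]) rfl rfl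

/-- Every monomial of `z` contains an off-diagonal variable. -/
def IsOffDiag (z : WAlg K N p) : Prop :=
  ∀ m, MvPolynomial.coeff m z ≠ 0 → ∃ y : Fin p × Fin N × Fin N, y.2.1 ≠ y.2.2 ∧ m y ≠ 0

/-- A monomial of weight at most `n` contains an off-diagonal variable, of weight two; removing it
leaves weight at most `n - 2`, where the derivative vanishes. Its coefficient there is a positive
integer multiple of the original one. -/
theorem IsOffDiag.wge_succ [CharZero K] {z : WAlg K N p} (hz : IsOffDiag z) {n : ℤ}
    (h : ∀ a b : Fin N, a ≠ b → ∀ j, WGE (n - 1) (MvPolynomial.pderiv (j, b, a) z)) :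
    WGE (n + 1) z := by
  intro m hm
  by_contra h0
  obtain ⟨⟨j, b, a⟩, hab, hy⟩ := hz m h0
  obtain ⟨m', rfl⟩ : ∃ m', m = m' + Finsupp.single (j, b, a) 1 := by
    refine ⟨m - Finsupp.single (j, b, a) 1, ?_⟩
    rw [tsub_add_cancel_of_le]
    rw [Finsupp.single_le_iff]
    omega
  rw [monWt_add, monWt_single, entryWt_of_ne hab] at hm
  have h1 := h a b hab.symm j m' (by push_cast at hm; omega)
  rw [MvPolynomial.coeff_pderiv] at h1
  rcases mul_eq_zero.1 h1 with h2 | h2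
  · exact h0 h2
  · have h3 : ((m' (j, b, a) + 1 : ℕ) : K) = 0 := by exact_mod_cast h2
    exact Nat.succ_ne_zero _ (Nat.cast_eq_zero.1 h3)

theorem eq_zero_of_wge {z : WAlg K N p} (h : ∀ n : ℕ, WGE n z) : z = 0 := by
  refine MvPolynomial.ext _ _ fun m => ?_
  rw [MvPolynomial.coeff_zero]
  exact h (monWt m + 1) m (by push_cast; omega)

/-- An element without purely diagonal monomials is zero if it is annihilated by
`{W̄_0^{ab}, ·}` and `{W̄_1^{bb}, ·}`. -/
theorem IsTriangular.eq_zero_of_invariant [CharZero K]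
    {C : ℕ → Matrix (Fin N) (Fin N) (WAlg K N p)} {c : ℕ → K}
    (hC : IsTriangular C c) {D₀ : Fin N → Fin N → Derivation K (WAlg K N p) (WAlg K N p)}
    {D₁ : Fin N → Derivation K (WAlg K N p) (WAlg K N p)}
    (hD₀ : ∀ a b j, (C j).map (D₀ a b) = comm (Matrix.single b a 1) (C j))
    (hD₁ : ∀ b j, (C j).map (D₁ b) = comm (Matrix.single b b 1) (C (j + 1)) +
      C 0 * Matrix.single b b 1 * C j - C j * Matrix.single b b 1 * C 0)
    {z : WAlg K N p} (hz : IsOffDiag z) (h0 : ∀ a b, D₀ a b z = 0) (h1 : ∀ b, D₁ b z = 0) :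
    z = 0 := by
  refine eq_zero_of_wge fun n => ?_
  induction n with
  | zero => exact wge_of_nonpos le_rfl z
  | succ n ih =>
  push_cast
  refine hz.wge_succ fun a b hab j => WGE.pderiv_of_derivations hC.ne_zero hab ?_ ?_ j
  -- `ad E_{ba}` lowers the weight only where it sends `W_j^{ba}` to a difference of diagonal
  -- variables, which is `rootDer` with `k = 0`; the remainder preserves the weight.
  · have h2 : WGE ((n : ℤ) + 0) ((D₀ a b - rootDer N p c a b 0) z) := by
      refine WGE.derivation (fun y => ?_) ih
      have h3 := congrFun (congrFun (hC.map_genW_eq_comm (hD₀ a b) y.1) y.2.1) y.2.2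
      rw [Matrix.map_apply, comm, Matrix.sub_apply, single_mul_apply_kd, mul_single_apply_kd] at h3
      rw [Derivation.sub_apply, ← genW_val, h3, rootDer_genW, kd, kd, add_zero]
      obtain ⟨j, e, d⟩ := y
      by_cases he : e = b
      · subst he
        by_cases hd : d = a
        · subst hd
          simp only [if_true, add_zero, div_self (hC.ne_zero j j.2), one_smul, one_mul,
            mul_one, sub_self]
          exact wge_zero _
        · rw [if_neg (show ¬ (e, d) = (e, a) by simp [hd])]
          simp only [if_true, if_neg (Ne.symm hd), one_mul, mul_zero, sub_zero]
          refine WGE.mono (wge_genW _ _ _) ?_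
          rw [entryWt_of_ne (Ne.symm hd)]
          exact_mod_cast (entryWt_bounds _ _).2
      · rw [if_neg (show ¬ (e, d) = (b, a) by simp [he]), sub_zero]
        simp only [if_neg he, zero_mul, zero_sub]
        split_ifs with hd
        · rw [mul_one]
          refine (WGE.mono (wge_genW _ _ _) ?_).neg
          rw [entryWt_of_ne he]
          exact_mod_cast (entryWt_bounds _ _).2
        · rw [mul_zero]
          exact (wge_zero _).neg
    rw [Derivation.sub_apply, h0, zero_sub] at h2
    simpa using h2.neg
  -- The remainder raises the weight by one (`mge_map_genW_sub`), and `D₁ b` kills `z`, so the shift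
  -- alone must raise it too.
  · have h2 : WGE ((n : ℤ) + 1) ((D₁ b - shiftDer N p c b) z) := by
      refine WGE.derivation (fun y => ?_) ih
      have h3 := hC.mge_map_genW_sub (hD₁ b) y.1 y.2.1 y.2.2
      rw [Matrix.sub_apply, Matrix.map_apply, Matrix.smul_apply, comm, Matrix.sub_apply,
        single_mul_apply_kd, mul_single_apply_kd, kd, kd] at h3
      rw [Derivation.sub_apply, ← genW_val, shiftDer_genW]
      convert h3 using 2
      rw [mul_smul]
      congr 1
      by_cases he : y.2.1 = b <;> by_cases hd : y.2.2 = b <;>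
        simp [he, hd, eq_comm (a := b)]
    rw [Derivation.sub_apply, h1, zero_sub] at h2
    simpa using h2.neg

theorem algHom_word_apply {S : Type*} [CommRing S] [Algebra K S] (f : WAlg K N p →ₐ[K] S)
    (hf : ∀ j (c d : Fin N), c ≠ d → f (genW K N p j c d) = 0) {n : ℕ} (s : Fin n → ℕ)
    (c d : Fin N) : f (word (genW K N p) s c d) =
      if c = d then ∏ i, f (genW K N p (s i) c c) else 0 := by
  induction n with
  | zero =>
    simp only [word, List.ofFn_zero, List.prod_nil, Matrix.one_apply, Finset.univ_eq_empty,
      Finset.prod_empty]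
    split_ifs <;> simp
  | succ n ih =>
    rw [word_cons, Matrix.mul_apply, map_sum, Finset.sum_eq_single c]
    · rw [map_mul, ih, Fin.prod_univ_succ, mul_ite, mul_zero]
      rfl
    · intro e _ he
      rw [map_mul, hf _ _ _ he.symm, zero_mul]
    · simp

/-- The algebra map killing all off-diagonal variables. -/
def diagProj (K : Type*) [Field K] (N p : ℕ) : WAlg K N p →ₐ[K] WAlg K N p :=
  MvPolynomial.aeval fun y => if y.2.1 = y.2.2 then MvPolynomial.X y else 0

/-- The algebra map killing all variables outside the diagonal position `a`. -/
def cornerProj (K : Type*) [Field K] (N p : ℕ) (a : Fin N) : WAlg K N p →ₐ[K] WAlg K N p :=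
  MvPolynomial.aeval fun y => if y.2.1 = a ∧ y.2.2 = a then MvPolynomial.X y else 0

theorem diagProj_genW (j : ℕ) (c d : Fin N) :
    diagProj K N p (genW K N p j c d) = if c = d then genW K N p j c d else 0 := by
  by_cases hj : j < p
  · rw [genW_val (⟨j, hj⟩, c, d), diagProj, MvPolynomial.aeval_X]
  · rw [genW_eq_zero (by omega), Matrix.zero_apply, map_zero, ite_self]

theorem cornerProj_genW (a : Fin N) (j : ℕ) (c d : Fin N) :
    cornerProj K N p a (genW K N p j c d) = if c = a ∧ d = a then genW K N p j c d else 0 := by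
  by_cases hj : j < p
  · rw [genW_val (⟨j, hj⟩, c, d), cornerProj, MvPolynomial.aeval_X]
  · rw [genW_eq_zero (by omega), Matrix.zero_apply, map_zero, ite_self]

theorem isOffDiag_of_diagProj_eq_zero {z : WAlg K N p} (hz : diagProj K N p z = 0) :
    IsOffDiag z := by
  set I := Ideal.span ((MvPolynomial.X : _ → WAlg K N p) ''
    {y : Fin p × Fin N × Fin N | y.2.1 ≠ y.2.2}) with hI
  have h : (Ideal.Quotient.mkₐ K I).comp (diagProj K N p) = Ideal.Quotient.mkₐ K I := by
    refine MvPolynomial.algHom_ext fun y => ?_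
    rw [AlgHom.comp_apply, diagProj, MvPolynomial.aeval_X]
    split_ifs with hy
    · rfl
    · rw [map_zero, eq_comm, Ideal.Quotient.mkₐ_eq_mk, Ideal.Quotient.eq_zero_iff_mem]
      exact Ideal.subset_span ⟨y, hy, rfl⟩
  have h1 := DFunLike.congr_fun h z
  rw [AlgHom.comp_apply, hz, map_zero, eq_comm, Ideal.Quotient.mkₐ_eq_mk,
    Ideal.Quotient.eq_zero_iff_mem, hI, MvPolynomial.mem_ideal_span_X_image] at h1
  intro m hm
  exact h1 m (MvPolynomial.mem_support_iff.2 hm)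

/-- Keep only the variables at position `(a,a)`: the `(b,b)` entry of a nonempty word becomes `0`.
With off-diagonal variables killed, its `(a,a)` entry involves only those variables. For a scalar
matrix both entries are `z`, so the diagonal part of `z` vanishes. -/
theorem isOffDiag_of_scalar_mem_wordSpan {w : ℕ} {z : WAlg K N p} {a b : Fin N} (hab : a ≠ b)
    (h : z • (1 : Matrix (Fin N) (Fin N) (WAlg K N p)) ∈ wordSpan K (genW K N p) 1 w) :
    IsOffDiag z := by
  have key : ∀ M ∈ wordSpan K (genW K N p) 1 w,
      diagProj K N p (M a a) = cornerProj K N p a (M a a) ∧ cornerProj K N p a (M b b) = 0 := by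
    intro M hM
    induction hM using Submodule.span_induction with
    | mem x hx =>
      obtain ⟨n, s, h1, -, rfl⟩ := hx
      rw [algHom_word_apply _ fun j c d hcd => by rw [diagProj_genW, if_neg hcd],
        algHom_word_apply _ fun j c d hcd => by
          rw [cornerProj_genW, if_neg fun h => hcd (h.1.trans h.2.symm)],
        algHom_word_apply _ fun j c d hcd => by
          rw [cornerProj_genW, if_neg fun h => hcd (h.1.trans h.2.symm)]]
      simp only [if_true, diagProj_genW, cornerProj_genW, and_self, if_neg hab.symm, true_and]
      rw [Finset.prod_const, Finset.card_univ, Fintype.card_fin, zero_pow (by omega)]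
    | zero => simp
    | add x y _ _ hx hy =>
      simp only [Matrix.add_apply, map_add, hx.1, hy.1, hx.2, hy.2, add_zero, and_self]
    | smul r x _ hx =>
      simp only [Matrix.smul_apply, map_smul, hx.1, hx.2, smul_zero, and_self]
  have h1 := key _ h
  simp only [Matrix.smul_apply, Matrix.one_apply_eq, smul_eq_mul, mul_one] at h1
  exact isOffDiag_of_diagProj_eq_zero (h1.1.trans h1.2)

end Invariants

/-! ### Uniqueness of admissible families for `N ≥ 2`. -/

section Uniqueness

variable (K : Type*) [Field K] [CharZero K] {N p : ℕ} (hp : 0 < p)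

theorem barFamily_mem (ε : ℤˣ) (j : ℕ) :
    barFamily K hp ε j ∈ wordSpan K (genW K N p) 1 (j + 1) := by
  rw [barFamily]
  split_ifs
  · exact cornerX_mem K hp j
  · exact cornerY_mem K hp j

theorem exists_isTriangular_barFamily (ε : ℤˣ) :
    ∃ c : ℕ → K, IsTriangular (barFamily K (N := N) hp ε) c := by
  rw [barFamily]
  split_ifs
  · exact ⟨_, fun j hj => leadCoeff_ne_zero K p hj, cornerX_sub_mem K N hp⟩
  · exact ⟨_, fun j hj => mul_ne_zero (pow_ne_zero _ (by simp)) (leadCoeff_ne_zero K p hj),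
      cornerY_sub_mem K hp⟩

theorem map_wDer_barFamily_zero (ε : ℤˣ) (a b : Fin N) (j : ℕ) :
    (barFamily K hp ε j).map (wDer K N p (barFamily K hp ε 0 a b)) =
      comm (Matrix.single b a 1) (barFamily K hp ε j) := by
  rw [barFamily]
  split_ifs
  · exact map_wDer_zero K hp j a b
  · have h := map_wDer_cornerY_zero K hp j a b
    rwa [← show cornerY K hp 0 = cornerX K N hp 0 from invFamily_zero _] at h

theorem map_wDer_barFamily_one (ε : ℤˣ) (b : Fin N) (j : ℕ) :
    (barFamily K hp ε j).map (wDer K N p (barFamily K hp ε 1 b b)) =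
      comm (Matrix.single b b 1) (barFamily K hp ε (j + 1)) +
        barFamily K hp ε 0 * Matrix.single b b 1 * barFamily K hp ε j -
        barFamily K hp ε j * Matrix.single b b 1 * barFamily K hp ε 0 := by
  rw [barFamily]
  split_ifs
  · exact map_wDer_one K hp j b b
  · exact map_wDer_cornerY_one K hp j b b

omit [CharZero K] in
theorem IsBarFamily.mem_wordSpan {ε : ℤˣ} {B : ℕ → Matrix (Fin N) (Fin N) (WAlg K N p)}
    (hB : IsBarFamily ε B) {j : ℕ} (hj : 2 ≤ j) : B j ∈ wordSpan K (genW K N p) 1 (j + 1) := by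
  obtain ⟨α, h⟩ := hB.words j hj
  rw [h]
  refine Submodule.sum_mem _ fun n hn => Submodule.sum_mem _ fun s hs =>
    Submodule.smul_mem _ _ (Submodule.subset_span ⟨n, s, (Finset.mem_Icc.1 hn).1, ?_, rfl⟩)
  have h1 := Finset.Nat.mem_antidiagonalTuple.1 hs
  have h2 := (Finset.mem_Icc.1 hn).2
  omega

omit [CharZero K] in
theorem IsBarFamily.wDer_zero {ε : ℤˣ} {B : ℕ → Matrix (Fin N) (Fin N) (WAlg K N p)}
    (hB : IsBarFamily ε B) (j : ℕ) (a b c d : Fin N) :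
    wDer K N p (B 0 a b) (B j c d) = kd _ c b * B j a d - kd _ a d * B j c b := by
  rw [wDer_apply, hB.bracket_zero]

/-- For `N ≥ 2` an admissible family is determined by its sign. -/
theorem IsBarFamily.eq_barFamily (hN : 2 ≤ N) {ε : ℤˣ}
    {B : ℕ → Matrix (Fin N) (Fin N) (WAlg K N p)} (hB : IsBarFamily ε B) :
    B = barFamily K hp ε := by
  set C := barFamily K (N := N) hp ε with hC
  have hCf : IsBarFamily ε C := isBarFamily_barFamily K hp ε
  have h0 : B 0 = C 0 := hB.zero.trans hCf.zero.symm
  have h1 : B 1 = C 1 := hB.one.trans hCf.one.symm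
  obtain ⟨c, hc⟩ := exists_isTriangular_barFamily K (N := N) hp ε
  let i₀ : Fin N := ⟨0, by omega⟩
  let i₁ : Fin N := ⟨1, by omega⟩
  have hi : i₀ ≠ i₁ := by simp [i₀, i₁]
  have step : ∀ j, 1 ≤ j → B j = C j → B (j + 1) = C (j + 1) := by
    intro j hj hBC
    -- Both brackets with first argument `W̄_1` and second argument `B j = C j` coincide, and their
    -- quadratic terms agree; only the terms of index `j + 1` can differ. Taking `b = c` below shows
    -- that the difference is scalar.
    have hd : ∀ a b c d : Fin N, kd _ c b * (B (j + 1) - C (j + 1)) a d =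
        kd (WAlg K N p) a d * (B (j + 1) - C (j + 1)) c b := by
      intro a b c d
      have h2 := hB.bracket_one j hj a b c d
      have h3 := hCf.bracket_one j hj a b c d
      rw [h1, hBC, h3, h0] at h2
      simp only [Matrix.sub_apply]
      linear_combination -h2
    set z := (B (j + 1) - C (j + 1)) i₀ i₀ with hz
    have hscalar : B (j + 1) - C (j + 1) = z • 1 := by
      refine Matrix.ext fun a d => ?_
      have h2 := hd a i₀ i₀ d
      rw [kd, if_pos rfl, one_mul, ← hz] at h2
      rw [h2, Matrix.smul_apply, Matrix.one_apply, kd, smul_eq_mul, mul_comm]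
    have hoff : IsOffDiag z := by
      refine isOffDiag_of_scalar_mem_wordSpan (w := j + 1 + 1) hi ?_
      rw [← hscalar]
      exact sub_mem (hB.mem_wordSpan K (by omega)) (barFamily_mem K hp ε _)
    have hdiag : ∀ b, (B (j + 1) - C (j + 1)) b b = z := by
      intro b
      rw [hscalar, Matrix.smul_apply, Matrix.one_apply_eq, smul_eq_mul, mul_one]
    have hz0 : z = 0 := by
      refine hc.eq_zero_of_invariant (map_wDer_barFamily_zero K hp ε)
        (map_wDer_barFamily_one K hp ε) hoff (fun a b => ?_) (fun b => ?_)
      · have h2 := hB.wDer_zero K (j + 1) a b a a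
        have h3 := hCf.wDer_zero K (j + 1) a b a a
        have h4 : (B (j + 1) - C (j + 1)) a b = kd _ a b * z := by
          rw [hscalar, Matrix.smul_apply, Matrix.one_apply, kd, smul_eq_mul, mul_comm]
        rw [h0] at h2
        rw [← hdiag a, Matrix.sub_apply, map_sub, h2, h3]
        have h5 := hdiag a
        rw [Matrix.sub_apply] at h4 h5
        simp only [kd, if_true] at h4 ⊢
        linear_combination (if a = b then 1 else 0) * h5 - h4
      -- With all four indices equal to `b` the right-hand side of `bracket_one` cancels, including
      -- the members of index `j + 2`, which are not yet known to agree.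
      · have h2 : wDer K N p (C 1 b b) (B (j + 1) b b) = 0 := by
          rw [← h1, wDer_apply, hB.bracket_one _ (by omega)]
          ring
        have h3 : wDer K N p (C 1 b b) (C (j + 1) b b) = 0 := by
          rw [wDer_apply, hCf.bracket_one _ (by omega)]
          ring
        rw [← hdiag b, Matrix.sub_apply, map_sub, h2, h3, sub_zero]
    rw [← sub_eq_zero, hscalar, hz0, zero_smul]
  funext j
  induction j with
  | zero => exact h0
  | succ j ih =>
    rcases Nat.eq_zero_or_pos j with rfl | hj
    · exact h1
    · exact step j hj ih

end Uniqueness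

end FiniteW

end

theorem mainTheorem9 {K : Type*} [Field K] [CharZero K] (N p : ℕ) (hN : 1 ≤ N) (hp : 1 ≤ p) :
    (∃ B : ℤˣ → ℕ → Matrix (Fin N) (Fin N) (FiniteW.WAlg K N p),
      (∀ ε, FiniteW.IsBarFamily ε (B ε) ∧ FiniteW.Generates (B ε)) ∧
      ∀ (ε : ℤˣ) (j : ℕ) (a b : Fin N),
        B ε j a b = ∑ n ∈ Finset.Icc 1 (j + 1), (-1) ^ (j + n + 1) *
          ∑ s ∈ Finset.Nat.antidiagonalTuple n (j + 1 - n), FiniteW.word (B (-ε)) s a b) ∧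
    (2 ≤ N → ∀ B : ℤˣ → ℕ → Matrix (Fin N) (Fin N) (FiniteW.WAlg K N p),
      (∀ ε, FiniteW.IsBarFamily ε (B ε)) →
      ∀ (ε : ℤˣ) (j : ℕ) (a b : Fin N),
        B ε j a b = ∑ n ∈ Finset.Icc 1 (j + 1), (-1) ^ (j + n + 1) *
          ∑ s ∈ Finset.Nat.antidiagonalTuple n (j + 1 - n), FiniteW.word (B (-ε)) s a b) := by
  have formula : ∀ (ε : ℤˣ) (j : ℕ) (a b : Fin N), FiniteW.barFamily K hp ε j a b =
      ∑ n ∈ Finset.Icc 1 (j + 1), (-1) ^ (j + n + 1) *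
        ∑ s ∈ Finset.Nat.antidiagonalTuple n (j + 1 - n),
          FiniteW.word (FiniteW.barFamily K hp (-ε)) s a b := by
    intro ε j a b
    rw [← FiniteW.invFamily_apply, ← FiniteW.barFamily_eq_invFamily]
  refine ⟨⟨FiniteW.barFamily K hp, fun ε => ⟨FiniteW.isBarFamily_barFamily K hp ε,
    FiniteW.generates_barFamily K hp ε⟩, formula⟩, fun hN' B hB ε j a b => ?_⟩
  have h : ∀ ε, B ε = FiniteW.barFamily K hp ε := fun ε => (hB ε).eq_barFamily K hp hN'
  rw [h, h]
  exact formula ε j a b
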